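/- **Setting.** Let $g:[0,1]\to\mathbb R$ satisfy $|g|\le B$, let $c>0$, $\lambda\in(0,1/4)$, let $n\ge 2$ be an integer, $p\in[0,1]$, and let $X_1,\dots,X_{2n}$ be i.i.d. Bernoulli$(p)$; $\hat p_1$ and $\hat p_2$ denote the empirical frequencies of the symbol $1$ in $X_1,\dots,X_n$ and in $X_{n+1},\dots,X_{2n}$. *Smoothness.* For an interval $I$ put $$L_g(h,I)=\sup_{x,y\in I,\ |y-x|\ge h}\frac{|g(y)-g(x)|}{|y-x|},\qquad D_g(d,I)=\inf_{\deg q\le d}\ \sup_{x\in I}|g(x)-q(x)| .$$ *Partition.* Let $c_n=c\,\frac{\log n}{n}$, $M_n=\lceil 1/\sqrt{c_n}\,\rceil$ and, for $1\le j\le M_n$, $I_j=c_n[(j-1)^2,j^2]\cap[0,1]$, $I^{**}_j=\bigcup_{|j'-j|\le 2}I_{j'}$ and $x_j=\min I^{**}_j$. For $x\in[0,1]$ let $j_x$ be the smallest $j$ with $x\in I_j$. Let $d_n=\max\{d\in\mathbb N: d\cdot 2^{4.5d+2}\le n^{\lambda}\}$. With $j'$ ranging over $[j_x-1,j_x+1]\cap[1,M_n]$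 put $$D^*_g(2n,x)=n\max_{j'}D_g(d_n,I^{**}_{j'}),\qquad L^*_g(2n,x)=\max_{j'}L_g(1/n,I^{**}_{j'}),$$ $$S^*_g(2n)=\max_{x\in[0,1]}L^*_g(2n,x)+\max_{x\in[0,1]}D^*_g(2n,x).$$ *Estimator.* For each $j\in[1,M_n]$ let $r_j$ be a polynomial of degree at most $d_n$ attaining $D_g(d_n,I^{**}_j)$, and let $\tilde g_j$ be either $r_j$ or its vertical shift $r_j+g(x_j)-r_j(x_j)$. For a polynomial $q(x)=\sum_t a_tx^t$ of degree at most $d_n$ put $$E_q(y)=\sum_t a_t\prod_{i=0}^{t-1}\frac{y-i/n}{1-i/n},$$ so that $E_q(\hat p_2)$ is unbiased for $q(p)$. With $j=j_{\hat p_1}$ and $j'=j_{\hat p_2}$ define $$\hat g(\hat p_1,\hat p_2)=\begin{cases}E_{\tilde g_{j}}(\hat p_2)&\text{if }\hat p_2\in I^{**}_{j},\\ E_{\tilde g_{j'}}(\hat p_2)&\text{otherwise.}\end{cases}$$ **Theorem.** There is an absolute constant $c_0>0$ such that for all $c\ge c_0$, $\lambda\in(0,1/4)$ and $B>0$ there are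 constants $C,\kappa>0$, depending only on $c,\lambda,B$, such that for every $n\ge2$, every $g$ on $[0,1]$ with $|g|\le B$, every choice of the polynomials $\tilde g_j$ as above, every $p\in[0,1]$ and every $\varepsilon>0$, $$\bigl|\mathbb E[\hat g(\hat p_1,\hat p_2)]-g(p)\bigr|\le C\left(\frac{p}{(2n)^3}+\frac{D^*_g(2n,p)}{2n}\right),$$ $$\mathrm{Var}(\hat g(\hat p_1,\hat p_2))\le C\left(\frac{p}{(2n)^5}+\frac{L^*_g(2n,p)^2\,p}{(2n)^{1-4\lambda}}\right),$$ $$\Pr\bigl(|\hat g(\hat p_1,\hat p_2)-\mathbb E[\hat g(\hat p_1,\hat p_2)]|>\varepsilon\bigr)\le C\exp\left(-\kappa\,\frac{\varepsilon^2(2n)^{1-2\lambda}}{S^*_g(2n)^2}\right),$$ where the last right-hand side is read as $0$ if $S^*_g(2n)=0$. -/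

import Mathlib

open MeasureTheory ProbabilityTheory Polynomial

namespace PiecewiseMinMax

noncomputable section

/-! ### Smoothness of a real function on a set -/

/-- Effective derivative `L_g(h, I)`: the supremum of the difference quotients of `g` over pairs
of points of `I` at distance at least `h`. -/
def effDeriv (g : ℝ → ℝ) (h : ℝ) (I : Set ℝ) : ℝ :=
  sSup {r : ℝ | ∃ x ∈ I, ∃ y ∈ I, h ≤ |y - x| ∧ r = |g y - g x| / |y - x|}

/-- Largest absolute deviation between `g` and the polynomial `q` on `I`. -/
def supDev (g : ℝ → ℝ) (q : ℝ[X]) (I : Set ℝ) : ℝ :=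
  sSup ((fun x => |g x - q.eval x|) '' I)

/-- Min-max deviation `D_g(d, I)` of `g` from the polynomials of degree at most `d` on `I`. -/
def minMaxDev (g : ℝ → ℝ) (d : ℕ) (I : Set ℝ) : ℝ :=
  sInf ((fun q : ℝ[X] => supDev g q I) '' {q | q.natDegree ≤ d})

/-- `q` is a degree-`d` min-max polynomial of `g` on `I`. -/
def IsMinMaxPoly (g : ℝ → ℝ) (d : ℕ) (I : Set ℝ) (q : ℝ[X]) : Prop :=
  q.natDegree ≤ d ∧ ∀ r : ℝ[X], r.natDegree ≤ d → supDev g q I ≤ supDev g r I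

/-! ### The partition of the unit interval (`n` is the size of each half of the sample) -/

/-- `c_n = c log n / n`. -/
def cn (c : ℝ) (n : ℕ) : ℝ := c * Real.log n / n

/-- Number `M_n = ⌈1 / √c_n⌉` of intervals. -/
def numIntervals (c : ℝ) (n : ℕ) : ℕ := ⌈1 / √(cn c n)⌉₊

/-- `I_j = c_n [(j-1)², j²] ∩ [0, 1]`, for `j ≥ 1`. -/
def piece (c : ℝ) (n j : ℕ) : Set ℝ :=
  Set.Icc (cn c n * ((j - 1 : ℕ) : ℝ) ^ 2) (min 1 (cn c n * (j : ℝ) ^ 2))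

/-- Left end point `x_j = c_n (j-3)² 1_{j ≥ 3}` of `I**_j` (the subtraction is truncated). -/
def leftEnd (c : ℝ) (n j : ℕ) : ℝ := cn c n * ((j - 3 : ℕ) : ℝ) ^ 2

/-- `I**_j`, the union of `I_{j'}` over `j - 2 ≤ j' ≤ j + 2`, `j' ≥ 1`. -/
def widePiece (c : ℝ) (n j : ℕ) : Set ℝ :=
  Set.Icc (leftEnd c n j) (min 1 (cn c n * ((j : ℝ) + 2) ^ 2))

/-- `j_x`: the index `j` with `x ∈ I_j` (the smaller one if `x` is a common end point). -/
def idx (c : ℝ) (n : ℕ) (x : ℝ) : ℕ := sInf {j : ℕ | 1 ≤ j ∧ x ∈ piece c n j}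

/-- The degree `d_n = max {d ∈ ℕ : d 2^{4.5 d + 2} ≤ n^λ}`. -/
def deg (lam : ℝ) (n : ℕ) : ℕ :=
  sSup {d : ℕ | (d : ℝ) * (2 : ℝ) ^ (4.5 * (d : ℝ) + 2) ≤ (n : ℝ) ^ lam}

/-- The indices of the partition lying in `[j_x - 1, j_x + 1]`. -/
def nearby (c : ℝ) (n : ℕ) (x : ℝ) : Set ℕ :=
  {j : ℕ | 1 ≤ j ∧ j ≤ numIntervals c n ∧ idx c n x ≤ j + 1 ∧ j ≤ idx c n x + 1}

/-! ### Normalized smoothness quantities for a sample of size `2 n` -/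

/-- Local min-max deviation `D*_g(2n, x)`. -/
def localDev (lam c : ℝ) (g : ℝ → ℝ) (n : ℕ) (x : ℝ) : ℝ :=
  n * sSup ((fun j => minMaxDev g (deg lam n) (widePiece c n j)) '' nearby c n x)

/-- Global min-max deviation `D*_g(2n)`. -/
def globalDev (lam c : ℝ) (g : ℝ → ℝ) (n : ℕ) : ℝ :=
  sSup (localDev lam c g n '' Set.Icc 0 1)

/-- Local effective derivative `L*_g(2n, x)`. -/
def localDeriv (c : ℝ) (g : ℝ → ℝ) (n : ℕ) (x : ℝ) : ℝ :=
  sSup ((fun j => effDeriv g (1 / n) (widePiece c n j)) '' nearby c n x)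

/-- Global effective derivative `L*_g(2n)`. -/
def globalDeriv (c : ℝ) (g : ℝ → ℝ) (n : ℕ) : ℝ :=
  sSup (localDeriv c g n '' Set.Icc 0 1)

/-- `S*_g(2n) = L*_g(2n) + D*_g(2n)`. -/
def totalDev (lam c : ℝ) (g : ℝ → ℝ) (n : ℕ) : ℝ :=
  globalDeriv c g n + globalDev lam c g n

/-! ### The estimator -/

/-- `(q_j)` is an admissible family of local approximations of `g`: each `q_j` is a degree-`d_n`
min-max polynomial of `g` on `I**_j`, possibly shifted vertically so as to agree with `g` at the
left end point of `I**_j`. -/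
def IsLocalApprox (lam c : ℝ) (g : ℝ → ℝ) (n : ℕ) (q : ℕ → ℝ[X]) : Prop :=
  ∀ j : ℕ, 1 ≤ j → j ≤ numIntervals c n →
    ∃ r : ℝ[X], IsMinMaxPoly g (deg lam n) (widePiece c n j) r ∧
      (q j = r ∨ q j = r + C (g (leftEnd c n j) - r.eval (leftEnd c n j)))

/-- The estimator of `q(p)` obtained by replacing every power `p ^ t` in `q` by its unbiased
estimator `∏_{i < t} (x - i/n) / (1 - i/n)`, where `x` is the empirical frequency of `1` among
`n` samples. -/
def unbiasedEval (n : ℕ) (q : ℝ[X]) (x : ℝ) : ℝ :=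
  ∑ t ∈ Finset.range (q.natDegree + 1),
    q.coeff t * ∏ i ∈ Finset.range t, (x - (i : ℝ) / n) / (1 - (i : ℝ) / n)

/-- The estimator `ĝ(x₁, x₂)`: `x₁` selects the interval `I_j`; the value is the unbiased
estimator, computed from `x₂`, of the piece at `x₂` of the piecewise polynomial which is `q_j` on
`I**_j` and `q_{j'}` on each other `I_{j'}`. -/
def estimator (c : ℝ) (n : ℕ) (q : ℕ → ℝ[X]) (x₁ x₂ : ℝ) : ℝ :=
  open Classical in
  if x₂ ∈ widePiece c n (idx c n x₁) then unbiasedEval n (q (idx c n x₁)) x₂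
  else unbiasedEval n (q (idx c n x₂)) x₂

/-- Empirical frequency of `1` (that is, of `true`) in the first half of the sample. -/
def freq₁ (n : ℕ) (X : Fin (n + n) → Bool) : ℝ :=
  ((Finset.univ.filter fun i : Fin n => X (Fin.castAdd n i) = true).card : ℝ) / n

/-- Empirical frequency of `1` (that is, of `true`) in the second half of the sample. -/
def freq₂ (n : ℕ) (X : Fin (n + n) → Bool) : ℝ :=
  ((Finset.univ.filter fun i : Fin n => X (Fin.natAdd n i) = true).card : ℝ) / n

/-- The estimator as a function of the sample sequence of length `2 n`. -/
def sampleEstimator (c : ℝ) (n : ℕ) (q : ℕ → ℝ[X]) (X : Fin (n + n) → Bool) : ℝ :=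
  estimator c n q (freq₁ n X) (freq₂ n X)

/-- The law of `m` independent Bernoulli(`p`) samples (`true` stands for the symbol `1`). -/
def sampleLaw (p : unitInterval) (m : ℕ) : Measure (Fin m → Bool) :=
  Measure.pi fun _ => bernoulliMeasure true false p

/-! ### Existence of min-max polynomials of bounded functions -/

theorem exists_isMinMaxPoly {g : ℝ → ℝ} {B a b : ℝ} {I : Set ℝ} (hI : I ⊆ Set.Icc a b)
    (hg : ∀ x ∈ I, |g x| ≤ B) (d : ℕ) : ∃ q : ℝ[X], IsMinMaxPoly g d I q := by
  have hpoly : ∀ q : ℝ[X], Memℓp (fun x : I => q.eval (x : ℝ)) ⊤ := by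
    intro q
    obtain ⟨K, hK⟩ := (isCompact_Icc (a := a) (b := b)).exists_bound_of_continuousOn
      q.continuous.continuousOn
    refine memℓp_infty ⟨K, ?_⟩
    rintro _ ⟨x, rfl⟩
    exact hK x (hI x.2)
  have hG : Memℓp (fun x : I => g x) ⊤ := by
    refine memℓp_infty ⟨B, ?_⟩
    rintro _ ⟨x, rfl⟩
    exact hg x x.2
  let G : lp (fun _ : I => ℝ) ⊤ := ⟨fun x : I => g x, hG⟩
  let Φ : ℝ[X] →ₗ[ℝ] lp (fun _ : I => ℝ) ⊤ :=
    { toFun := fun q => ⟨fun x : I => q.eval (x : ℝ), hpoly q⟩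
      map_add' := fun p q => by
        ext x
        exact eval_add
      map_smul' := fun r q => by ext x; simp }
  have hnorm : ∀ q : ℝ[X], ‖G - Φ q‖ = supDev g q I := by
    intro q
    rw [lp.norm_eq_ciSup, supDev, sSup_image']
    rfl
  let S : Submodule ℝ (lp (fun _ : I => ℝ) ⊤) := (degreeLT ℝ (d + 1)).map Φ
  have : FiniteDimensional ℝ (degreeLT ℝ (d + 1)) :=
    (degreeLTEquiv ℝ (d + 1)).symm.finiteDimensional
  have : FiniteDimensional ℝ S := inferInstance
  have : ProperSpace S := FiniteDimensional.proper ℝ S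
  have hcont : Continuous fun s : S => ‖G - (s : lp (fun _ : I => ℝ) ⊤)‖ := by fun_prop
  have htend : Filter.Tendsto (fun s : S => ‖G - (s : lp (fun _ : I => ℝ) ⊤)‖)
      (Filter.cocompact S) Filter.atTop := by
    refine Filter.tendsto_atTop_mono (fun s => ?_)
      (Filter.tendsto_atTop_add_const_right _ (-‖G‖) (tendsto_norm_cocompact_atTop (E := S)))
    have h := norm_sub_norm_le (s : lp (fun _ : I => ℝ) ⊤) G
    rw [norm_sub_rev] at h
    simpa [sub_eq_add_neg] using h
  obtain ⟨⟨s, hs⟩, hmin⟩ := hcont.exists_forall_le htend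
  obtain ⟨q, hq, rfl⟩ := Submodule.mem_map.1 hs
  have hdeg : ∀ r : ℝ[X], r ∈ degreeLT ℝ (d + 1) ↔ r.natDegree ≤ d := by
    intro r
    rw [mem_degreeLT, ← Nat.lt_succ_iff]
    exact ⟨fun h => Nat.lt_succ_of_le (natDegree_le_of_degree_le (Order.le_of_lt_succ h)),
      fun h => lt_of_le_of_lt degree_le_natDegree (by exact_mod_cast h)⟩
  refine ⟨q, (hdeg q).1 hq, fun r hr => ?_⟩
  rw [← hnorm q, ← hnorm r]
  exact hmin ⟨Φ r, Submodule.mem_map_of_mem ((hdeg r).2 hr)⟩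

/-- Admissible families of local approximations exist for every bounded function. -/
theorem exists_isLocalApprox {g : ℝ → ℝ} {B : ℝ} (hg : ∀ x ∈ Set.Icc (0 : ℝ) 1, |g x| ≤ B)
    (lam : ℝ) {c : ℝ} (hc : 0 < c) (n : ℕ) : ∃ q : ℕ → ℝ[X], IsLocalApprox lam c g n q := by
  have hcn : 0 ≤ cn c n := by
    unfold cn
    have := Real.log_natCast_nonneg n
    positivity
  have hI : ∀ j, widePiece c n j ⊆ Set.Icc 0 1 := fun j x hx =>
    ⟨le_trans (by unfold leftEnd; positivity) hx.1, hx.2.trans (min_le_left _ _)⟩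
  choose q hq using fun j => exists_isMinMaxPoly (hI j) (fun x hx => hg x (hI j hx)) (deg lam n)
  exact ⟨q, fun j _ _ => ⟨q j, hq j, Or.inl rfl⟩⟩

end

end PiecewiseMinMax

open PiecewiseMinMax

/-! The sample matters only through its two counts of ones. `binomExp` conditions on one sample at a
time, so that most probabilistic facts become inductions on the number of samples.

Unbiased estimation. The unbiased estimator of `(p - x₀) ^ v` is the normalised `v`-th elementary
symmetric polynomial of the centred samples `X_i - x₀`, that is, `krawtchouk` over a binomial
coefficient. Its three-term recurrence bounds it by `(2l)^v` while the frequency stays in an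
interval `[x₀, x₀ + l]` that is long in the sense of `IsLong`. Chebyshev polynomials have extremal
derivatives at 1, whence `∑ |a_v| (2l)^v ≤ 10^d sup |q|` for the Taylor coefficients `a_v` of `q` at
`x₀`. Together: for frequencies in the interval, the unbiased estimator of `q(p)` is at most `10^d
sup |q|` and changes by at most `d 10^d sup |q| / (n l)` when one sample changes; expanding at `p`
instead, its variance is at most `(10^d sup |q|)^2 * 2dp / (n l^2)`. The choice of `d_n` gives `d
10^d ≤ n^λ`.

Partition. On the square root scale the intervals form a uniform grid of mesh `√c_n`, and a
frequency deviates from `p` by more than half a mesh only with probability at most `100 p^2 / n^20`.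
Otherwise its index is within one of that of `p`. Quadratic spacing also makes every union of entire
intervals long.

Bias: for typical frequencies the estimator is the unbiased estimator of `q_j(p)`, with `|q_j(p) -
g(p)|` at most twice the min-max deviation. Variance: after subtraction of a constant, `q_j` has
size of order `L l` on `I**_j`, so that `l` cancels. Switching to a neighbouring polynomial costs at
most order `n^λ L c_n i`, where `c_n i^2` is of order `p`; if `p` is too small for this, both
indices are 1 and nothing is switched. Concentration: two approximations with overlapping domains
have close estimators on the overlap, so the estimator has differences of order `n^λ S / n` in each
sample, and a bounded differences inequality applies. -/

namespace PiecewiseMinMax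

noncomputable section

/-! ### Expectation under the binomial distribution -/

/-- Expectation of `f K` for a binomial variable `K` with parameters `n` and `p`. -/
def binomExp (p : ℝ) : ℕ → (ℕ → ℝ) → ℝ
  | 0, f => f 0
  | n + 1, f => p * binomExp p n (fun k => f (k + 1)) + (1 - p) * binomExp p n f

theorem binomExp_zero (p : ℝ) (f : ℕ → ℝ) : binomExp p 0 f = f 0 := rfl

theorem binomExp_succ (p : ℝ) (n : ℕ) (f : ℕ → ℝ) :
    binomExp p (n + 1) f = p * binomExp p n (fun k => f (k + 1)) + (1 - p) * binomExp p n f := rfl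

theorem binomExp_add (p : ℝ) (n : ℕ) (f g : ℕ → ℝ) :
    binomExp p n (fun k => f k + g k) = binomExp p n f + binomExp p n g := by
  induction n generalizing f g with
  | zero => rfl
  | succ n ih => simp only [binomExp_succ, ih]; ring

theorem binomExp_const_mul (p : ℝ) (n : ℕ) (a : ℝ) (f : ℕ → ℝ) :
    binomExp p n (fun k => a * f k) = a * binomExp p n f := by
  induction n generalizing f with
  | zero => rfl
  | succ n ih => simp only [binomExp_succ, ih]; ring

theorem binomExp_const (p : ℝ) (n : ℕ) (a : ℝ) : binomExp p n (fun _ => a) = a := by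
  induction n with
  | zero => rfl
  | succ n ih => simp only [binomExp_succ, ih]; ring

theorem binomExp_sub (p : ℝ) (n : ℕ) (f g : ℕ → ℝ) :
    binomExp p n (fun k => f k - g k) = binomExp p n f - binomExp p n g := by
  have h := binomExp_add p n f (fun k => (-1) * g k)
  rw [binomExp_const_mul] at h
  rw [show (fun k => f k - g k) = fun k => f k + (-1) * g k by funext k; ring, h]
  ring

theorem binomExp_sum {ι : Type*} (p : ℝ) (n : ℕ) (s : Finset ι) (f : ι → ℕ → ℝ) :
    binomExp p n (fun k => ∑ i ∈ s, f i k) = ∑ i ∈ s, binomExp p n (f i) := by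
  classical
  induction s using Finset.induction_on with
  | empty => simpa using binomExp_const p n 0
  | insert i s hi ih =>
    simp only [Finset.sum_insert hi]
    rw [binomExp_add, ih]

section Bounds

variable {p : ℝ}

theorem binomExp_mono (hp0 : 0 ≤ p) (hp1 : p ≤ 1) {n : ℕ} {f g : ℕ → ℝ}
    (h : ∀ k ≤ n, f k ≤ g k) : binomExp p n f ≤ binomExp p n g := by
  induction n generalizing f g with
  | zero => exact h 0 le_rfl
  | succ n ih =>
    rw [binomExp_succ, binomExp_succ]
    have h1 : binomExp p n (fun k => f (k + 1)) ≤ binomExp p n (fun k => g (k + 1)) :=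
      ih fun k hk => h _ (by omega)
    have h2 : binomExp p n f ≤ binomExp p n g := ih fun k hk => h _ (by omega)
    have := sub_nonneg.2 hp1
    gcongr

theorem binomExp_congr {n : ℕ} {f g : ℕ → ℝ}
    (h : ∀ k ≤ n, f k = g k) : binomExp p n f = binomExp p n g := by
  induction n generalizing f g with
  | zero => exact h 0 le_rfl
  | succ n ih =>
    rw [binomExp_succ, binomExp_succ, ih fun k hk => h k (by omega),
      ih (f := fun k => f (k + 1)) (g := fun k => g (k + 1)) fun k hk => h (k + 1) (by omega)]

theorem binomExp_nonneg (hp0 : 0 ≤ p) (hp1 : p ≤ 1) {n : ℕ} {f : ℕ → ℝ}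
    (h : ∀ k ≤ n, 0 ≤ f k) : 0 ≤ binomExp p n f := by
  simpa [binomExp_const] using binomExp_mono hp0 hp1 (f := fun _ => 0) h

theorem abs_binomExp_le (hp0 : 0 ≤ p) (hp1 : p ≤ 1) {n : ℕ} {f g : ℕ → ℝ}
    (h : ∀ k ≤ n, |f k| ≤ g k) : |binomExp p n f| ≤ binomExp p n g := by
  rw [abs_le]
  constructor
  · have := binomExp_mono hp0 hp1 (n := n) (f := fun k => (-1) * g k) (g := f)
      fun k hk => by linarith [(abs_le.1 (h k hk)).1]
    rw [binomExp_const_mul] at this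
    linarith
  · exact binomExp_mono hp0 hp1 fun k hk => (abs_le.1 (h k hk)).2

/-- The Cauchy–Schwarz inequality. -/
theorem binomExp_mul_sq_le (hp0 : 0 ≤ p) (hp1 : p ≤ 1) (n : ℕ) (f g : ℕ → ℝ) :
    binomExp p n (fun k => f k * g k) ^ 2
      ≤ binomExp p n (fun k => f k ^ 2) * binomExp p n (fun k => g k ^ 2) := by
  have h : ∀ x : ℝ, 0 ≤ binomExp p n (fun k => f k ^ 2) * (x * x)
      + 2 * binomExp p n (fun k => f k * g k) * x + binomExp p n (fun k => g k ^ 2) := by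
    intro x
    have h0 := binomExp_nonneg hp0 hp1 (n := n) (f := fun k => (x * f k + g k) ^ 2)
      fun k _ => sq_nonneg _
    have h1 : binomExp p n (fun k => (x * f k + g k) ^ 2)
        = binomExp p n (fun k => (x * x) * f k ^ 2 + ((2 * x) * (f k * g k) + g k ^ 2)) := by
      congr 1; funext k; ring
    rw [h1, binomExp_add, binomExp_add, binomExp_const_mul, binomExp_const_mul] at h0
    linarith
  have := discrim_le_zero h
  rw [discrim] at this
  linarith

/-- The size-bias identity. -/
theorem binomExp_natCast_mul (n : ℕ) (f : ℕ → ℝ) :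
    binomExp p (n + 1) (fun k => k * f k) = (n + 1) * p * binomExp p n (fun k => f (k + 1)) := by
  induction n generalizing f with
  | zero => simp [binomExp_succ, binomExp_zero]
  | succ n ih =>
    rw [binomExp_succ, ih]
    have h : binomExp p (n + 1) (fun k => ((k + 1 : ℕ) : ℝ) * f (k + 1))
        = binomExp p (n + 1) (fun k => (k : ℝ) * f (k + 1) + f (k + 1)) := by
      congr 1; funext k; push_cast; ring
    rw [h, binomExp_add, ih (fun k => f (k + 1)), binomExp_succ p n (fun k => f (k + 1))]
    push_cast
    ring

/-! ### Chernoff bounds for the binomial distribution. -/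

theorem binomExp_exp (p s : ℝ) (n : ℕ) :
    binomExp p n (fun k => Real.exp (s * k)) = (1 + p * (Real.exp s - 1)) ^ n := by
  induction n with
  | zero => simp [binomExp_zero]
  | succ n ih =>
    have h : (fun k : ℕ => Real.exp (s * ((k + 1 : ℕ) : ℝ)))
        = fun k : ℕ => Real.exp s * Real.exp (s * k) := by
      funext k; rw [← Real.exp_add]; congr 1; push_cast; ring
    rw [binomExp_succ, h, binomExp_const_mul, ih]
    ring

theorem binomExp_exp_le (hp0 : 0 ≤ p) (hp1 : p ≤ 1) (s : ℝ) (n : ℕ) :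
    binomExp p n (fun k => Real.exp (s * k)) ≤ Real.exp (n * (p * (Real.exp s - 1))) := by
  rw [binomExp_exp, Real.exp_nat_mul]
  refine pow_le_pow_left₀ ?_ ?_ n
  · nlinarith [Real.exp_pos s, mul_nonneg hp0 (Real.exp_pos s).le]
  · linarith [Real.add_one_le_exp (p * (Real.exp s - 1))]

open Classical in
/-- Probability that a binomial variable satisfies `P`. -/
def binomProb (p : ℝ) (n : ℕ) (P : ℕ → Prop) : ℝ := binomExp p n fun k => if P k then 1 else 0

/-- Exponential bound for one tail of the square root of an empirical frequency. -/
theorem binomProb_sqrt_tail (hp0 : 0 < p) (hp1 : p ≤ 1) {n : ℕ} (hn : 0 < n) {δ : ℝ}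
    {P : ℕ → Prop} (hu : 0 < √p + δ)
    (hP : ∀ k ≤ n, P k → 0 ≤ δ * (√((k : ℝ) / n) - (√p + δ))) :
    binomProb p n P ≤ Real.exp (-(n * δ ^ 2)) := by
  classical
  have hn' : (0 : ℝ) < n := by exact_mod_cast hn
  set u := √p with hu_def
  have hu0 : 0 < u := Real.sqrt_pos.2 hp0
  have hup : u ^ 2 = p := Real.sq_sqrt hp0.le
  -- Half of the Chernoff exponent that is optimal for the Poisson law: then `p * (exp s - 1) = u *
  -- δ`, and `s ≥ δ / (u + δ)` bounds the exponent by `n u δ - n δ (u + δ) = -n δ ^ 2`. The sign of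
  -- `δ` plays no role, so both tails are covered.
  set s := Real.log ((u + δ) / u) with hs
  have hes : Real.exp s = (u + δ) / u := Real.exp_log (div_pos hu hu0)
  have hs1 : s ≤ δ / u := by
    have := Real.log_le_sub_one_of_pos (div_pos hu hu0)
    have h2 : (u + δ) / u - 1 = δ / u := by field_simp; ring
    linarith
  have hs2 : δ / (u + δ) ≤ s := by
    have := Real.log_le_sub_one_of_pos (div_pos hu0 hu)
    have h2 : u / (u + δ) - 1 = -(δ / (u + δ)) := by field_simp; ring
    have h3 : Real.log (u / (u + δ)) = - s := by rw [hs, ← Real.log_inv, inv_div]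
    linarith
  have hmul : δ * (u + δ) ≤ s * (u + δ) ^ 2 := by
    have := mul_le_mul_of_nonneg_right hs2 (sq_nonneg (u + δ))
    have h2 : δ / (u + δ) * (u + δ) ^ 2 = δ * (u + δ) := by field_simp
    linarith
  have key : ∀ k ≤ n, (if P k then (1 : ℝ) else 0)
      ≤ Real.exp (-(n * (δ * (u + δ)))) * Real.exp (s * k) := by
    intro k hk
    split_ifs with h
    · rw [← Real.exp_add]
      refine Real.one_le_exp ?_
      have h1 := hP k hk h
      set y := √((k : ℝ) / n) with hy
      have hy0 : 0 ≤ y := Real.sqrt_nonneg _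
      have hy2 : (k : ℝ) = n * y ^ 2 := by
        rw [hy, Real.sq_sqrt (by positivity)]; field_simp
      have h3 : 0 ≤ s * (y ^ 2 - (u + δ) ^ 2) := by
        have hfac : y ^ 2 - (u + δ) ^ 2 = (y - (u + δ)) * (y + (u + δ)) := by ring
        rw [hfac, ← mul_assoc]
        refine mul_nonneg ?_ (by positivity)
        rcases lt_trichotomy δ 0 with hδ | hδ | hδ
        · have hs0 : s ≤ 0 := hs1.trans (div_nonpos_of_nonpos_of_nonneg hδ.le hu0.le)
          have : y - (u + δ) ≤ 0 := by nlinarith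
          exact mul_nonneg_of_nonpos_of_nonpos hs0 this
        · have hs0 : s = 0 := by rw [hs, hδ]; simp [hu0.ne']
          rw [hs0, zero_mul]
        · have hs0 : 0 ≤ s := le_trans (div_nonneg hδ.le hu.le) hs2
          have : 0 ≤ y - (u + δ) := nonneg_of_mul_nonneg_right h1 hδ
          exact mul_nonneg hs0 this
      have h4 : δ * (u + δ) ≤ s * y ^ 2 := by nlinarith
      rw [hy2]
      nlinarith
    · positivity
  refine (binomExp_mono hp0.le hp1 key).trans ?_
  rw [binomExp_const_mul]
  refine (mul_le_mul_of_nonneg_left (binomExp_exp_le hp0.le hp1 s n)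
    (Real.exp_pos _).le).trans ?_
  rw [← Real.exp_add]
  refine Real.exp_le_exp.2 (le_of_eq ?_)
  rw [hes, ← hup]
  field_simp
  ring

theorem binomProb_or_le (hp0 : 0 ≤ p) (hp1 : p ≤ 1) {n : ℕ} {P Q R : ℕ → Prop}
    (h : ∀ k ≤ n, P k → Q k ∨ R k) : binomProb p n P ≤ binomProb p n Q + binomProb p n R := by
  classical
  unfold binomProb
  rw [← binomExp_add]
  refine binomExp_mono hp0 hp1 fun k hk => ?_
  have := h k hk
  by_cases h1 : P k <;> by_cases h2 : Q k <;> by_cases h3 : R k <;> simp_all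

theorem binomProb_mono (hp0 : 0 ≤ p) (hp1 : p ≤ 1) {n : ℕ} {P Q : ℕ → Prop}
    (h : ∀ k ≤ n, P k → Q k) : binomProb p n P ≤ binomProb p n Q := by
  classical
  refine binomExp_mono hp0 hp1 fun k hk => ?_
  have := h k hk
  by_cases h1 : P k <;> by_cases h2 : Q k <;> simp_all

/-- Exponential bound for both tails of the square root of an empirical frequency. -/
theorem binomProb_sqrt_sub_sqrt_le (hp0 : 0 < p) (hp1 : p ≤ 1) {n : ℕ} (hn : 0 < n) {δ : ℝ}
    (hδ : 0 < δ) :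
    binomProb p n (fun k => δ < |√((k : ℝ) / n) - √p|) ≤ 2 * Real.exp (-(n * δ ^ 2)) := by
  have hup : 0 < √p := Real.sqrt_pos.2 hp0
  have h1 : binomProb p n (fun k => √p + δ < √((k : ℝ) / n)) ≤ Real.exp (-(n * δ ^ 2)) :=
    binomProb_sqrt_tail hp0 hp1 hn (by positivity) fun k _ h =>
      mul_nonneg hδ.le (sub_nonneg.2 h.le)
  have h2 : binomProb p n (fun k => √((k : ℝ) / n) < √p - δ) ≤ Real.exp (-(n * δ ^ 2)) := by
    by_cases hu : 0 < √p + -δ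
    · have := binomProb_sqrt_tail (P := fun k => √((k : ℝ) / n) < √p - δ) hp0 hp1 hn hu
        fun k _ h => mul_nonneg_of_nonpos_of_nonpos (by linarith) (by linarith)
      rwa [neg_sq] at this
    -- If `√p ≤ δ`, the lower tail event is empty.
    · refine le_trans ?_ (Real.exp_pos _).le
      have : binomProb p n (fun k => √((k : ℝ) / n) < √p - δ) ≤ binomExp p n fun _ => 0 := by
        refine binomExp_mono hp0.le hp1 fun k _ => ?_
        rw [if_neg]
        have := Real.sqrt_nonneg ((k : ℝ) / n)
        linarith
      rwa [binomExp_const] at this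
  refine (binomProb_or_le hp0.le hp1 fun k _ h => ?_).trans
    ((add_le_add h1 h2).trans_eq (two_mul _).symm)
  rcases lt_abs.1 h with h | h
  · left; linarith
  · right; linarith

/-- Tail bound with a factor `p ^ 2`, for small `p`. -/
theorem binomProb_ge_le (hp0 : 0 ≤ p) (hp1 : p ≤ 1) {n : ℕ} (hpn : n * p ≤ 1) {K : ℝ}
    (hK : 1 < K) :
    binomProb p n (fun k => K ≤ k) ≤ (n * p) ^ 2 * Real.exp (4 - K) := by
  match n with
  | 0 =>
    have : ¬ K ≤ ((0 : ℕ) : ℝ) := by push_cast; linarith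
    simp only [binomProb, binomExp_zero, if_neg this]
    positivity
  | 1 =>
    have h0 : ¬ K ≤ ((0 : ℕ) : ℝ) := by push_cast; linarith
    have h1 : ¬ K ≤ ((0 + 1 : ℕ) : ℝ) := by push_cast; linarith
    simp only [binomProb, binomExp_succ, binomExp_zero, if_neg h0, if_neg h1]
    simp only [mul_zero, add_zero]
    positivity
  | n + 2 =>
    -- The factor `k * (k - 1)` can be inserted because `K > 1` forces `k ≥ 2`; two applications of
    -- the size-bias identity turn it into the factor `(n p) ^ 2`.
    have key : ∀ k ≤ n + 2, (if K ≤ (k : ℝ) then (1 : ℝ) else 0)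
        ≤ k * (((k : ℝ) - 1) * Real.exp (k - K)) := by
      intro k _
      have hk0 : (0 : ℝ) ≤ k := k.cast_nonneg
      rcases Nat.lt_or_ge k 2 with h | h
      · have hk1 : (k : ℝ) ≤ 1 := by exact_mod_cast (by omega : k ≤ 1)
        rw [if_neg (by linarith)]
        interval_cases k <;> simp
      · have hk2 : (2 : ℝ) ≤ k := by exact_mod_cast h
        split_ifs with hKk
        · have : 1 ≤ Real.exp (k - K) := Real.one_le_exp (by linarith)
          nlinarith [mul_le_mul hk2 (by linarith : (1 : ℝ) ≤ k - 1) (by norm_num) hk0]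
        · have : 0 ≤ (k : ℝ) - 1 := by linarith
          positivity
    refine (binomExp_mono hp0 hp1 key).trans ?_
    rw [binomExp_natCast_mul (n + 1) fun k => ((k : ℝ) - 1) * Real.exp (k - K)]
    have e1 : (fun k : ℕ => (((k + 1 : ℕ) : ℝ) - 1) * Real.exp (((k + 1 : ℕ) : ℝ) - K))
        = fun k : ℕ => (k : ℝ) * Real.exp (((k + 1 : ℕ) : ℝ) - K) := by
      funext k; congr 1; push_cast; ring
    rw [e1, binomExp_natCast_mul n fun k => Real.exp (((k + 1 : ℕ) : ℝ) - K)]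
    have e2 : (fun k : ℕ => Real.exp (((k + 1 + 1 : ℕ) : ℝ) - K))
        = fun k : ℕ => Real.exp (2 - K) * Real.exp (1 * k) := by
      funext k; rw [← Real.exp_add]; congr 1; push_cast; ring
    rw [e2, binomExp_const_mul]
    have h3 := binomExp_exp_le hp0 hp1 1 n
    have h4 : (n : ℝ) * (p * (Real.exp 1 - 1)) ≤ 2 := by
      push_cast at hpn
      have := Real.exp_one_lt_d9
      have h5 : (n : ℝ) * p ≤ 1 := by nlinarith
      have h6 : (0 : ℝ) ≤ n * p := by positivity
      nlinarith
    have h5 : Real.exp (2 - K) * binomExp p n (fun k => Real.exp (1 * k)) ≤ Real.exp (4 - K) := by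
      have := h3.trans (Real.exp_le_exp.2 h4)
      refine (mul_le_mul_of_nonneg_left this (Real.exp_pos _).le).trans_eq ?_
      rw [← Real.exp_add]; congr 1; ring
    have h6 : ((n + 1 : ℕ) + 1 : ℝ) * p * ((n + 1) * p) ≤ (((n + 2 : ℕ) : ℝ) * p) ^ 2 := by
      push_cast
      have : (0 : ℝ) ≤ n := n.cast_nonneg
      nlinarith [sq_nonneg p, mul_nonneg this (sq_nonneg p)]
    rw [← mul_assoc]
    exact mul_le_mul h6 h5 (mul_nonneg (Real.exp_pos _).le
      (binomExp_nonneg hp0 hp1 fun _ _ => (Real.exp_pos _).le)) (sq_nonneg _)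

/-! ### Concentration under bounded differences -/

/-- Hoeffding's lemma for a variable with two values. -/
theorem two_point_exp_le (hp0 : 0 ≤ p) (hp1 : p ≤ 1) {a b r : ℝ} (hab : |a - b| ≤ r) :
    p * Real.exp a + (1 - p) * Real.exp b
      ≤ Real.exp (p * a + (1 - p) * b) * Real.exp (r ^ 2 / 2) := by
  have hq : 0 ≤ 1 - p := by linarith
  -- Symmetrisation: by Jensen it suffices to bound the product of the moment generating functions
  -- at `1` and `-1`, which is a convex combination of `1` and `cosh (a - b)`.
  have hj : Real.exp (-(p * a + (1 - p) * b)) ≤ p * Real.exp (-a) + (1 - p) * Real.exp (-b) := by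
    have := convexOn_exp.2 (Set.mem_univ (-a)) (Set.mem_univ (-b)) hp0 hq (by ring)
    simp only [smul_eq_mul] at this
    refine le_trans (le_of_eq ?_) this
    congr 1; ring
  have hc : Real.cosh (a - b) ≤ Real.exp (r ^ 2 / 2) := by
    refine (Real.cosh_le_exp_half_sq _).trans (Real.exp_le_exp.2 ?_)
    have := sq_abs (a - b)
    have := abs_nonneg (a - b)
    nlinarith
  have h1 : (p * Real.exp a + (1 - p) * Real.exp b)
      * (p * Real.exp (-a) + (1 - p) * Real.exp (-b)) ≤ Real.exp (r ^ 2 / 2) := by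
    refine le_trans ?_ hc
    have ha : Real.exp a * Real.exp (-a) = 1 := by rw [← Real.exp_add]; simp
    have hb : Real.exp b * Real.exp (-b) = 1 := by rw [← Real.exp_add]; simp
    have hx : Real.exp a * Real.exp (-b) = Real.exp (a - b) := by rw [← Real.exp_add]; rfl
    have hy : Real.exp b * Real.exp (-a) = Real.exp (-(a - b)) := by
      rw [← Real.exp_add]; congr 1; ring
    have hcosh := Real.cosh_eq (a - b)
    have h1c := Real.one_le_cosh (a - b)
    have e : (p * Real.exp a + (1 - p) * Real.exp b)
        * (p * Real.exp (-a) + (1 - p) * Real.exp (-b))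
        = p ^ 2 + (1 - p) ^ 2 + 2 * (p * (1 - p)) * Real.cosh (a - b) := by
      rw [hcosh, ← hx, ← hy]
      linear_combination p ^ 2 * ha + (1 - p) ^ 2 * hb
    rw [e]
    nlinarith [mul_nonneg hp0 hq, mul_nonneg (sq_nonneg p) (sub_nonneg.2 h1c),
      mul_nonneg (sq_nonneg (1 - p)) (sub_nonneg.2 h1c)]
  have hpos : 0 ≤ p * Real.exp a + (1 - p) * Real.exp b := by positivity
  have h2 := (mul_le_mul_of_nonneg_left hj hpos).trans h1
  have h3 := mul_le_mul_of_nonneg_right h2 (Real.exp_pos (p * a + (1 - p) * b)).le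
  rw [mul_assoc, ← Real.exp_add, neg_add_cancel, Real.exp_zero, mul_one] at h3
  linarith

theorem abs_binomExp_sub_le (hp0 : 0 ≤ p) (hp1 : p ≤ 1) {n : ℕ} {f g : ℕ → ℝ} {r : ℝ}
    (h : ∀ k ≤ n, |f k - g k| ≤ r) : |binomExp p n f - binomExp p n g| ≤ r := by
  rw [← binomExp_sub]
  exact (abs_binomExp_le hp0 hp1 h).trans_eq (binomExp_const p n r)

/-- McDiarmid's argument: given one sample, the two conditional means differ by at most `r`, since
the remaining samples can be taken equal. Hoeffding's lemma thus costs `r ^ 2 / 2` per sample. -/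
theorem binomExp_exp_le_of_bounded_differences (hp0 : 0 ≤ p) (hp1 : p ≤ 1) {n : ℕ} {f : ℕ → ℝ}
    {r : ℝ} (h : ∀ k < n, |f (k + 1) - f k| ≤ r) :
    binomExp p n (fun k => Real.exp (f k)) ≤ Real.exp (binomExp p n f + n * (r ^ 2 / 2)) := by
  induction n generalizing f with
  | zero => simp [binomExp_zero]
  | succ n ih =>
    have hq : 0 ≤ 1 - p := by linarith
    have h1 := ih (f := fun k => f (k + 1)) fun k hk => h (k + 1) (by omega)
    have h2 := ih (f := f) fun k hk => h k (by omega)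
    have h3 : |binomExp p n (fun k => f (k + 1)) - binomExp p n f| ≤ r :=
      abs_binomExp_sub_le hp0 hp1 fun k hk => h k (by omega)
    have h4 := two_point_exp_le hp0 hp1 h3
    rw [binomExp_succ, binomExp_succ]
    refine (add_le_add (mul_le_mul_of_nonneg_left h1 hp0)
      (mul_le_mul_of_nonneg_left h2 hq)).trans ?_
    rw [Real.exp_add, Real.exp_add]
    calc _ = (p * Real.exp (binomExp p n fun k => f (k + 1))
          + (1 - p) * Real.exp (binomExp p n f)) * Real.exp (n * (r ^ 2 / 2)) := by ring
      _ ≤ _ := mul_le_mul_of_nonneg_right h4 (Real.exp_pos _).le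
      _ = _ := by
        rw [← Real.exp_add, ← Real.exp_add]; congr 1; push_cast; ring

/-- Moment generating function of a function of two independent binomial variables, under bounded
differences. -/
theorem binomExp_binomExp_exp_le (hp0 : 0 ≤ p) (hp1 : p ≤ 1) {n : ℕ} {F : ℕ → ℕ → ℝ}
    {r : ℝ} (h1 : ∀ k < n, ∀ l ≤ n, |F (k + 1) l - F k l| ≤ r)
    (h2 : ∀ k ≤ n, ∀ l < n, |F k (l + 1) - F k l| ≤ r) :
    binomExp p n (fun k => binomExp p n fun l => Real.exp (F k l))
      ≤ Real.exp (binomExp p n (fun k => binomExp p n (F k)) + n * r ^ 2) := by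
  have ha : ∀ k ≤ n, binomExp p n (fun l => Real.exp (F k l))
      ≤ Real.exp (n * (r ^ 2 / 2)) * Real.exp (binomExp p n (F k)) := fun k hk => by
    rw [← Real.exp_add, add_comm]
    exact binomExp_exp_le_of_bounded_differences hp0 hp1 (h2 k hk)
  refine (binomExp_mono hp0 hp1 ha).trans ?_
  rw [binomExp_const_mul]
  have hb := binomExp_exp_le_of_bounded_differences hp0 hp1 (n := n)
    (f := fun k => binomExp p n (F k)) (r := r)
    fun k hk => abs_binomExp_sub_le hp0 hp1 fun l hl => h1 k hk l hl
  refine (mul_le_mul_of_nonneg_left hb (Real.exp_pos _).le).trans_eq ?_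
  rw [← Real.exp_add]; congr 1; ring

open Classical in
/-- Exponential tail bound with free parameter `t` for a function of two independent binomial
variables with differences bounded by `r`. -/
theorem binomExp_binomExp_tail_le (hp0 : 0 ≤ p) (hp1 : p ≤ 1) {n : ℕ} {F : ℕ → ℕ → ℝ}
    {r : ℝ} (h1 : ∀ k < n, ∀ l ≤ n, |F (k + 1) l - F k l| ≤ r)
    (h2 : ∀ k ≤ n, ∀ l < n, |F k (l + 1) - F k l| ≤ r) (ε : ℝ) {t : ℝ} (ht : 0 ≤ t) :
    binomExp p n (fun k => binomExp p n fun l =>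
        if ε < |F k l - binomExp p n (fun k => binomExp p n (F k))| then 1 else 0)
      ≤ 2 * Real.exp (n * (t * r) ^ 2 - t * ε) := by
  set m := binomExp p n (fun k => binomExp p n (F k)) with hm
  -- The sign `σ` treats both tails at once.
  have side : ∀ σ : ℝ, |σ| = 1 →
      binomExp p n (fun k => binomExp p n fun l => Real.exp (t * (σ * (F k l - m)) - t * ε))
        ≤ Real.exp (n * (t * r) ^ 2 - t * ε) := by
    intro σ hσ
    have e0 : ∀ x y : ℝ, |t * σ * x - t * σ * y| = t * |x - y| := fun x y => by
      rw [← mul_sub, abs_mul, abs_mul, hσ, abs_of_nonneg ht, mul_one]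
    have h := binomExp_binomExp_exp_le hp0 hp1 (n := n) (F := fun k l => t * σ * F k l)
      (r := t * r) (fun k hk l hl => by
        rw [e0]; exact mul_le_mul_of_nonneg_left (h1 k hk l hl) ht)
      (fun k hk l hl => by rw [e0]; exact mul_le_mul_of_nonneg_left (h2 k hk l hl) ht)
    simp only [binomExp_const_mul] at h
    rw [← hm] at h
    have e : (fun k => binomExp p n fun l => Real.exp (t * (σ * (F k l - m)) - t * ε))
        = fun k => Real.exp (-(t * σ * m) - t * ε)
            * binomExp p n fun l => Real.exp (t * σ * F k l) := by
      funext k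
      rw [← binomExp_const_mul]
      congr 1; funext l
      rw [← Real.exp_add]; congr 1; ring
    rw [e, binomExp_const_mul]
    refine (mul_le_mul_of_nonneg_left h (Real.exp_pos _).le).trans_eq ?_
    rw [← Real.exp_add]; congr 1; ring
  have s1 := side 1 (by simp)
  have s2 := side (-1) (by simp)
  rw [two_mul]
  refine le_trans ?_ (add_le_add s1 s2)
  rw [← binomExp_add]
  refine binomExp_mono hp0 hp1 fun k _ => ?_
  rw [← binomExp_add]
  refine binomExp_mono hp0 hp1 fun l _ => ?_
  split_ifs with hε
  · rcases lt_abs.1 hε with hε | hε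
    · have : 1 ≤ Real.exp (t * (1 * (F k l - m)) - t * ε) := Real.one_le_exp (by nlinarith)
      linarith [Real.exp_pos (t * (-1 * (F k l - m)) - t * ε)]
    · have : 1 ≤ Real.exp (t * (-1 * (F k l - m)) - t * ε) := Real.one_le_exp (by nlinarith)
      linarith [Real.exp_pos (t * (1 * (F k l - m)) - t * ε)]
  · positivity

end Bounds

/-! ### Taylor coefficients of bounded polynomials -/

/-- `T_{d+2}(5) = 10 T_{d+1}(5) - T_d(5)` and `T_d(5) ≥ 1`. The point 5 appears because the Taylor
coefficients of `T_d` at 1 are summed with weights `4 ^ v`. -/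
theorem chebyshev_T_eval_five_le (d : ℕ) :
    (Chebyshev.T ℝ d).eval 5 ≤ 10 ^ d ∧ (Chebyshev.T ℝ (d + 1)).eval 5 ≤ 10 ^ (d + 1) := by
  induction d with
  | zero => norm_num [Chebyshev.T_one]
  | succ d ih =>
    refine ⟨by exact_mod_cast ih.2, ?_⟩
    have h := Chebyshev.one_le_eval_T_real (d : ℤ) (x := 5) (by norm_num)
    have e : ((d + 1 : ℕ) : ℤ) + 1 = (d : ℤ) + 2 := by push_cast; ring
    rw [e, Chebyshev.T_add_two]
    simp only [eval_sub, eval_mul, eval_X, eval_ofNat]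
    have := ih.2
    rw [pow_succ 10 (d + 1)]
    linarith

/-- Among polynomials of degree at most `d` bounded by 1 on `[-1, 1]`, the Chebyshev polynomial
maximises every derivative at 1; this applies to `P` and to `-P`. -/
theorem taylor_coeff_le_of_forall_abs_le_one {d : ℕ} {P : ℝ[X]} (hd : P.natDegree ≤ d)
    (hP : ∀ x ∈ Set.Icc (-1 : ℝ) 1, |P.eval x| ≤ 1) (v : ℕ) :
    |(taylor 1 P).coeff v| ≤ (taylor 1 (Chebyshev.T ℝ d)).coeff v := by
  have key : ∀ Q : ℝ[X], Q.natDegree ≤ d → (∀ x ∈ Set.Icc (-1 : ℝ) 1, |Q.eval x| ≤ 1) →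
      (taylor 1 Q).coeff v ≤ (taylor 1 (Chebyshev.T ℝ d)).coeff v := by
    intro Q hQd hQ
    have h := Chebyshev.eval_iterate_derivative_le_of_forall_abs_le_one (k := v) (le_refl (1 : ℝ))
      (natDegree_le_iff_degree_le.1 hQd) hQ
    rw [← factorial_smul_hasseDeriv] at h
    rw [LinearMap.smul_apply, LinearMap.smul_apply, eval_smul, eval_smul, nsmul_eq_mul,
      nsmul_eq_mul] at h
    rw [taylor_coeff, taylor_coeff]
    exact le_of_mul_le_mul_left h (Nat.cast_pos.2 v.factorial_pos)
  refine abs_le'.2 ⟨key P hd hP, ?_⟩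
  have := key (-P) (by rwa [natDegree_neg]) fun x hx => by rw [eval_neg, abs_neg]; exact hP x hx
  simpa using this

/-- Bound for the Taylor coefficients at `x₀` of a polynomial bounded by `A` between `x₀` and
`x₀ + h`. -/
theorem sum_abs_taylor_coeff_le {d : ℕ} {q : ℝ[X]} (hd : q.natDegree ≤ d) {x₀ h A : ℝ}
    (hA : ∀ t ∈ Set.Icc (0 : ℝ) 1, |q.eval (x₀ + t * h)| ≤ A) :
    ∑ v ∈ Finset.range (d + 1), |(taylor x₀ q).coeff v| * (2 * |h|) ^ v ≤ 10 ^ d * A := by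
  -- The normalisation divides by the bound, which may vanish; the case `A = 0` is recovered by a
  -- limit.
  have main : ∀ A' : ℝ, 0 < A' → A ≤ A' →
      ∑ v ∈ Finset.range (d + 1), |(taylor x₀ q).coeff v| * (2 * |h|) ^ v ≤ 10 ^ d * A' := by
    intro A' hA' hAA'
    -- The substitution `x = 1 - 2t` carries the segment to `[-1, 1]` with `x₀` going to 1. It
    -- multiplies coefficient `v` by `(-h/2)^v`, so the weight `(2|h|)^v` becomes `4^v`.
    set r : ℝ[X] := (taylor x₀ q).comp (C (-(h / 2)) * X) with hr
    set P : ℝ[X] := C A'⁻¹ * taylor (-1) r with hP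
    have hrd : r.natDegree ≤ d := by
      refine natDegree_comp_le.trans ?_
      rw [natDegree_taylor]
      calc _ ≤ d * 1 := Nat.mul_le_mul hd ((natDegree_C_mul_le _ _).trans natDegree_X_le)
        _ = d := mul_one d
    have hPd : P.natDegree ≤ d := (natDegree_C_mul_le _ _).trans (by rwa [natDegree_taylor])
    have hPb : ∀ x ∈ Set.Icc (-1 : ℝ) 1, |P.eval x| ≤ 1 := by
      intro x hx
      have h1 := hA ((1 - x) / 2) ⟨by linarith [hx.2], by linarith [hx.1]⟩
      rw [hP, eval_mul, eval_C, taylor_eval, hr, eval_comp, eval_mul, eval_C, eval_X, taylor_eval,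
        abs_mul, abs_of_pos (inv_pos.2 hA'), inv_mul_le_iff₀ hA', mul_one]
      have e : -(h / 2) * (x + -1) + x₀ = x₀ + (1 - x) / 2 * h := by ring
      rw [e]
      exact h1.trans hAA'
    have hcoeff : ∀ v, (taylor 1 P).coeff v = A'⁻¹ * ((taylor x₀ q).coeff v * (-(h / 2)) ^ v) := by
      intro v
      rw [hP, taylor_mul, taylor_C, coeff_C_mul, taylor_taylor]
      norm_num
      left
      rw [hr, comp_C_mul_X_coeff]
    have hT : ∑ v ∈ Finset.range (d + 1), (taylor 1 (Chebyshev.T ℝ d)).coeff v * 4 ^ v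
        ≤ 10 ^ d := by
      rw [← eval_eq_sum_range' (by rw [natDegree_taylor, Chebyshev.natDegree_T]; simp), taylor_eval]
      norm_num
      exact (chebyshev_T_eval_five_le d).1
    calc _ = A' * ∑ v ∈ Finset.range (d + 1), |(taylor 1 P).coeff v| * 4 ^ v := by
          rw [Finset.mul_sum]
          refine Finset.sum_congr rfl fun v _ => ?_
          rw [hcoeff, abs_mul, abs_mul, abs_pow, abs_neg, abs_div, abs_of_pos (inv_pos.2 hA'),
            abs_two, mul_pow, div_pow, show (4 : ℝ) = 2 * 2 by norm_num, mul_pow]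
          field_simp
      _ ≤ A' * ∑ v ∈ Finset.range (d + 1), (taylor 1 (Chebyshev.T ℝ d)).coeff v * 4 ^ v := by
          gcongr with v _
          exact taylor_coeff_le_of_forall_abs_le_one hPd hPb v
      _ ≤ A' * 10 ^ d := by gcongr
      _ = 10 ^ d * A' := mul_comm _ _
  have hA0 : 0 ≤ A := (abs_nonneg _).trans (hA 0 (by simp))
  refine le_of_forall_pos_le_add fun ε hε => ?_
  have h10 : (0 : ℝ) < 10 ^ d := by positivity
  refine (main (A + ε / 10 ^ d) (by positivity)
    (by simp only [le_add_iff_nonneg_right]; positivity)).trans_eq ?_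
  field_simp

/-! ### Unbiased estimators of shifted powers -/

/-- `krawtchouk x₀ n k v` is `n.choose v` times the unbiased estimator of `(p - x₀) ^ v` when
`k` ones are observed among `n` samples. -/
def krawtchouk (x₀ : ℝ) (n k v : ℕ) : ℝ :=
  ((1 + C (1 - x₀) * X) ^ k * (1 - C x₀ * X) ^ (n - k) : ℝ[X]).coeff v

variable {x₀ : ℝ}

theorem krawtchouk_zero_right (n k : ℕ) : krawtchouk x₀ n k 0 = 1 := by
  simp [krawtchouk, coeff_zero_eq_eval_zero]

/-- The defining product has one linear factor per sample, so `krawtchouk x₀ n k v` is the `v`-th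
elementary symmetric polynomial of `k` copies of `1 - x₀` and `n - k` copies of `-x₀`; a further
sample multiplies by one more factor. -/
theorem krawtchouk_succ_succ (n k v : ℕ) :
    krawtchouk x₀ (n + 1) (k + 1) (v + 1)
      = krawtchouk x₀ n k (v + 1) + (1 - x₀) * krawtchouk x₀ n k v := by
  unfold krawtchouk
  rw [Nat.add_sub_add_right, pow_succ,
    show (1 + C (1 - x₀) * X) ^ k * (1 + C (1 - x₀) * X) * (1 - C x₀ * X) ^ (n - k)
      = (1 + C (1 - x₀) * X) ^ k * (1 - C x₀ * X) ^ (n - k)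
        + C (1 - x₀) * ((1 + C (1 - x₀) * X) ^ k * (1 - C x₀ * X) ^ (n - k) * X) by ring,
    coeff_add, coeff_C_mul, coeff_mul_X]

theorem krawtchouk_succ {n k : ℕ} (hk : k ≤ n) (v : ℕ) :
    krawtchouk x₀ (n + 1) k (v + 1) = krawtchouk x₀ n k (v + 1) - x₀ * krawtchouk x₀ n k v := by
  unfold krawtchouk
  rw [Nat.succ_sub hk, pow_succ,
    show (1 + C (1 - x₀) * X) ^ k * ((1 - C x₀ * X) ^ (n - k) * (1 - C x₀ * X))
      = (1 + C (1 - x₀) * X) ^ k * (1 - C x₀ * X) ^ (n - k)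
        - C x₀ * ((1 + C (1 - x₀) * X) ^ k * (1 - C x₀ * X) ^ (n - k) * X) by ring,
    coeff_sub, coeff_C_mul, coeff_mul_X]

/-- The two values `1 - x₀` and `-x₀` of a centred sample differ by 1, so flipping it leaves the
symmetric polynomial of the others, one degree lower. This is the source of the gain in the bounded
differences. -/
theorem krawtchouk_succ_sub {n k : ℕ} (hk : k ≤ n) (v : ℕ) :
    krawtchouk x₀ (n + 1) (k + 1) (v + 1) - krawtchouk x₀ (n + 1) k (v + 1)
      = krawtchouk x₀ n k v := by
  rw [krawtchouk_succ_succ, krawtchouk_succ hk]; ring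

theorem krawtchouk_one {n k : ℕ} (hk : k ≤ n) : krawtchouk x₀ n k 1 = k - n * x₀ := by
  induction n generalizing k with
  | zero =>
    obtain rfl : k = 0 := by omega
    simp [krawtchouk, coeff_one]
  | succ n ih =>
    rcases k with _ | k
    · rw [krawtchouk_succ (by omega), ih (by omega), krawtchouk_zero_right]; push_cast; ring
    · rw [krawtchouk_succ_succ, ih (by omega), krawtchouk_zero_right]; push_cast; ring

/-- The three-term recurrence. -/
theorem krawtchouk_add_two {n k : ℕ} (hk : k ≤ n) (v : ℕ) :
    (v + 2) * krawtchouk x₀ n k (v + 2)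
      = (k - n * x₀ - (v + 1) * (1 - 2 * x₀)) * krawtchouk x₀ n k (v + 1)
        - (n - v) * (x₀ * (1 - x₀)) * krawtchouk x₀ n k v := by
  set a : ℝ[X] := 1 + C (1 - x₀) * X with ha
  set b : ℝ[X] := 1 - C x₀ * X with hb
  set F : ℝ[X] := a ^ k * b ^ (n - k) with hF
  have hpow : ∀ (u : ℝ[X]) (m : ℕ), derivative (u ^ m) * u = C (m : ℝ) * u ^ m * derivative u := by
    intro u m
    rcases m with _ | m
    · simp
    · rw [derivative_pow, Nat.add_sub_cancel]; ring
  have da : derivative a = C (1 - x₀) := by simp [ha]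
  have db : derivative b = - C x₀ := by simp [hb]
  -- The generating function satisfies a first-order differential equation with quadratic
  -- coefficients; its coefficient of `X ^ (v + 1)` is the recurrence.
  have hode : derivative F * (a * b)
      = F * (C (k : ℝ) * C (1 - x₀) * b - C ((n : ℝ) - k) * C x₀ * a) := by
    have e1 := hpow a k
    have e2 := hpow b (n - k)
    rw [da] at e1
    rw [db, Nat.cast_sub hk] at e2
    rw [hF, derivative_mul]
    linear_combination (b ^ (n - k) * b) * e1 + (a ^ k * a) * e2
  have hab : a * b = 1 + C (1 - 2 * x₀) * X - C (x₀ * (1 - x₀)) * X * X := by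
    rw [ha, hb]; simp only [C_sub, C_mul, C_1, C_ofNat]; ring
  have hrhs : C (k : ℝ) * C (1 - x₀) * b - C ((n : ℝ) - k) * C x₀ * a
      = C (k - n * x₀) - C (n * (x₀ * (1 - x₀))) * X := by
    rw [ha, hb]; simp only [C_sub, C_mul, C_1]; ring
  rw [hab, hrhs] at hode
  have hc := congrArg (fun P : ℝ[X] => P.coeff (v + 1)) hode
  have e1 : derivative F * (1 + C (1 - 2 * x₀) * X - C (x₀ * (1 - x₀)) * X * X)
      = derivative F + C (1 - 2 * x₀) * (derivative F * X)
        - C (x₀ * (1 - x₀)) * (derivative F * X * X) := by ring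
  have e2 : F * (C (k - n * x₀) - C (n * (x₀ * (1 - x₀))) * X)
      = C (k - n * x₀) * F - C (n * (x₀ * (1 - x₀))) * (F * X) := by ring
  rw [e1, e2] at hc
  have e3 : (derivative F * X * X).coeff (v + 1) = F.coeff v * v := by
    rw [coeff_mul_X]
    rcases v with _ | v
    · simp
    · rw [coeff_mul_X, coeff_derivative]; push_cast; ring
  simp only [coeff_add, coeff_sub, coeff_C_mul, coeff_mul_X, coeff_derivative, e3] at hc
  change (v + 2 : ℝ) * F.coeff (v + 2) = (k - n * x₀ - (v + 1) * (1 - 2 * x₀)) * F.coeff (v + 1)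
    - (n - v) * (x₀ * (1 - x₀)) * F.coeff v
  push_cast at hc
  linear_combination hc

theorem binomExp_krawtchouk (p : ℝ) (n v : ℕ) :
    binomExp p n (fun k => krawtchouk p n k v) = if v = 0 then 1 else 0 := by
  rcases v with _ | v
  · simp [krawtchouk_zero_right, binomExp_const]
  induction n with
  | zero => simp [binomExp_zero, krawtchouk, coeff_one]
  | succ n ih =>
    rw [binomExp_succ]
    simp only [krawtchouk_succ_succ]
    rw [binomExp_congr fun k hk => krawtchouk_succ hk v, binomExp_add, binomExp_sub,
      binomExp_const_mul, binomExp_const_mul, ih]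
    simp only [Nat.add_eq_zero_iff, one_ne_zero, and_false, if_false]
    ring

/-- Second moment of the Krawtchouk polynomials. -/
theorem binomExp_krawtchouk_sq (p : ℝ) (n v : ℕ) :
    binomExp p n (fun k => krawtchouk p n k v ^ 2) = n.choose v * (p * (1 - p)) ^ v := by
  induction n generalizing v with
  | zero =>
    rcases v with _ | v
    · simp [binomExp_zero, krawtchouk_zero_right]
    · simp [binomExp_zero, krawtchouk, coeff_one]
  | succ n ih =>
    rcases v with _ | v
    · simp [krawtchouk_zero_right, binomExp_const]
    -- In the mixture with weights `p` and `1 - p` the cross terms of `e1` and `e2` cancel, the last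
    -- terms combine to the factor `p * (1 - p)`, and Pascal's rule concludes.
    have e1 : binomExp p n (fun k => krawtchouk p (n + 1) (k + 1) (v + 1) ^ 2)
        = binomExp p n (fun k => krawtchouk p n k (v + 1) ^ 2)
          + (2 * (1 - p) * binomExp p n (fun k => krawtchouk p n k (v + 1) * krawtchouk p n k v)
          + (1 - p) ^ 2 * binomExp p n (fun k => krawtchouk p n k v ^ 2)) := by
      rw [← binomExp_const_mul, ← binomExp_const_mul, ← binomExp_add, ← binomExp_add]
      refine binomExp_congr fun k _ => ?_
      rw [krawtchouk_succ_succ]; ring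
    have e2 : binomExp p n (fun k => krawtchouk p (n + 1) k (v + 1) ^ 2)
        = binomExp p n (fun k => krawtchouk p n k (v + 1) ^ 2)
          + (-(2 * p) * binomExp p n (fun k => krawtchouk p n k (v + 1) * krawtchouk p n k v)
          + p ^ 2 * binomExp p n (fun k => krawtchouk p n k v ^ 2)) := by
      rw [← binomExp_const_mul, ← binomExp_const_mul, ← binomExp_add, ← binomExp_add]
      refine binomExp_congr fun k hk => ?_
      rw [krawtchouk_succ hk]; ring
    rw [binomExp_succ, e1, e2, ih, ih, Nat.choose_succ_succ']
    push_cast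
    ring

theorem krawtchouk_eq_sum {n k v : ℕ} (hk : k ≤ n) :
    krawtchouk x₀ n k v = ∑ t ∈ Finset.range (v + 1),
      (k.choose t : ℝ) * ((n - t).choose (v - t) * (-x₀) ^ (v - t)) := by
  have hlin : ∀ m j : ℕ, ((1 - C x₀ * X) ^ m : ℝ[X]).coeff j = m.choose j * (-x₀) ^ j := by
    intro m j
    have : (1 - C x₀ * X : ℝ[X]) = (1 + X).comp (C (-x₀) * X) := by simp; ring
    rw [this, ← pow_comp, comp_C_mul_X_coeff, coeff_one_add_X_pow]
  -- Writing the first factor as `X + (1 - C x₀ * X)` and expanding its `k`-th power produces the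
  -- coefficients `k.choose t`, which are those of the unbiased estimators of `p ^ t`.
  have hexp : (1 + C (1 - x₀) * X : ℝ[X]) ^ k * (1 - C x₀ * X) ^ (n - k)
      = ∑ t ∈ Finset.range (k + 1), C (k.choose t : ℝ) * ((1 - C x₀ * X) ^ (n - t) * X ^ t) := by
    rw [show (1 + C (1 - x₀) * X : ℝ[X]) = X + (1 - C x₀ * X) by simp only [C_sub, C_1]; ring,
      add_pow, Finset.sum_mul]
    refine Finset.sum_congr rfl fun t ht => ?_
    have ht' : t ≤ k := by simpa [Nat.lt_succ_iff] using ht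
    rw [show n - t = (k - t) + (n - k) by omega, pow_add, C_eq_natCast]
    ring
  unfold krawtchouk
  rw [hexp, finsetSum_coeff]
  have hterm : ∀ t, (C (k.choose t : ℝ) * ((1 - C x₀ * X) ^ (n - t) * X ^ t) : ℝ[X]).coeff v
      = if t ≤ v then (k.choose t : ℝ) * ((n - t).choose (v - t) * (-x₀) ^ (v - t)) else 0 := by
    intro t
    rw [coeff_C_mul, coeff_mul_X_pow']
    split_ifs
    · rw [hlin]
    · simp
  simp only [hterm]
  rw [← Finset.sum_filter]
  refine Finset.sum_subset_zero_on_sdiff ?_ ?_ fun _ _ => rfl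
  · intro t ht; simp only [Finset.mem_filter, Finset.mem_range] at ht ⊢; omega
  · intro t ht
    simp only [Finset.mem_sdiff, Finset.mem_filter, Finset.mem_range] at ht
    rw [Nat.choose_eq_zero_of_lt (by omega)]; simp

/-- The linear functional sending `X ^ t` to the unbiased estimator of `p ^ t` when `k` ones are
observed among `n` samples. -/
def unbiasedFunctional (n k : ℕ) : ℝ[X] →ₗ[ℝ] ℝ :=
  lsum fun t => LinearMap.toSpanSingleton ℝ ℝ ((k.choose t : ℝ) / n.choose t)

theorem unbiasedFunctional_apply (n k : ℕ) (q : ℝ[X]) :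
    unbiasedFunctional n k q
      = ∑ t ∈ Finset.range (q.natDegree + 1), q.coeff t * ((k.choose t : ℝ) / n.choose t) := by
  rw [unbiasedFunctional, lsum_apply, sum_over_range]
  · simp
  · simp

theorem prod_range_frequency {n k t : ℕ} (ht : t ≤ n) :
    ∏ i ∈ Finset.range t, ((k : ℝ) / n - (i : ℝ) / n) / (1 - (i : ℝ) / n)
      = (k.choose t : ℝ) / n.choose t := by
  induction t with
  | zero => simp
  | succ t ih =>
    have hn : (n : ℝ) ≠ 0 := by exact_mod_cast (by omega : n ≠ 0)
    have hnt : (n : ℝ) - t ≠ 0 := by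
      rw [sub_ne_zero]; exact_mod_cast (by omega : n ≠ t)
    have h1 : (0 : ℝ) < n.choose t := by exact_mod_cast Nat.choose_pos (by omega)
    have h2 : (0 : ℝ) < n.choose (t + 1) := by exact_mod_cast Nat.choose_pos ht
    have e1 : (n.choose (t + 1) : ℝ) * (t + 1) = n.choose t * (n - t) := by
      have := Nat.choose_succ_right_eq n t
      rw [← Nat.cast_sub (by omega : t ≤ n)]
      exact_mod_cast this
    have e2 : (k.choose (t + 1) : ℝ) * (t + 1) = k.choose t * (k - t) := by
      rcases le_or_gt t k with h | h
      · have := Nat.choose_succ_right_eq k t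
        rw [← Nat.cast_sub h]
        exact_mod_cast this
      -- For `t > k` both sides vanish, the product having a zero factor at `i = k`.
      · rw [Nat.choose_eq_zero_of_lt h, Nat.choose_eq_zero_of_lt (by omega)]; simp
    rw [Finset.prod_range_succ, ih (by omega)]
    have e3 : ((k : ℝ) / n - (t : ℝ) / n) / (1 - (t : ℝ) / n) = (k - t) / (n - t) := by
      field_simp
    rw [e3, div_mul_div_comm, div_eq_div_iff (mul_ne_zero h1.ne' hnt) h2.ne', ← e1, ← e2]
    ring

theorem unbiasedFunctional_X_sub_C_pow {n k v : ℕ} (hk : k ≤ n) (hv : v ≤ n) :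
    unbiasedFunctional n k ((X - C x₀) ^ v) = krawtchouk x₀ n k v / n.choose v := by
  have hX : ∀ t (a : ℝ), unbiasedFunctional n k (C a * X ^ t)
      = a * ((k.choose t : ℝ) / n.choose t) := by
    intro t a
    rw [C_mul_X_pow_eq_monomial, unbiasedFunctional, lsum_apply, sum_monomial_index] <;> simp
  rw [krawtchouk_eq_sum hk, sub_eq_add_neg, add_pow, map_sum, Finset.sum_div]
  refine Finset.sum_congr rfl fun t ht => ?_
  have ht' : t ≤ v := by simpa [Nat.lt_succ_iff] using ht
  have e : (X ^ t * (-C x₀) ^ (v - t) * (v.choose t : ℝ[X]) : ℝ[X])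
      = C ((-x₀) ^ (v - t) * v.choose t) * X ^ t := by
    simp only [C_mul, C_pow, C_neg, C_eq_natCast]; ring
  rw [e, hX]
  have h1 : (0 : ℝ) < n.choose t := by exact_mod_cast Nat.choose_pos (by omega)
  have h2 : (0 : ℝ) < n.choose v := by exact_mod_cast Nat.choose_pos hv
  have h3 : (n.choose v : ℝ) * v.choose t = n.choose t * (n - t).choose (v - t) := by
    exact_mod_cast Nat.choose_mul (n := n) ht'
  field_simp
  linear_combination ((-x₀) ^ (v - t) * (k.choose t : ℝ)) * h3

/-- The unbiased estimator of `q(p)` in terms of the Taylor expansion of `q` at `x₀`. -/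
theorem unbiasedEval_eq_sum_taylor (x₀ : ℝ) {n k d : ℕ} {q : ℝ[X]} (hq : q.natDegree ≤ d)
    (hd : d ≤ n) (hk : k ≤ n) :
    unbiasedEval n q ((k : ℝ) / n) = ∑ v ∈ Finset.range (d + 1),
      (taylor x₀ q).coeff v * (krawtchouk x₀ n k v / n.choose v) := by
  have h1 : unbiasedEval n q ((k : ℝ) / n) = unbiasedFunctional n k q := by
    rw [unbiasedFunctional_apply, unbiasedEval]
    refine Finset.sum_congr rfl fun t ht => ?_
    rw [prod_range_frequency (by simp at ht; omega)]
  rw [h1]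
  conv_lhs => rw [← sum_taylor_eq q x₀]
  rw [sum_over_range' _ (by simp) (d + 1) (by rw [natDegree_taylor]; omega), map_sum]
  refine Finset.sum_congr rfl fun v hv => ?_
  rw [← smul_eq_C_mul, map_smul, unbiasedFunctional_X_sub_C_pow hk (by simp at hv; omega),
    smul_eq_mul]

/-- The sum defining `unbiasedEval` has a range depending on the degree of its argument; the Taylor
expansion with common length `n + 1` makes linearity visible. -/
theorem unbiasedEval_sub {n k : ℕ} {q r : ℝ[X]} (hq : q.natDegree ≤ n) (hr : r.natDegree ≤ n)
    (hk : k ≤ n) : unbiasedEval n (q - r) ((k : ℝ) / n)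
      = unbiasedEval n q ((k : ℝ) / n) - unbiasedEval n r ((k : ℝ) / n) := by
  rw [unbiasedEval_eq_sum_taylor 0 hq le_rfl hk, unbiasedEval_eq_sum_taylor 0 hr le_rfl hk,
    unbiasedEval_eq_sum_taylor 0 ((natDegree_sub_le _ _).trans (max_le hq hr)) le_rfl hk,
    ← Finset.sum_sub_distrib]
  refine Finset.sum_congr rfl fun v _ => ?_
  rw [map_sub, coeff_sub]; ring

/-- Expanded at `p` itself, all terms but the constant one have mean zero. -/
theorem binomExp_unbiasedEval (p : ℝ) {n : ℕ} {q : ℝ[X]} (hq : q.natDegree ≤ n) :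
    binomExp p n (fun k => unbiasedEval n q ((k : ℝ) / n)) = q.eval p := by
  rw [binomExp_congr fun k hk => unbiasedEval_eq_sum_taylor p hq le_rfl hk, binomExp_sum]
  have e : ∀ v, binomExp p n (fun k => (taylor p q).coeff v * (krawtchouk p n k v / n.choose v))
      = (taylor p q).coeff v * (n.choose v : ℝ)⁻¹ * if v = 0 then 1 else 0 := by
    intro v
    rw [← binomExp_krawtchouk p n v, ← binomExp_const_mul]
    congr 1; funext k; ring
  simp only [e]
  rw [Finset.sum_eq_single 0]
  · simp [taylor_coeff_zero]
  · intro v _ hv; simp [hv]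
  · simp

/-! ### Bounds for unbiased estimators on long intervals -/

theorem krawtchouk_div_choose_add_two (x₀ : ℝ) {n k v : ℕ} (hk : k ≤ n) (hv : v + 2 ≤ n) :
    (n - v - 1) * (krawtchouk x₀ n k (v + 2) / n.choose (v + 2))
      = (k - n * x₀ - (v + 1) * (1 - 2 * x₀)) * (krawtchouk x₀ n k (v + 1) / n.choose (v + 1))
        - (v + 1) * (x₀ * (1 - x₀)) * (krawtchouk x₀ n k v / n.choose v) := by
  have h0 : (0 : ℝ) < n.choose v := by exact_mod_cast Nat.choose_pos (by omega)
  have h1 : (0 : ℝ) < n.choose (v + 1) := by exact_mod_cast Nat.choose_pos (by omega)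
  have h2 : (0 : ℝ) < n.choose (v + 2) := by exact_mod_cast Nat.choose_pos (by omega)
  have e1 : (n.choose (v + 1) : ℝ) * (v + 1) = n.choose v * (n - v) := by
    have := Nat.choose_succ_right_eq n v
    rw [← Nat.cast_sub (by omega : v ≤ n)]
    exact_mod_cast this
  have e2 : (n.choose (v + 2) : ℝ) * (v + 2) = n.choose (v + 1) * (n - v - 1) := by
    have := Nat.choose_succ_right_eq n (v + 1)
    have h := congrArg (Nat.cast (R := ℝ)) this
    push_cast [Nat.cast_sub (by omega : v + 1 ≤ n)] at h
    linarith
  have hrec := krawtchouk_add_two (x₀ := x₀) hk v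
  have f1 : (n - v - 1) * (krawtchouk x₀ n k (v + 2) / n.choose (v + 2))
      = (v + 2) * krawtchouk x₀ n k (v + 2) / n.choose (v + 1) := by
    field_simp
    linear_combination -(krawtchouk x₀ n k (v + 2)) * e2
  have f2 : (v + 1) * (x₀ * (1 - x₀)) * (krawtchouk x₀ n k v / n.choose v)
      = (n - v) * (x₀ * (1 - x₀)) * krawtchouk x₀ n k v / n.choose (v + 1) := by
    field_simp
    linear_combination (x₀ * (1 - x₀) * krawtchouk x₀ n k v) * e1
  rw [f1, hrec, f2]
  ring

/-- Two-step induction along the normalised recurrence. With `w = (2 * l) ^ v`, its right side is at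
most `(1.1 * 2 + 0.1) n l² w`, below the available `0.9 * 4 n l² w`; the hypotheses on `d` make the
correction terms this small. -/
theorem abs_krawtchouk_div_choose_le {x₀ l : ℝ} {n k d : ℕ} (hx0 : 0 ≤ x₀) (hx1 : x₀ ≤ 1)
    (hl : 0 ≤ l) (hk : k ≤ n) (hkx : |(k : ℝ) - n * x₀| ≤ n * l) (hdn : 10 * d ≤ n)
    (hdl : (10 * d : ℝ) ≤ n * l) (hdx : 10 * d * x₀ ≤ n * l ^ 2) (v : ℕ) :
    (v ≤ d → |krawtchouk x₀ n k v / n.choose v| ≤ (2 * l) ^ v) ∧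
    (v + 1 ≤ d → |krawtchouk x₀ n k (v + 1) / n.choose (v + 1)| ≤ (2 * l) ^ (v + 1)) := by
  induction v with
  | zero =>
    refine ⟨fun _ => by simp [krawtchouk_zero_right], fun h => ?_⟩
    have hn : (0 : ℝ) < n := by exact_mod_cast (by omega : 0 < n)
    simp only [zero_add, Nat.choose_one_right, pow_one]
    rw [krawtchouk_one hk, abs_div, abs_of_pos hn, div_le_iff₀ hn]
    nlinarith
  | succ v ih =>
    refine ⟨ih.2, fun h => ?_⟩
    have i0 := ih.1 (by omega)
    have i1 := ih.2 (by omega)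
    have hrec := krawtchouk_div_choose_add_two x₀ hk (v := v) (by omega)
    set e0 := krawtchouk x₀ n k v / n.choose v
    set e1 := krawtchouk x₀ n k (v + 1) / n.choose (v + 1)
    set e2 := krawtchouk x₀ n k (v + 2) / n.choose (v + 2)
    change |e2| ≤ (2 * l) ^ (v + 2)
    have hvd : (v : ℝ) + 1 ≤ d := by exact_mod_cast (by omega : v + 1 ≤ d)
    have hdn' : (10 * d : ℝ) ≤ n := by exact_mod_cast hdn
    have hd0 : (1 : ℝ) ≤ d := by exact_mod_cast (by omega : 1 ≤ d)
    have hv0 : (0 : ℝ) ≤ v := v.cast_nonneg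
    have hw : (0 : ℝ) ≤ (2 * l) ^ v := by positivity
    set w := (2 * l) ^ v
    have hw1 : (2 * l) ^ (v + 1) = w * (2 * l) := pow_succ _ _
    have hw2 : (2 * l) ^ (v + 2) = w * (2 * l) * (2 * l) := by rw [pow_succ, pow_succ]
    rw [hw1] at i1
    rw [hw2]
    have c1 : |(k : ℝ) - n * x₀ - (v + 1) * (1 - 2 * x₀)| ≤ 11 / 10 * (n * l) := by
      have : |((v : ℝ) + 1) * (1 - 2 * x₀)| ≤ d := by
        rw [abs_mul, abs_of_nonneg (by positivity)]
        have : |1 - 2 * x₀| ≤ 1 := abs_le.2 ⟨by linarith, by linarith⟩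
        nlinarith [abs_nonneg (1 - 2 * x₀)]
      have := abs_sub ((k : ℝ) - n * x₀) ((v + 1) * (1 - 2 * x₀))
      linarith
    have c2 : |((v : ℝ) + 1) * (x₀ * (1 - x₀))| ≤ 1 / 10 * (n * l ^ 2) := by
      have hx : 0 ≤ x₀ * (1 - x₀) := mul_nonneg hx0 (by linarith)
      rw [abs_of_nonneg (by positivity)]
      have : x₀ * (1 - x₀) ≤ x₀ := by nlinarith
      nlinarith
    have c3 : (9 / 10 * n : ℝ) * |e2| ≤ |(n - v - 1) * e2| := by
      rw [abs_mul, abs_of_nonneg (by linarith : (0 : ℝ) ≤ n - v - 1)]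
      exact mul_le_mul_of_nonneg_right (by linarith) (abs_nonneg _)
    rw [hrec] at c3
    have c4 : |(k - n * x₀ - (v + 1) * (1 - 2 * x₀)) * e1 - (v + 1) * (x₀ * (1 - x₀)) * e0|
        ≤ 11 / 10 * (n * l) * (w * (2 * l)) + 1 / 10 * (n * l ^ 2) * w := by
      refine (abs_sub _ _).trans ?_
      rw [abs_mul, abs_mul _ e0]
      gcongr
    have c5 : (9 / 10 * n : ℝ) * |e2| ≤ 9 / 10 * n * (w * (2 * l) * (2 * l)) := by
      have : 0 ≤ n * l ^ 2 * w := by positivity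
      nlinarith
    exact le_of_mul_le_mul_left c5 (by linarith)

/-- The interval `[a, a + l]` is long compared with the standard deviation of an empirical
frequency with mean in the interval, even after multiplication by `√d`. -/
structure IsLong (n d : ℕ) (a l : ℝ) : Prop where
  left_nonneg : 0 ≤ a
  right_le : a + l ≤ 1
  length_pos : 0 < l
  -- The constant is twice what `abs_krawtchouk_div_choose_le` needs, to leave room for replacing
  -- `n` by `n - 1` when one sample is changed.
  deg_le : 20 * d ≤ n * l
  deg_mul_le : 20 * d * a ≤ n * l ^ 2

namespace IsLong

variable {n d : ℕ} {a l : ℝ}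

theorem deg_le_nat (h : IsLong n d a l) : 20 * d ≤ n := by
  have h1 := h.deg_le
  have h2 : l ≤ 1 := by linarith [h.right_le, h.left_nonneg]
  have h3 : (n : ℝ) * l ≤ n := mul_le_of_le_one_right n.cast_nonneg h2
  exact_mod_cast h1.trans h3

/-- Expanding at the left end `a`, the basis estimators are at most `(2 * l) ^ v`, which are the
weights in the Chebyshev bound for the Taylor coefficients. -/
theorem abs_unbiasedEval_le (h : IsLong n d a l) {q : ℝ[X]} (hq : q.natDegree ≤ d) {A : ℝ}
    (hA : ∀ x ∈ Set.Icc a (a + l), |q.eval x| ≤ A) {k : ℕ} (hn : 0 < n) (hk : k ≤ n)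
    (hkJ : (k : ℝ) / n ∈ Set.Icc a (a + l)) :
    |unbiasedEval n q ((k : ℝ) / n)| ≤ 10 ^ d * A := by
  have hn' : (0 : ℝ) < n := by exact_mod_cast hn
  have hl := h.length_pos
  have hdn := h.deg_le_nat
  have hd1 := h.deg_le
  have hd2 := h.deg_mul_le
  have ha := h.left_nonneg
  have hr := h.right_le
  have hd0 : (0 : ℝ) ≤ d := d.cast_nonneg
  have hkx : |(k : ℝ) - n * a| ≤ n * l := by
    have h1 := (le_div_iff₀ hn').1 hkJ.1
    have h2 := (div_le_iff₀ hn').1 hkJ.2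
    exact abs_le.2 ⟨by nlinarith, by linarith⟩
  rw [unbiasedEval_eq_sum_taylor a hq (by omega) hk]
  refine (Finset.abs_sum_le_sum_abs _ _).trans ?_
  have hc := sum_abs_taylor_coeff_le hq (x₀ := a) (h := l) (A := A) fun t ht =>
    hA _ ⟨by nlinarith [ht.1], by nlinarith [ht.2]⟩
  rw [abs_of_pos hl] at hc
  refine le_trans (Finset.sum_le_sum fun v hv => ?_) hc
  rw [abs_mul]
  refine mul_le_mul_of_nonneg_left ?_ (abs_nonneg _)
  exact (abs_krawtchouk_div_choose_le (d := d) ha (by linarith) hl.le hk hkx (by omega)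
    (by linarith) (by nlinarith [mul_nonneg hd0 ha]) v).1 (by simp at hv; omega)

/-- Each basis estimator of order `v + 1` changes by `(v + 1) / n` times one of order `v` on `n - 1`
samples: compared with `(2 * l) ^ (v + 1)` this gains the factor `d / (n l)`. -/
theorem abs_unbiasedEval_sub_le (h : IsLong n d a l) {q : ℝ[X]} (hq : q.natDegree ≤ d) {A : ℝ}
    (hA : ∀ x ∈ Set.Icc a (a + l), |q.eval x| ≤ A) {k : ℕ} (hk : k + 1 ≤ n)
    (hkJ : (k : ℝ) / n ∈ Set.Icc a (a + l)) (hkJ' : ((k + 1 : ℕ) : ℝ) / n ∈ Set.Icc a (a + l)) :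
    |unbiasedEval n q (((k + 1 : ℕ) : ℝ) / n) - unbiasedEval n q ((k : ℝ) / n)|
      ≤ d * 10 ^ d * A / (n * l) := by
  obtain ⟨m, rfl⟩ : ∃ m, n = m + 1 := ⟨n - 1, by omega⟩
  have hn' : (0 : ℝ) < (m + 1 : ℕ) := by positivity
  have hl := h.length_pos
  have hdn := h.deg_le_nat
  have hd1 := h.deg_le
  have hd2 := h.deg_mul_le
  have ha := h.left_nonneg
  have hr := h.right_le
  have hd0 : (0 : ℝ) ≤ d := d.cast_nonneg
  have hA0 : 0 ≤ A := (abs_nonneg _).trans (hA _ hkJ)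
  have hkx : |(k : ℝ) - m * a| ≤ m * l := by
    have h1 := (le_div_iff₀ hn').1 hkJ.1
    have h2 := (div_le_iff₀ hn').1 hkJ'.2
    push_cast at h1 h2
    exact abs_le.2 ⟨by nlinarith [mul_nonneg (m.cast_nonneg : (0 : ℝ) ≤ m) hl.le], by nlinarith⟩
  -- The exception is a single sample, where the degree must be 0.
  have hm : d = 0 ∨ ((m + 1 : ℕ) : ℝ) ≤ 2 * m := by
    rcases Nat.eq_zero_or_pos d with h0 | h0
    · exact Or.inl h0
    · right; exact_mod_cast (by omega : m + 1 ≤ 2 * m)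
  have hb : ∀ v ≤ d, |krawtchouk a m k v / m.choose v| ≤ (2 * l) ^ v := by
    intro v hv
    refine (abs_krawtchouk_div_choose_le (d := d) ha (by linarith) hl.le (by omega) hkx (by omega)
      ?_ ?_ v).1 hv
    · rcases hm with rfl | hm
      · simp; positivity
      · nlinarith
    · rcases hm with rfl | hm
      · simp; positivity
      · nlinarith [mul_nonneg hd0 ha, sq_nonneg l]
  rw [unbiasedEval_eq_sum_taylor a hq (by omega) hk,
    unbiasedEval_eq_sum_taylor a hq (by omega) (by omega), ← Finset.sum_sub_distrib]
  refine (Finset.abs_sum_le_sum_abs _ _).trans ?_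
  have hc := sum_abs_taylor_coeff_le hq (x₀ := a) (h := l) (A := A) fun t ht =>
    hA _ ⟨by nlinarith [ht.1], by nlinarith [ht.2]⟩
  rw [abs_of_pos hl] at hc
  have hD : 0 ≤ (d : ℝ) / ((m + 1 : ℕ) * l) := by positivity
  calc _ ≤ ∑ v ∈ Finset.range (d + 1),
        (d : ℝ) / ((m + 1 : ℕ) * l) * (|(taylor a q).coeff v| * (2 * l) ^ v) := by
        refine Finset.sum_le_sum fun v hv => ?_
        have hvd : v ≤ d := by simp at hv; omega
        rw [← mul_sub, abs_mul, mul_left_comm]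
        refine mul_le_mul_of_nonneg_left ?_ (abs_nonneg _)
        rcases v with _ | v
        · simp only [krawtchouk_zero_right, sub_self, abs_zero]; positivity
        rw [← sub_div, krawtchouk_succ_sub (by omega)]
        have h0 : (0 : ℝ) < m.choose v := by exact_mod_cast Nat.choose_pos (by omega)
        have h1 : (0 : ℝ) < (m + 1).choose (v + 1) := by
          exact_mod_cast Nat.choose_pos (by omega)
        have e1 : ((m + 1 : ℕ) : ℝ) * m.choose v = (m + 1).choose (v + 1) * (v + 1) := by
          exact_mod_cast Nat.add_one_mul_choose_eq m v
        have e2 : krawtchouk a m k v / (m + 1).choose (v + 1)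
            = (v + 1) / ((m + 1 : ℕ) : ℝ) * (krawtchouk a m k v / m.choose v) := by
          field_simp
          linear_combination krawtchouk a m k v * e1
        rw [e2, abs_mul, abs_of_nonneg (by positivity), pow_succ]
        have hv' : (v : ℝ) + 1 ≤ d := by exact_mod_cast hvd
        have hbv := hb v (by omega)
        calc _ ≤ (d : ℝ) / (m + 1 : ℕ) * (2 * l) ^ v := by gcongr
          _ ≤ (d : ℝ) / (m + 1 : ℕ) * (2 * l) ^ v * 2 := by
            have : 0 ≤ (d : ℝ) / (m + 1 : ℕ) * (2 * l) ^ v := by positivity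
            linarith
          _ = _ := by field_simp
    _ ≤ (d : ℝ) / ((m + 1 : ℕ) * l) * (10 ^ d * A) := by
        rw [← Finset.mul_sum]; gcongr
    _ = _ := by ring

end IsLong

/-! ### Variance of unbiased estimators. -/

theorem div_pow_le_choose {n d : ℕ} (hd : 10 * d ≤ n) (v : ℕ) (hv : v ≤ d) :
    ((n : ℝ) / (2 * d)) ^ v ≤ n.choose v := by
  induction v with
  | zero => simp
  | succ v ih =>
    have e1 : (n.choose (v + 1) : ℝ) * (v + 1) = n.choose v * (n - v) := by
      have := Nat.choose_succ_right_eq n v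
      rw [← Nat.cast_sub (by omega : v ≤ n)]
      exact_mod_cast this
    have hvd : (v : ℝ) + 1 ≤ d := by exact_mod_cast hv
    have hdn : (10 * d : ℝ) ≤ n := by exact_mod_cast hd
    have hv0 : (0 : ℝ) ≤ v := v.cast_nonneg
    have h1 : (n : ℝ) / (2 * d) ≤ (n - v) / (v + 1) := by
      rw [div_le_div_iff₀ (by linarith) (by linarith)]
      nlinarith
    calc _ ≤ (n.choose v : ℝ) * ((n - v) / (v + 1)) := by
          rw [pow_succ]
          have := ih (by omega)
          gcongr
      _ = n.choose (v + 1) := by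
          rw [← mul_div_assoc, ← e1]; field_simp

/-- Expanded at `p`, the term of order `v` has exact second moment `(p(1-p))^v / n.choose v`, at
most `l^(2v) ρ^v` with `ρ = 2dp / (n l²) ≤ 1`. Cauchy–Schwarz with weights `|a_v| l^v`, where `a_v`
is the Taylor coefficient, assembles the terms. -/
theorem binomExp_unbiasedEval_sub_sq_le {n d : ℕ} {a l p : ℝ} (hp0 : 0 ≤ p) (hp1 : p ≤ 1)
    (hl : 0 < l) (hpJ : p ∈ Set.Icc a (a + l)) (hdn : 10 * d ≤ n) (hdp : 2 * d * p ≤ n * l ^ 2)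
    {q : ℝ[X]} (hq : q.natDegree ≤ d) {A : ℝ} (hn : 0 < n)
    (hA : ∀ x ∈ Set.Icc a (a + l), |q.eval x| ≤ A) :
    binomExp p n (fun k => (unbiasedEval n q ((k : ℝ) / n) - q.eval p) ^ 2)
      ≤ (10 ^ d * A) ^ 2 * (2 * d * p / (n * l ^ 2)) := by
  have hn' : (0 : ℝ) < n := by exact_mod_cast hn
  have hA0 : 0 ≤ A := (abs_nonneg _).trans (hA p hpJ)
  have hc : ∑ v ∈ Finset.range (d + 1), |(taylor p q).coeff v| * l ^ v ≤ 10 ^ d * A := by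
    -- `p` may lie anywhere in the interval; a segment of length `l / 2` from `p` always fits on one
    -- side, and `2 * |h| = l` gives the weights.
    obtain ⟨h, hh, hJ⟩ : ∃ h : ℝ, |h| = l / 2 ∧
        ∀ t ∈ Set.Icc (0 : ℝ) 1, p + t * h ∈ Set.Icc a (a + l) := by
      rcases le_total p (a + l / 2) with hpl | hpl
      · exact ⟨l / 2, abs_of_pos (by linarith), fun t ht =>
          ⟨by nlinarith [ht.1, hpJ.1], by nlinarith [ht.2]⟩⟩
      · exact ⟨-(l / 2), by rw [abs_neg, abs_of_pos (by linarith)], fun t ht =>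
          ⟨by nlinarith [ht.2], by nlinarith [ht.1, hpJ.2]⟩⟩
    have := sum_abs_taylor_coeff_le hq (x₀ := p) (h := h) (A := A) fun t ht => hA _ (hJ t ht)
    rwa [hh, mul_div_cancel₀ l two_ne_zero] at this
  set S := ∑ v ∈ Finset.range (d + 1), |(taylor p q).coeff v| * l ^ v with hS
  set ρ := 2 * d * p / (n * l ^ 2) with hρ
  have hρ0 : 0 ≤ ρ := by positivity
  have hρ1 : ρ ≤ 1 := (div_le_one (by positivity)).2 hdp
  have hS0 : 0 ≤ S := Finset.sum_nonneg fun v _ => by positivity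
  set e : ℕ → ℕ → ℝ := fun v k => if v = 0 then 0 else krawtchouk p n k v / n.choose v with he
  have hexp : ∀ k ≤ n, unbiasedEval n q ((k : ℝ) / n) - q.eval p
      = ∑ v ∈ Finset.range (d + 1), (taylor p q).coeff v * e v k := by
    intro k hk
    rw [unbiasedEval_eq_sum_taylor p hq (by omega) hk, Finset.sum_range_succ',
      Finset.sum_range_succ']
    simp [he, krawtchouk_zero_right, taylor_coeff_zero]
  have hmom : ∀ v ∈ Finset.range (d + 1), binomExp p n (fun k => e v k ^ 2) ≤ l ^ (2 * v) * ρ := by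
    intro v hv
    have hvd : v ≤ d := by simp at hv; omega
    rcases v with _ | v
    · simp [he, binomExp_const, hρ0]
    have hC : (0 : ℝ) < n.choose (v + 1) := by exact_mod_cast Nat.choose_pos (by omega)
    have h1 : binomExp p n (fun k => e (v + 1) k ^ 2)
        = (p * (1 - p)) ^ (v + 1) / n.choose (v + 1) := by
      have h2 : (fun k => e (v + 1) k ^ 2)
          = fun k => ((n.choose (v + 1) : ℝ) ^ 2)⁻¹ * krawtchouk p n k (v + 1) ^ 2 := by
        funext k; simp only [he, Nat.add_eq_zero_iff, one_ne_zero, and_false, if_false]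
        rw [div_pow]; field_simp
      rw [h2, binomExp_const_mul, binomExp_krawtchouk_sq]
      field_simp
    have hd0 : (0 : ℝ) < d := by exact_mod_cast (by omega : 0 < d)
    have hpp : p * (1 - p) ≤ p := by nlinarith
    have hpp0 : 0 ≤ p * (1 - p) := mul_nonneg hp0 (by linarith)
    have hch := div_pow_le_choose hdn (v + 1) hvd
    rw [h1]
    calc _ ≤ p ^ (v + 1) / ((n : ℝ) / (2 * d)) ^ (v + 1) := by gcongr
      _ = l ^ (2 * (v + 1)) * ρ ^ (v + 1) := by
        rw [hρ, ← div_pow, pow_mul, ← mul_pow]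
        congr 1
        field_simp
      _ ≤ l ^ (2 * (v + 1)) * ρ := by
        gcongr
        exact pow_le_of_le_one hρ0 hρ1 (by omega)
  have hcs : ∀ k ≤ n, (unbiasedEval n q ((k : ℝ) / n) - q.eval p) ^ 2
      ≤ S * ∑ v ∈ Finset.range (d + 1), |(taylor p q).coeff v| / l ^ v * e v k ^ 2 := by
    intro k hk
    rw [hexp k hk, hS]
    refine Finset.sum_sq_le_sum_mul_sum_of_sq_le_mul _ (fun v _ => by positivity)
      (fun v _ => by positivity) fun v _ => le_of_eq ?_
    rw [mul_pow, ← sq_abs ((taylor p q).coeff v)]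
    field_simp
  refine (binomExp_mono hp0 hp1 hcs).trans ?_
  rw [binomExp_const_mul, binomExp_sum]
  simp only [binomExp_const_mul]
  have hfin : ∑ v ∈ Finset.range (d + 1),
      |(taylor p q).coeff v| / l ^ v * binomExp p n (fun k => e v k ^ 2) ≤ S * ρ := by
    rw [hS, Finset.sum_mul]
    refine Finset.sum_le_sum fun v hv => ?_
    calc _ ≤ |(taylor p q).coeff v| / l ^ v * (l ^ (2 * v) * ρ) := by
          gcongr; exact hmom v hv
      _ = _ := by rw [two_mul, pow_add]; field_simp
  calc _ ≤ S * (S * ρ) := by gcongr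
    _ = S ^ 2 * ρ := by ring
    _ ≤ _ := by gcongr

/-! ### The degree -/

section Degree

variable {lam : ℝ} {n : ℕ}

/-- The supremum defining `deg` is attained: its set contains 0 and is bounded by `n`. -/
theorem deg_mul_two_rpow_le (hn : 2 ≤ n) (hlam1 : lam < 1 / 4) :
    (deg lam n : ℝ) * (2 : ℝ) ^ (4.5 * (deg lam n : ℝ) + 2) ≤ (n : ℝ) ^ lam := by
  have hn1 : (1 : ℝ) ≤ n := by exact_mod_cast (by omega : 1 ≤ n)
  refine Nat.sSup_mem (s := {d : ℕ | (d : ℝ) * (2 : ℝ) ^ (4.5 * (d : ℝ) + 2) ≤ (n : ℝ) ^ lam})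
    ⟨0, ?_⟩ ⟨n, fun d hd => ?_⟩
  · simp only [Set.mem_ofPred_eq, CharP.cast_eq_zero, zero_mul]; positivity
  · have h1 : (1 : ℝ) ≤ (2 : ℝ) ^ (4.5 * (d : ℝ) + 2) :=
      Real.one_le_rpow (by norm_num) (by positivity)
    have h2 : (n : ℝ) ^ lam ≤ n := by
      calc (n : ℝ) ^ lam ≤ (n : ℝ) ^ (1 : ℝ) := Real.rpow_le_rpow_of_exponent_le hn1 (by linarith)
        _ = n := Real.rpow_one _
    have h3 : (d : ℝ) ≤ n := by
      have : (d : ℝ) * 1 ≤ d * (2 : ℝ) ^ (4.5 * (d : ℝ) + 2) :=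
        mul_le_mul_of_nonneg_left h1 d.cast_nonneg
      linarith [hd.out]
    exact_mod_cast h3

theorem four_mul_sixteen_pow_le (d : ℕ) : 4 * (16 : ℝ) ^ d ≤ (2 : ℝ) ^ (4.5 * (d : ℝ) + 2) := by
  have e : 4 * (16 : ℝ) ^ d = (2 : ℝ) ^ (4 * (d : ℝ) + 2) := by
    rw [Real.rpow_add (by norm_num), Real.rpow_mul (by norm_num)]
    norm_num
    ring
  rw [e]
  refine Real.rpow_le_rpow_of_exponent_le (by norm_num) ?_
  have : (0 : ℝ) ≤ d := d.cast_nonneg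
  linarith

theorem deg_mul_sixteen_pow_le (hn : 2 ≤ n) (hlam1 : lam < 1 / 4) :
    4 * ((deg lam n : ℝ) * 16 ^ deg lam n) ≤ (n : ℝ) ^ lam := by
  refine le_trans ?_ (deg_mul_two_rpow_le hn hlam1)
  have := mul_le_mul_of_nonneg_left (four_mul_sixteen_pow_le (deg lam n))
    (Nat.cast_nonneg (α := ℝ) (deg lam n))
  linarith

theorem ten_pow_le_sixteen_pow (d : ℕ) : (10 : ℝ) ^ d ≤ 16 ^ d := by gcongr; norm_num

theorem deg_mul_ten_pow_le (hn : 2 ≤ n) (hlam1 : lam < 1 / 4) :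
    (deg lam n : ℝ) * 10 ^ deg lam n ≤ (n : ℝ) ^ lam := by
  have h1 := deg_mul_sixteen_pow_le hn hlam1
  have h2 := mul_le_mul_of_nonneg_left (ten_pow_le_sixteen_pow (deg lam n))
    (Nat.cast_nonneg (α := ℝ) (deg lam n))
  have : (0 : ℝ) ≤ (deg lam n : ℝ) * 10 ^ deg lam n := by positivity
  linarith

theorem ten_pow_deg_le (hn : 2 ≤ n) (hlam0 : 0 < lam) (hlam1 : lam < 1 / 4) :
    (10 : ℝ) ^ deg lam n ≤ (n : ℝ) ^ lam := by
  rcases Nat.eq_zero_or_pos (deg lam n) with h | h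
  · rw [h, pow_zero]
    exact Real.one_le_rpow (by exact_mod_cast (by omega : 1 ≤ n)) hlam0.le
  · refine le_trans ?_ (deg_mul_ten_pow_le hn hlam1)
    have : (1 : ℝ) ≤ deg lam n := by exact_mod_cast h
    exact le_mul_of_one_le_left (by positivity) this

theorem twenty_mul_deg_le (hn : 2 ≤ n) (hlam1 : lam < 1 / 4) : 20 * deg lam n ≤ n := by
  rcases Nat.eq_zero_or_pos (deg lam n) with h | h
  · omega
  have h1 := deg_mul_sixteen_pow_le hn hlam1
  have hn1 : (1 : ℝ) ≤ n := by exact_mod_cast (by omega : 1 ≤ n)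
  have h2 : (n : ℝ) ^ lam ≤ n := by
    calc (n : ℝ) ^ lam ≤ (n : ℝ) ^ (1 : ℝ) := Real.rpow_le_rpow_of_exponent_le hn1 (by linarith)
      _ = n := Real.rpow_one _
  have h3 : (16 : ℝ) ≤ 16 ^ deg lam n := le_self_pow₀ (by norm_num) (by omega)
  have h4 : (20 * deg lam n : ℝ) ≤ n := by
    have : (0 : ℝ) ≤ deg lam n := Nat.cast_nonneg _
    nlinarith
  exact_mod_cast h4

theorem deg_le_log (hn : 2 ≤ n) (hlam1 : lam < 1 / 4) : (deg lam n : ℝ) ≤ Real.log n := by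
  have hn1 : (1 : ℝ) ≤ n := by exact_mod_cast (by omega : 1 ≤ n)
  have hlog : 0 ≤ Real.log n := Real.log_nonneg hn1
  rcases Nat.eq_zero_or_pos (deg lam n) with h | h
  · rw [h]; simpa using hlog
  have h1 := deg_mul_sixteen_pow_le hn hlam1
  have hd : (1 : ℝ) ≤ deg lam n := by exact_mod_cast h
  have h3 : (16 : ℝ) ^ deg lam n ≤ (n : ℝ) ^ lam := by
    have : (0 : ℝ) < 16 ^ deg lam n := by positivity
    nlinarith
  have h4 := Real.log_le_log (by positivity) h3
  rw [Real.log_pow, Real.log_rpow (by linarith)] at h4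
  have h5 : (1 : ℝ) ≤ Real.log 16 := by
    rw [show (16 : ℝ) = 2 ^ 4 by norm_num, Real.log_pow]
    have := Real.log_two_gt_d9
    push_cast
    linarith
  nlinarith

end Degree

/-! ### The partition -/

section Partition

variable {c lam : ℝ} {n : ℕ}

theorem natCast_mul_cn (hn : 2 ≤ n) : n * cn c n = c * Real.log n := by
  have : (n : ℝ) ≠ 0 := by exact_mod_cast (by omega : n ≠ 0)
  unfold cn; field_simp

theorem half_le_log (hn : 2 ≤ n) : 1 / 2 ≤ Real.log n := by
  have h1 : Real.log 2 ≤ Real.log n := Real.log_le_log (by norm_num) (by exact_mod_cast hn)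
  have := Real.log_two_gt_d9
  linarith

theorem cn_pos (hc : 100 ≤ c) (hn : 2 ≤ n) : 0 < cn c n := by
  have h := half_le_log hn
  have : (0 : ℝ) < n := by exact_mod_cast (by omega : 0 < n)
  unfold cn
  positivity

theorem fifty_le_natCast_mul_cn (hc : 100 ≤ c) (hn : 2 ≤ n) : 50 ≤ n * cn c n := by
  rw [natCast_mul_cn hn]
  nlinarith [half_le_log hn]

theorem cn_mul_sq_lt_one (hc : 100 ≤ c) (hn : 2 ≤ n) {m : ℕ} (hm : m < numIntervals c n) :
    cn c n * (m : ℝ) ^ 2 < 1 := by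
  have h0 := cn_pos hc hn
  have hs : 0 < √(cn c n) := Real.sqrt_pos.2 h0
  have h1 : (m : ℝ) < 1 / √(cn c n) := Nat.lt_ceil.1 hm
  rw [lt_div_iff₀ hs] at h1
  have h2 : cn c n * (m : ℝ) ^ 2 = (m * √(cn c n)) ^ 2 := by
    rw [mul_pow, Real.sq_sqrt h0.le]; ring
  rw [h2]
  have : 0 ≤ m * √(cn c n) := by positivity
  nlinarith

theorem one_le_numIntervals (hc : 100 ≤ c) (hn : 2 ≤ n) : 1 ≤ numIntervals c n := by
  have hs : 0 < √(cn c n) := Real.sqrt_pos.2 (cn_pos hc hn)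
  exact Nat.one_le_ceil_iff.2 (by positivity)

theorem one_le_cn_mul_numIntervals_sq (hc : 100 ≤ c) (hn : 2 ≤ n) :
    1 ≤ cn c n * (numIntervals c n : ℝ) ^ 2 := by
  have h0 := cn_pos hc hn
  have hs : 0 < √(cn c n) := Real.sqrt_pos.2 h0
  have h1 : 1 / √(cn c n) ≤ numIntervals c n := Nat.le_ceil _
  rw [div_le_iff₀ hs] at h1
  have h2 : cn c n * (numIntervals c n : ℝ) ^ 2 = (numIntervals c n * √(cn c n)) ^ 2 := by
    rw [mul_pow, Real.sq_sqrt h0.le]; ring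
  rw [h2]
  nlinarith

theorem idx_spec (hc : 100 ≤ c) (hn : 2 ≤ n) {x : ℝ} (hx : x ∈ Set.Icc (0 : ℝ) 1) :
    1 ≤ idx c n x ∧ idx c n x ≤ numIntervals c n ∧ x ∈ piece c n (idx c n x) := by
  classical
  have hM : 1 ≤ numIntervals c n ∧ x ≤ cn c n * (numIntervals c n : ℝ) ^ 2 :=
    ⟨one_le_numIntervals hc hn, hx.2.trans (one_le_cn_mul_numIntervals_sq hc hn)⟩
  have hex : ∃ j : ℕ, 1 ≤ j ∧ x ≤ cn c n * (j : ℝ) ^ 2 := ⟨_, hM⟩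
  set m := Nat.find hex with hm
  have hspec := Nat.find_spec hex
  -- Minimality of `m` supplies the lower end of the interval.
  have hmem : m ∈ {j : ℕ | 1 ≤ j ∧ x ∈ piece c n j} := by
    refine ⟨hspec.1, ?_, le_min hx.2 hspec.2⟩
    rcases Nat.lt_or_ge m 2 with h | h
    · have : m - 1 = 0 := by omega
      rw [this]; simpa using hx.1
    · have := Nat.find_min hex (m := m - 1) (by omega)
      rw [not_and] at this
      exact (not_le.1 (this (by omega))).le
  have h1 := Nat.sInf_mem ⟨m, hmem⟩
  exact ⟨h1.1, (Nat.sInf_le hmem).trans (Nat.find_min' hex hM), h1.2⟩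

theorem idx_eq_one (hc : 100 ≤ c) (hn : 2 ≤ n) {x : ℝ} (hx : x ∈ Set.Icc (0 : ℝ) 1)
    (h : x ≤ cn c n) : idx c n x = 1 := by
  refine le_antisymm (Nat.sInf_le ⟨le_rfl, ?_, ?_⟩) (idx_spec hc hn hx).1
  · simpa using hx.1
  · simpa using ⟨hx.2, h⟩

/-- The right end point of `I_j` has index `j`. Hence the global smoothness quantities, maxima over
points, dominate those of every interval of the partition. -/
theorem exists_idx_eq (hc : 100 ≤ c) (hn : 2 ≤ n) {j : ℕ} (hj : 1 ≤ j)
    (hjM : j ≤ numIntervals c n) : ∃ x ∈ Set.Icc (0 : ℝ) 1, idx c n x = j := by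
  have h0 := cn_pos hc hn
  have hlt := cn_mul_sq_lt_one hc hn (m := j - 1) (by omega)
  set x := min 1 (cn c n * (j : ℝ) ^ 2) with hx
  have hj1 : ((j - 1 : ℕ) : ℝ) < j := by exact_mod_cast (by omega : j - 1 < j)
  have hx1 : cn c n * ((j - 1 : ℕ) : ℝ) ^ 2 < x := by
    refine lt_min hlt ?_
    gcongr
  have hxI : x ∈ Set.Icc (0 : ℝ) 1 := ⟨le_min zero_le_one (by positivity), min_le_left _ _⟩
  refine ⟨x, hxI, le_antisymm (Nat.sInf_le ⟨hj, hx1.le, le_rfl⟩) ?_⟩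
  have h1 := hx1.trans_le ((idx_spec hc hn hxI).2.2.2.trans (min_le_right _ _))
  have h2 := lt_of_mul_lt_mul_left h1 h0.le
  have h3 := lt_of_pow_lt_pow_left₀ 2 (Nat.cast_nonneg _) h2
  have : j - 1 < idx c n x := by exact_mod_cast h3
  omega

/-- A union of at least one entire interval of the partition is long. -/
theorem partition_interval (hc : 100 ≤ c) (hlam1 : lam < 1 / 4) (hn : 2 ≤ n) {α β : ℕ}
    (hαβ : α + 1 ≤ β) (hα : α = 0 ∨ cn c n * ((α : ℝ) + 1) ^ 2 ≤ 1) :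
    IsLong n (deg lam n) (cn c n * (α : ℝ) ^ 2)
        (min 1 (cn c n * (β : ℝ) ^ 2) - cn c n * (α : ℝ) ^ 2) ∧
      2 ≤ n * (min 1 (cn c n * (β : ℝ) ^ 2) - cn c n * (α : ℝ) ^ 2) ∧
      ∀ p : ℝ, 0 ≤ p → p ≤ 1 → p ≤ cn c n * ((α : ℝ) + 5) ^ 2 → 2 * deg lam n * p
        ≤ n * (min 1 (cn c n * (β : ℝ) ^ 2) - cn c n * (α : ℝ) ^ 2) ^ 2 := by
  have h0 := cn_pos hc hn
  have h50 := fifty_le_natCast_mul_cn hc hn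
  have hn' : (2 : ℝ) ≤ n := by exact_mod_cast hn
  have hd := deg_le_log hn hlam1
  have hd20 : (20 * deg lam n : ℝ) ≤ n := by exact_mod_cast twenty_mul_deg_le hn hlam1
  have hd0 : (0 : ℝ) ≤ deg lam n := Nat.cast_nonneg _
  have hcn := natCast_mul_cn (c := c) hn
  have hlog := half_le_log hn
  -- One role of the size of `c`: the degree is at most `log n`.
  have hdc : 100 * (deg lam n : ℝ) ≤ n * cn c n := by rw [hcn]; nlinarith
  have hα0 : (0 : ℝ) ≤ α := α.cast_nonneg
  have hβ : (α : ℝ) + 1 ≤ β := by exact_mod_cast hαβ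
  set κ := cn c n
  set d : ℝ := (deg lam n : ℝ)
  -- For small `n`, `κ` may exceed 1; then the first interval is already `[0, 1]`.
  by_cases hα1 : κ * ((α : ℝ) + 1) ^ 2 ≤ 1
  · set l := min 1 (κ * (β : ℝ) ^ 2) - κ * (α : ℝ) ^ 2 with hl
    have hl1 : κ * (2 * α + 1) ≤ l := by
      have h1 : κ * ((α : ℝ) + 1) ^ 2 ≤ κ * (β : ℝ) ^ 2 := by gcongr
      have h2 := le_min hα1 h1
      have e : κ * ((α : ℝ) + 1) ^ 2 = κ * (α : ℝ) ^ 2 + κ * (2 * α + 1) := by ring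
      linarith
    have hl2 : κ ≤ l := by nlinarith [mul_nonneg h0.le hα0]
    have hlsq : κ * (κ * (2 * α + 1) ^ 2) ≤ l ^ 2 := by
      have : (κ * (2 * α + 1)) ^ 2 ≤ l ^ 2 := by gcongr
      linarith
    -- Quadratic spacing makes `l ^ 2` at least of order `κ x`. The constant 25 comes from `α + 5 ≤
    -- 5 * (2 * α + 1)`.
    have hmain : ∀ x : ℝ, 0 ≤ x → x ≤ 25 * (κ * (2 * α + 1) ^ 2) → 2 * d * x ≤ n * l ^ 2 := by
      intro x hx0 hx
      have h1 : 2 * d * x ≤ 2 * d * (25 * (κ * (2 * α + 1) ^ 2)) := by gcongr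
      have h2 : 0 ≤ κ * (2 * (α : ℝ) + 1) ^ 2 := by positivity
      have h3 : n * (κ * (κ * (2 * α + 1) ^ 2)) ≤ n * l ^ 2 := by gcongr
      nlinarith [mul_le_mul_of_nonneg_right hdc h2]
    refine ⟨⟨by positivity, ?_, h0.trans_le hl2, ?_, ?_⟩, ?_, ?_⟩
    · rw [hl]; linarith [min_le_left 1 (κ * (β : ℝ) ^ 2)]
    · nlinarith
    · have := hmain (10 * (κ * (α : ℝ) ^ 2)) (by positivity)
        (by nlinarith [mul_nonneg h0.le hα0, mul_nonneg h0.le (sq_nonneg (α : ℝ))])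
      linarith
    · nlinarith
    · intro p hp0 _ hp
      refine hmain p hp0 (hp.trans ?_)
      nlinarith [mul_nonneg h0.le hα0, mul_nonneg h0.le (sq_nonneg (α : ℝ))]
  · have hα' : α = 0 := hα.resolve_right hα1
    subst hα'
    have hκ : 1 ≤ κ := by simpa using (not_le.1 hα1).le
    have hmin : min 1 (κ * (β : ℝ) ^ 2) = 1 := by
      refine min_eq_left ?_
      have : (1 : ℝ) ≤ β := by simpa using hβ
      nlinarith
    rw [hmin]
    simp only [CharP.cast_eq_zero, ne_eq, OfNat.ofNat_ne_zero, not_false_eq_true, zero_pow,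
      mul_zero, sub_zero, mul_one, one_pow]
    refine ⟨⟨le_rfl, by norm_num, one_pos, by simpa using hd20, by simp⟩, hn', ?_⟩
    intro p hp0 hp1 _
    nlinarith

/-- Length of `I**_j`. -/
def wideLength (c : ℝ) (n j : ℕ) : ℝ := min 1 (cn c n * ((j : ℝ) + 2) ^ 2) - leftEnd c n j

theorem widePiece_eq (c : ℝ) (n j : ℕ) :
    widePiece c n j = Set.Icc (leftEnd c n j) (leftEnd c n j + wideLength c n j) := by
  rw [wideLength, add_sub_cancel, widePiece]

theorem widePiece_props (hc : 100 ≤ c) (hlam1 : lam < 1 / 4) (hn : 2 ≤ n) {j : ℕ} (hj : 1 ≤ j)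
    (hjM : j ≤ numIntervals c n) :
    IsLong n (deg lam n) (leftEnd c n j) (wideLength c n j) ∧ 2 ≤ n * wideLength c n j ∧
      ∀ p ∈ widePiece c n j, 2 * deg lam n * p ≤ n * wideLength c n j ^ 2 := by
  have h0 := cn_pos hc hn
  have hα : j - 3 = 0 ∨ cn c n * (((j - 3 : ℕ) : ℝ) + 1) ^ 2 ≤ 1 := by
    rcases Nat.lt_or_ge 3 j with h | h
    · right
      have := (cn_mul_sq_lt_one hc hn (m := j - 3 + 1) (by omega)).le
      exact_mod_cast this
    · left; omega
  obtain ⟨h1, h2, h3⟩ := partition_interval hc hlam1 hn (α := j - 3) (β := j + 2) (by omega) hα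
  have e : min 1 (cn c n * ((j + 2 : ℕ) : ℝ) ^ 2) - cn c n * ((j - 3 : ℕ) : ℝ) ^ 2
      = wideLength c n j := by
    unfold wideLength leftEnd; push_cast; rfl
  rw [e] at h1 h2 h3
  refine ⟨h1, h2, fun p hp => ?_⟩
  have hp0 : 0 ≤ p := le_trans (by unfold leftEnd; positivity) hp.1
  refine h3 p hp0 (hp.2.trans (min_le_left _ _)) (hp.2.trans ((min_le_right _ _).trans ?_))
  have : (j : ℝ) ≤ ((j - 3 : ℕ) : ℝ) + 3 := by exact_mod_cast (by omega : j ≤ j - 3 + 3)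
  have : (j : ℝ) + 2 ≤ ((j - 3 : ℕ) : ℝ) + 5 := by linarith
  gcongr

theorem widePiece_subset (hc : 100 ≤ c) (hn : 2 ≤ n) (j : ℕ) :
    widePiece c n j ⊆ Set.Icc 0 1 := fun x hx => by
  have := cn_pos hc hn
  exact ⟨le_trans (by unfold leftEnd; positivity) hx.1, hx.2.trans (min_le_left _ _)⟩

theorem piece_subset_widePiece (hc : 100 ≤ c) (hn : 2 ≤ n) {i j : ℕ} (hij : i ≤ j + 2)
    (hji : j ≤ i + 2) : piece c n i ⊆ widePiece c n j := by
  have h0 := cn_pos hc hn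
  refine Set.Icc_subset_Icc ?_ ?_
  · unfold leftEnd
    have : ((j - 3 : ℕ) : ℝ) ≤ ((i - 1 : ℕ) : ℝ) := by exact_mod_cast (by omega : j - 3 ≤ i - 1)
    gcongr
  · have : (i : ℝ) ≤ j + 2 := by exact_mod_cast hij
    gcongr

theorem mem_widePiece_idx (hc : 100 ≤ c) (hn : 2 ≤ n) {x : ℝ} (hx : x ∈ Set.Icc (0 : ℝ) 1) {j : ℕ}
    (h1 : idx c n x ≤ j + 2) (h2 : j ≤ idx c n x + 2) : x ∈ widePiece c n j :=
  piece_subset_widePiece hc hn h1 h2 (idx_spec hc hn hx).2.2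

/-- If `x` lies in the extended interval of index `j`, then `j` differs little from `idx x`. -/
theorem idx_near_of_mem_widePiece (hc : 100 ≤ c) (hn : 2 ≤ n) {x : ℝ} {j : ℕ}
    (h : x ∈ widePiece c n j) : idx c n x ≤ j + 3 ∧ j ≤ idx c n x + 3 := by
  have h0 := cn_pos hc hn
  have hs := (idx_spec hc hn (widePiece_subset hc hn j h)).2.2
  constructor
  · have h1 := hs.1.trans (h.2.trans (min_le_right _ _))
    have h2 := le_of_mul_le_mul_left h1 h0
    have h3 := le_of_sq_le_sq h2 (by positivity)
    have : idx c n x - 1 ≤ j + 2 := by exact_mod_cast h3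
    omega
  -- A distance of 3 can occur: the left end of `I**_j` is also the right end of `I_{j-3}` when `j ≥
  -- 4`, and `idx` prefers the smaller index.
  · have h1 := h.1.trans (hs.2.trans (min_le_right _ _))
    have h2 := le_of_mul_le_mul_left h1 h0
    have h3 := le_of_sq_le_sq h2 (by positivity)
    have : j - 3 ≤ idx c n x := by exact_mod_cast h3
    omega

/-- The indices of points with close square roots differ by at most one. -/
theorem idx_le_idx_add_one (hc : 100 ≤ c) (hn : 2 ≤ n) {x y : ℝ} (hx : x ∈ Set.Icc (0 : ℝ) 1)
    (hy : y ∈ Set.Icc (0 : ℝ) 1) (h : √x - √y ≤ √(cn c n) / 2) : idx c n x ≤ idx c n y + 1 := by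
  have h0 := cn_pos hc hn
  have hs : 0 < √(cn c n) := Real.sqrt_pos.2 h0
  have h1 := Real.sqrt_le_sqrt (idx_spec hc hn hx).2.2.1
  have h2 := Real.sqrt_le_sqrt ((idx_spec hc hn hy).2.2.2.trans (min_le_right _ _))
  -- On the square root scale the partition is a uniform grid of mesh `√(cn c n)`.
  rw [Real.sqrt_mul h0.le, Real.sqrt_sq (Nat.cast_nonneg _)] at h1 h2
  have h3 : √(cn c n) * ((idx c n x - 1 : ℕ) : ℝ) < √(cn c n) * (idx c n y + 1 : ℝ) := by
    nlinarith
  have h4 := lt_of_mul_lt_mul_left h3 hs.le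
  have : idx c n x - 1 < idx c n y + 1 := by exact_mod_cast h4
  omega

end Partition

/-! ### Min-max deviation and effective derivative of bounded functions -/

section Smoothness

variable {g : ℝ → ℝ} {B a b : ℝ} {I : Set ℝ}

/-- Boundedness of `g` rules out the default value 0 of `sSup` on an unbounded set. -/
theorem abs_sub_le_supDev (hI : I ⊆ Set.Icc a b) (hg : ∀ x ∈ I, |g x| ≤ B) (q : ℝ[X]) {x : ℝ}
    (hx : x ∈ I) : |g x - q.eval x| ≤ supDev g q I := by
  obtain ⟨K, hK⟩ := (isCompact_Icc (a := a) (b := b)).exists_bound_of_continuousOn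
    q.continuous.continuousOn
  refine le_csSup ⟨B + K, ?_⟩ ⟨x, hx, rfl⟩
  rintro _ ⟨y, hy, rfl⟩
  exact (abs_sub _ _).trans (add_le_add (hg y hy) (hK y (hI hy)))

theorem supDev_le {q : ℝ[X]} {K : ℝ} (hK : 0 ≤ K) (h : ∀ x ∈ I, |g x - q.eval x| ≤ K) :
    supDev g q I ≤ K := by
  refine Real.sSup_le ?_ hK
  rintro _ ⟨x, hx, rfl⟩
  exact h x hx

theorem supDev_nonneg (g : ℝ → ℝ) (q : ℝ[X]) (I : Set ℝ) : 0 ≤ supDev g q I := by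
  refine Real.sSup_nonneg ?_
  rintro _ ⟨x, _, rfl⟩
  exact abs_nonneg _

theorem minMaxDev_nonneg (g : ℝ → ℝ) (d : ℕ) (I : Set ℝ) : 0 ≤ minMaxDev g d I := by
  refine Real.sInf_nonneg ?_
  rintro _ ⟨q, _, rfl⟩
  exact supDev_nonneg g q I

theorem minMaxDev_le {d : ℕ} {q : ℝ[X]} (hq : q.natDegree ≤ d) {K : ℝ} (hK : 0 ≤ K)
    (h : ∀ x ∈ I, |g x - q.eval x| ≤ K) : minMaxDev g d I ≤ K := by
  have hbdd : BddBelow ((fun q : ℝ[X] => supDev g q I) '' {q | q.natDegree ≤ d}) := by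
    refine ⟨0, ?_⟩
    rintro _ ⟨r, _, rfl⟩
    exact supDev_nonneg g r I
  exact (csInf_le hbdd ⟨q, hq, rfl⟩).trans (supDev_le hK h)

theorem IsMinMaxPoly.abs_sub_le {d : ℕ} {r : ℝ[X]} (hr : IsMinMaxPoly g d I r)
    (hI : I ⊆ Set.Icc a b) (hg : ∀ x ∈ I, |g x| ≤ B) {x : ℝ} (hx : x ∈ I) :
    |g x - r.eval x| ≤ minMaxDev g d I := by
  refine (abs_sub_le_supDev hI hg r hx).trans (le_csInf ⟨_, r, hr.1, rfl⟩ ?_)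
  rintro _ ⟨s, hs, rfl⟩
  exact hr.2 s hs

theorem effDeriv_nonneg (g : ℝ → ℝ) (h : ℝ) (I : Set ℝ) : 0 ≤ effDeriv g h I := by
  refine Real.sSup_nonneg ?_
  rintro _ ⟨x, _, y, _, _, rfl⟩
  positivity

theorem effDeriv_le {h : ℝ} (hh : 0 < h) (hB : 0 ≤ B) (hg : ∀ x ∈ I, |g x| ≤ B) :
    effDeriv g h I ≤ 2 * B / h := by
  refine Real.sSup_le ?_ (by positivity)
  rintro _ ⟨x, hx, y, hy, hxy, rfl⟩
  have h1 : |g y - g x| ≤ 2 * B := (abs_sub _ _).trans (by linarith [hg x hx, hg y hy])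
  gcongr

theorem abs_sub_le_effDeriv_mul {h : ℝ} (hh : 0 < h) (hB : 0 ≤ B) (hg : ∀ x ∈ I, |g x| ≤ B)
    {x y : ℝ} (hx : x ∈ I) (hy : y ∈ I) (hxy : h ≤ |y - x|) :
    |g y - g x| ≤ effDeriv g h I * |y - x| := by
  rw [← div_le_iff₀ (hh.trans_le hxy)]
  refine le_csSup ⟨2 * B / h, ?_⟩ ⟨x, hx, y, hy, hxy, rfl⟩
  rintro _ ⟨x, hx, y, hy, hxy, rfl⟩
  have h1 : |g y - g x| ≤ 2 * B := (abs_sub _ _).trans (by linarith [hg x hx, hg y hy])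
  gcongr

/-- The oscillation of `g` on an interval, in terms of its effective derivative. -/
theorem abs_sub_le_three_mul_effDeriv {h l : ℝ} (hh : 0 < h) (hl : 2 * h ≤ l) (hB : 0 ≤ B)
    (hg : ∀ x ∈ Set.Icc a (a + l), |g x| ≤ B) {x y : ℝ} (hx : x ∈ Set.Icc a (a + l))
    (hy : y ∈ Set.Icc a (a + l)) :
    |g x - g y| ≤ 3 * (effDeriv g h (Set.Icc a (a + l)) * l) := by
  set L := effDeriv g h (Set.Icc a (a + l)) with hL
  have hL0 : 0 ≤ L := effDeriv_nonneg _ _ _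
  have step : ∀ u ∈ Set.Icc a (a + l), ∀ v ∈ Set.Icc a (a + l), h ≤ |u - v| →
      |g u - g v| ≤ L * l := by
    intro u hu v hv huv
    refine (abs_sub_le_effDeriv_mul hh hB hg hv hu huv).trans ?_
    refine mul_le_mul_of_nonneg_left (abs_le.2 ⟨?_, ?_⟩) hL0 <;> linarith [hu.1, hu.2, hv.1, hv.2]
  -- Points closer than `h` are not compared by the effective derivative, but each point is at
  -- distance at least `l / 2 ≥ h` from one of the ends. Two points are joined by three admissible
  -- steps through the ends.
  have far : ∀ u ∈ Set.Icc a (a + l), ∃ z, (z = a ∨ z = a + l) ∧ |g u - g z| ≤ L * l := by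
    intro u hu
    rcases le_total u (a + l / 2) with h1 | h1
    · refine ⟨a + l, Or.inr rfl, step u hu _ ⟨by linarith, le_rfl⟩ ?_⟩
      rw [abs_sub_comm]
      exact le_trans (by linarith) (le_abs_self _)
    · exact ⟨a, Or.inl rfl, step u hu _ ⟨le_rfl, by linarith⟩
        (le_trans (by linarith) (le_abs_self _))⟩
  have ends : |g (a + l) - g a| ≤ L * l :=
    step _ ⟨by linarith, le_rfl⟩ _ ⟨le_rfl, by linarith⟩ (le_trans (by linarith) (le_abs_self _))
  have hLl : 0 ≤ L * l := (abs_nonneg _).trans ends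
  obtain ⟨z, hz, hxz⟩ := far x hx
  obtain ⟨w, hw, hyw⟩ := far y hy
  have hzw : |g z - g w| ≤ L * l := by
    rcases hz with rfl | rfl <;> rcases hw with rfl | rfl
    · simpa using hLl
    · rwa [abs_sub_comm]
    · exact ends
    · simpa using hLl
  rw [abs_sub_comm] at hyw
  have e : g x - g y = (g x - g z) + (g z - g w) + (g w - g y) := by ring
  rw [e]
  refine (abs_add_three _ _ _).trans ?_
  linarith

end Smoothness

/-! ### The local approximations -/

/-- The standing assumptions. -/
structure IsSetup (c lam B : ℝ) (n : ℕ) (g : ℝ → ℝ) (q : ℕ → ℝ[X]) : Prop where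
  c_ge : 100 ≤ c
  lam_pos : 0 < lam
  lam_lt : lam < 1 / 4
  B_pos : 0 < B
  two_le : 2 ≤ n
  bound : ∀ x ∈ Set.Icc (0 : ℝ) 1, |g x| ≤ B
  approx : IsLocalApprox lam c g n q

namespace IsSetup

variable {c lam B : ℝ} {n : ℕ} {g : ℝ → ℝ} {q : ℕ → ℝ[X]}

theorem pos (h : IsSetup c lam B n g q) : (0 : ℝ) < n := by
  have := h.two_le
  exact_mod_cast (by omega : 0 < n)

theorem bound_wide (h : IsSetup c lam B n g q) {j : ℕ} {x : ℝ} (hx : x ∈ widePiece c n j) :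
    |g x| ≤ B :=
  h.bound x (widePiece_subset h.c_ge h.two_le j hx)

theorem long (h : IsSetup c lam B n g q) {j : ℕ} (hj : 1 ≤ j) (hjM : j ≤ numIntervals c n) :
    IsLong n (deg lam n) (leftEnd c n j) (wideLength c n j) :=
  (widePiece_props h.c_ge h.lam_lt h.two_le hj hjM).1

theorem two_le_mul_wideLength (h : IsSetup c lam B n g q) {j : ℕ} (hj : 1 ≤ j)
    (hjM : j ≤ numIntervals c n) : 2 ≤ n * wideLength c n j :=
  (widePiece_props h.c_ge h.lam_lt h.two_le hj hjM).2.1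

theorem natDegree_le (h : IsSetup c lam B n g q) {j : ℕ} (hj : 1 ≤ j)
    (hjM : j ≤ numIntervals c n) : (q j).natDegree ≤ deg lam n := by
  obtain ⟨r, hr, e | e⟩ := h.approx j hj hjM
  · rw [e]; exact hr.1
  · rw [e]; exact (natDegree_add_le _ _).trans (max_le hr.1 (by rw [natDegree_C]; omega))

/-- The min-max deviation of `g` on `I**_j`. -/
def dev (lam c : ℝ) (g : ℝ → ℝ) (n j : ℕ) : ℝ := minMaxDev g (deg lam n) (widePiece c n j)

/-- The effective derivative of `g` on `I**_j`. -/
def slope (c : ℝ) (g : ℝ → ℝ) (n j : ℕ) : ℝ := effDeriv g (1 / n) (widePiece c n j)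

theorem dev_nonneg (lam c : ℝ) (g : ℝ → ℝ) (n j : ℕ) : 0 ≤ dev lam c g n j :=
  minMaxDev_nonneg _ _ _

theorem slope_nonneg (c : ℝ) (g : ℝ → ℝ) (n j : ℕ) : 0 ≤ slope c g n j :=
  effDeriv_nonneg _ _ _

theorem left_mem (h : IsSetup c lam B n g q) {j : ℕ} (hj : 1 ≤ j)
    (hjM : j ≤ numIntervals c n) : leftEnd c n j ∈ widePiece c n j := by
  rw [widePiece_eq]
  exact ⟨le_rfl, by linarith [(h.long hj hjM).length_pos]⟩

/-- The factor 2 pays for the optional vertical shift, itself at most one deviation. -/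
theorem abs_sub_eval_le (h : IsSetup c lam B n g q) {j : ℕ} (hj : 1 ≤ j)
    (hjM : j ≤ numIntervals c n) {x : ℝ} (hx : x ∈ widePiece c n j) :
    |g x - (q j).eval x| ≤ 2 * dev lam c g n j := by
  obtain ⟨r, hr, e⟩ := h.approx j hj hjM
  have hb : ∀ x ∈ widePiece c n j, |g x - r.eval x| ≤ dev lam c g n j := fun x hx =>
    hr.abs_sub_le (widePiece_subset h.c_ge h.two_le j) (fun x hx => h.bound_wide hx) hx
  have h1 := hb x hx
  have h2 := hb _ (h.left_mem hj hjM)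
  have h0 := dev_nonneg lam c g n j
  rcases e with e | e
  · rw [e]; linarith
  · rw [e, eval_add, eval_C, show ∀ s t u v : ℝ, s - (t + (u - v)) = (s - t) - (u - v) by
      intros; ring]
    exact (abs_sub _ _).trans (by linarith)

theorem abs_eval_sub_eval_le (h : IsSetup c lam B n g q) {j : ℕ} (hj : 1 ≤ j)
    (hjM : j ≤ numIntervals c n) {x y : ℝ} (hx : x ∈ widePiece c n j) (hy : y ∈ widePiece c n j) :
    |(q j).eval x - (q j).eval y| ≤ 2 * dev lam c g n j + |g x - g y| := by
  obtain ⟨r, hr, e⟩ := h.approx j hj hjM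
  have hb : ∀ x ∈ widePiece c n j, |g x - r.eval x| ≤ dev lam c g n j := fun x hx =>
    hr.abs_sub_le (widePiece_subset h.c_ge h.two_le j) (fun x hx => h.bound_wide hx) hx
  have e1 : (q j).eval x - (q j).eval y
      = (g x - g y) + (g y - r.eval y) - (g x - r.eval x) := by
    rcases e with e | e
    · rw [e]; ring
    · rw [e, eval_add, eval_add, eval_C, eval_C]; ring
  rw [e1]
  have h1 := abs_sub ((g x - g y) + (g y - r.eval y)) (g x - r.eval x)
  have h2 := abs_add_le (g x - g y) (g y - r.eval y)
  linarith [hb x hx, hb y hy]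

theorem osc_le (h : IsSetup c lam B n g q) {j : ℕ} (hj : 1 ≤ j)
    (hjM : j ≤ numIntervals c n) {x y : ℝ} (hx : x ∈ widePiece c n j) (hy : y ∈ widePiece c n j) :
    |g x - g y| ≤ 3 * (slope c g n j * wideLength c n j) := by
  have hn := h.pos
  have h2 := h.two_le_mul_wideLength hj hjM
  unfold slope
  have hb : ∀ x ∈ widePiece c n j, |g x| ≤ B := fun x hx => h.bound_wide hx
  rw [widePiece_eq] at hx hy hb ⊢
  refine abs_sub_le_three_mul_effDeriv (by positivity) ?_ h.B_pos.le hb hx hy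
  rw [mul_one_div, div_le_iff₀ hn]
  linarith

/-- A constant polynomial is a competitor, so the deviation is at most the oscillation. This lets
the variance bound involve only `L`. -/
theorem dev_le_slope (h : IsSetup c lam B n g q) {j : ℕ} (hj : 1 ≤ j)
    (hjM : j ≤ numIntervals c n) :
    dev lam c g n j ≤ 3 * (slope c g n j * wideLength c n j) := by
  have hl := (h.long hj hjM).length_pos
  have := slope_nonneg c g n j
  refine minMaxDev_le (q := C (g (leftEnd c n j))) (by simp) (by positivity) fun x hx => ?_
  rw [eval_C]
  exact h.osc_le hj hjM hx (h.left_mem hj hjM)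

theorem dev_le_bound (h : IsSetup c lam B n g q) (j : ℕ) : dev lam c g n j ≤ B :=
  minMaxDev_le (q := 0) (by simp) h.B_pos.le fun x hx => by simpa using h.bound_wide hx

theorem slope_le_bound (h : IsSetup c lam B n g q) (j : ℕ) : slope c g n j ≤ 2 * B * n := by
  have hn := h.pos
  refine (effDeriv_le (by positivity) h.B_pos.le fun x hx => h.bound_wide hx).trans_eq ?_
  field_simp

theorem abs_eval_le (h : IsSetup c lam B n g q) {j : ℕ} (hj : 1 ≤ j)
    (hjM : j ≤ numIntervals c n) {x : ℝ} (hx : x ∈ widePiece c n j) :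
    |(q j).eval x| ≤ 3 * B := by
  have h1 := h.abs_sub_eval_le hj hjM hx
  have h2 := h.dev_le_bound j
  have h3 := h.bound_wide hx
  have h4 := abs_sub (g x) (g x - (q j).eval x)
  rw [sub_sub_cancel] at h4
  linarith

/-! ### Local and global smoothness quantities -/

theorem nearby_bddAbove (c : ℝ) (n : ℕ) (x : ℝ) (f : ℕ → ℝ) : BddAbove (f '' nearby c n x) :=
  (((Set.finite_le_nat (numIntervals c n)).subset fun _ hj => hj.2.1).image f).bddAbove

theorem dev_le_localDev (h : IsSetup c lam B n g q) {j : ℕ} {x : ℝ} (hj : j ∈ nearby c n x) :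
    n * dev lam c g n j ≤ localDev lam c g n x :=
  mul_le_mul_of_nonneg_left (le_csSup (nearby_bddAbove c n x _) ⟨j, hj, rfl⟩) h.pos.le

theorem slope_le_localDeriv {j : ℕ} {x : ℝ} (hj : j ∈ nearby c n x) :
    slope c g n j ≤ localDeriv c g n x :=
  le_csSup (nearby_bddAbove c n x _) ⟨j, hj, rfl⟩

theorem localDev_nonneg (lam c : ℝ) (g : ℝ → ℝ) (n : ℕ) (x : ℝ) : 0 ≤ localDev lam c g n x := by
  refine mul_nonneg n.cast_nonneg (Real.sSup_nonneg ?_)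
  rintro _ ⟨j, _, rfl⟩
  exact dev_nonneg lam c g n j

theorem localDeriv_nonneg (c : ℝ) (g : ℝ → ℝ) (n : ℕ) (x : ℝ) : 0 ≤ localDeriv c g n x := by
  refine Real.sSup_nonneg ?_
  rintro _ ⟨j, _, rfl⟩
  exact slope_nonneg c g n j

theorem dev_le_globalDev (h : IsSetup c lam B n g q) {j : ℕ} (hj : 1 ≤ j)
    (hjM : j ≤ numIntervals c n) : n * dev lam c g n j ≤ globalDev lam c g n := by
  obtain ⟨x, hx, hxj⟩ := exists_idx_eq h.c_ge h.two_le hj hjM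
  refine (h.dev_le_localDev (x := x) ⟨hj, hjM, by omega, by omega⟩).trans
    (le_csSup ⟨n * B, ?_⟩ ⟨x, hx, rfl⟩)
  rintro _ ⟨y, _, rfl⟩
  refine mul_le_mul_of_nonneg_left (Real.sSup_le ?_ h.B_pos.le) h.pos.le
  rintro _ ⟨i, _, rfl⟩
  exact h.dev_le_bound i

theorem slope_le_globalDeriv (h : IsSetup c lam B n g q) {j : ℕ} (hj : 1 ≤ j)
    (hjM : j ≤ numIntervals c n) : slope c g n j ≤ globalDeriv c g n := by
  obtain ⟨x, hx, hxj⟩ := exists_idx_eq h.c_ge h.two_le hj hjM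
  refine (slope_le_localDeriv (x := x) ⟨hj, hjM, by omega, by omega⟩).trans
    (le_csSup ⟨2 * B * n, ?_⟩ ⟨x, hx, rfl⟩)
  rintro _ ⟨y, _, rfl⟩
  refine Real.sSup_le ?_ (by have := h.B_pos; positivity)
  rintro _ ⟨i, _, rfl⟩
  exact h.slope_le_bound i

theorem globalDev_nonneg (lam c : ℝ) (g : ℝ → ℝ) (n : ℕ) : 0 ≤ globalDev lam c g n := by
  refine Real.sSup_nonneg ?_
  rintro _ ⟨x, _, rfl⟩
  exact localDev_nonneg lam c g n x

theorem globalDeriv_nonneg (c : ℝ) (g : ℝ → ℝ) (n : ℕ) : 0 ≤ globalDeriv c g n := by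
  refine Real.sSup_nonneg ?_
  rintro _ ⟨x, _, rfl⟩
  exact localDeriv_nonneg c g n x

theorem totalDev_nonneg (lam c : ℝ) (g : ℝ → ℝ) (n : ℕ) : 0 ≤ totalDev lam c g n :=
  add_nonneg (globalDeriv_nonneg c g n) (globalDev_nonneg lam c g n)

/-! ### The estimator is close to a function of the second frequency -/

theorem deg_le_nat (h : IsSetup c lam B n g q) : deg lam n ≤ n := by
  have := twenty_mul_deg_le h.two_le h.lam_lt
  omega

theorem abs_unbiasedEval_sub_lt (h : IsSetup c lam B n g q) {i j : ℕ} (hi : 1 ≤ i)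
    (hij : i < j) (hji : j ≤ i + 3) (hjM : j ≤ numIntervals c n) {k : ℕ} (hk : k ≤ n)
    (hki : (k : ℝ) / n ∈ widePiece c n i) (hkj : (k : ℝ) / n ∈ widePiece c n j) :
    |unbiasedEval n (q i) ((k : ℝ) / n) - unbiasedEval n (q j) ((k : ℝ) / n)|
      ≤ 10 ^ deg lam n * (2 * dev lam c g n i + 2 * dev lam c g n j) := by
  have h0 := cn_pos h.c_ge h.two_le
  have hn := h.pos
  have hα : j - 3 = 0 ∨ cn c n * (((j - 3 : ℕ) : ℝ) + 1) ^ 2 ≤ 1 := by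
    rcases Nat.lt_or_ge 3 j with h3 | h3
    · right
      have := (cn_mul_sq_lt_one h.c_ge h.two_le (m := j - 3 + 1) (by omega)).le
      exact_mod_cast this
    · left; omega
  -- As `j ≤ i + 3`, the overlap of the two extended intervals contains an entire interval of the
  -- partition and is therefore long. There both polynomials are close to `g`, so the bound for
  -- unbiased estimators applies to their difference.
  have hlong := (partition_interval h.c_ge h.lam_lt h.two_le (α := j - 3) (β := i + 2) (by omega)
    hα).1
  have hle : (i : ℝ) ≤ j := by exact_mod_cast hij.le
  have hli : leftEnd c n i ≤ leftEnd c n j := by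
    unfold leftEnd
    have : ((i - 3 : ℕ) : ℝ) ≤ ((j - 3 : ℕ) : ℝ) := by exact_mod_cast (by omega : i - 3 ≤ j - 3)
    gcongr
  have hri : min 1 (cn c n * ((i : ℝ) + 2) ^ 2) ≤ min 1 (cn c n * ((j : ℝ) + 2) ^ 2) := by
    gcongr
  have hJ : Set.Icc (cn c n * ((j - 3 : ℕ) : ℝ) ^ 2) (cn c n * ((j - 3 : ℕ) : ℝ) ^ 2
      + (min 1 (cn c n * ((i + 2 : ℕ) : ℝ) ^ 2) - cn c n * ((j - 3 : ℕ) : ℝ) ^ 2))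
      = Set.Icc (leftEnd c n j) (min 1 (cn c n * ((i : ℝ) + 2) ^ 2)) := by
    rw [add_sub_cancel, leftEnd]; push_cast; rfl
  have hqi := h.natDegree_le hi (by omega : i ≤ numIntervals c n)
  have hqj := h.natDegree_le (by omega : 1 ≤ j) hjM
  have hd := h.deg_le_nat
  rw [← unbiasedEval_sub (hqi.trans hd) (hqj.trans hd) hk]
  refine hlong.abs_unbiasedEval_le ((natDegree_sub_le _ _).trans (max_le hqi hqj)) ?_
    (by exact_mod_cast hn) hk ?_
  · rw [hJ]
    intro x hx
    have h1 := h.abs_sub_eval_le hi (by omega) (x := x) ⟨hli.trans hx.1, hx.2⟩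
    have h2 := h.abs_sub_eval_le (by omega) hjM (x := x) ⟨hx.1, hx.2.trans hri⟩
    rw [eval_sub, show (q i).eval x - (q j).eval x
      = (g x - (q j).eval x) - (g x - (q i).eval x) by ring]
    exact (abs_sub _ _).trans (by linarith)
  · rw [hJ]; exact ⟨hkj.1, hki.2⟩

/-- The unbiased estimators of overlapping pieces are close to each other on the overlap. -/
theorem abs_unbiasedEval_sub_le (h : IsSetup c lam B n g q) {i j : ℕ} (hi : 1 ≤ i)
    (hiM : i ≤ numIntervals c n) (hj : 1 ≤ j) (hjM : j ≤ numIntervals c n) (hij : i ≤ j + 3)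
    (hji : j ≤ i + 3) {k : ℕ} (hk : k ≤ n)
    (hki : (k : ℝ) / n ∈ widePiece c n i) (hkj : (k : ℝ) / n ∈ widePiece c n j) :
    |unbiasedEval n (q i) ((k : ℝ) / n) - unbiasedEval n (q j) ((k : ℝ) / n)|
      ≤ 10 ^ deg lam n * (2 * dev lam c g n i + 2 * dev lam c g n j) := by
  rcases lt_trichotomy i j with hlt | rfl | hlt
  · exact h.abs_unbiasedEval_sub_lt hi hlt hji hjM hk hki hkj
  · have := dev_nonneg lam c g n i
    rw [sub_self, abs_zero]; positivity
  · rw [abs_sub_comm, add_comm]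
    exact h.abs_unbiasedEval_sub_lt hj hlt hij hiM hk hkj hki

theorem natCast_div_mem (h : IsSetup c lam B n g q) {k : ℕ} (hk : k ≤ n) :
    (k : ℝ) / n ∈ Set.Icc (0 : ℝ) 1 := by
  have := h.pos
  exact ⟨by positivity, (div_le_one this).2 (by exact_mod_cast hk)⟩

/-- The index of the local approximation used by the estimator. -/
theorem exists_estimator_eq (h : IsSetup c lam B n g q) {x y : ℝ} (hx : x ∈ Set.Icc (0 : ℝ) 1)
    (hy : y ∈ Set.Icc (0 : ℝ) 1) : ∃ j, 1 ≤ j ∧ j ≤ numIntervals c n ∧ y ∈ widePiece c n j ∧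
      estimator c n q x y = unbiasedEval n (q j) y := by
  by_cases hxy : y ∈ widePiece c n (idx c n x)
  · obtain ⟨h1, h2, -⟩ := idx_spec h.c_ge h.two_le hx
    exact ⟨_, h1, h2, hxy, if_pos hxy⟩
  · obtain ⟨h1, h2, -⟩ := idx_spec h.c_ge h.two_le hy
    exact ⟨_, h1, h2, mem_widePiece_idx h.c_ge h.two_le hy (by omega) (by omega), if_neg hxy⟩

theorem abs_unbiasedEval_le (h : IsSetup c lam B n g q) {j : ℕ} (hj : 1 ≤ j)
    (hjM : j ≤ numIntervals c n) {k : ℕ} (hk : k ≤ n) (hkj : (k : ℝ) / n ∈ widePiece c n j) :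
    |unbiasedEval n (q j) ((k : ℝ) / n)| ≤ 3 * B * n := by
  have hB := h.B_pos
  have hn1 : (1 : ℝ) ≤ n := by have := h.two_le; exact_mod_cast (by omega : 1 ≤ n)
  have h10 : (10 : ℝ) ^ deg lam n ≤ n := by
    refine (ten_pow_deg_le h.two_le h.lam_pos h.lam_lt).trans ?_
    calc (n : ℝ) ^ lam ≤ (n : ℝ) ^ (1 : ℝ) :=
          Real.rpow_le_rpow_of_exponent_le hn1 (by linarith [h.lam_lt])
      _ = n := Real.rpow_one _
  have h1 := (h.long hj hjM).abs_unbiasedEval_le (h.natDegree_le hj hjM) (A := 3 * B)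
    (fun x hx => h.abs_eval_le hj hjM (by rwa [widePiece_eq])) (by exact_mod_cast h.pos) hk
    (by rwa [← widePiece_eq])
  refine h1.trans ?_
  rw [mul_comm]
  gcongr

theorem abs_estimator_le (h : IsSetup c lam B n g q) {k l : ℕ} (hk : k ≤ n) (hl : l ≤ n) :
    |estimator c n q ((k : ℝ) / n) ((l : ℝ) / n)| ≤ 3 * B * n := by
  obtain ⟨j, hj, hjM, hlj, e⟩ :=
    h.exists_estimator_eq (h.natCast_div_mem hk) (h.natCast_div_mem hl)
  rw [e]
  exact h.abs_unbiasedEval_le hj hjM hl hlj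

/-- The value at `y` of the piece of the estimator determined by `y` alone. -/
def diagonal (c : ℝ) (n : ℕ) (q : ℕ → ℝ[X]) (y : ℝ) : ℝ := unbiasedEval n (q (idx c n y)) y

theorem abs_unbiasedEval_sub_diagonal_le (h : IsSetup c lam B n g q) {j : ℕ} (hj : 1 ≤ j)
    (hjM : j ≤ numIntervals c n) {l : ℕ} (hl : l ≤ n) (hlj : (l : ℝ) / n ∈ widePiece c n j) :
    |unbiasedEval n (q j) ((l : ℝ) / n) - diagonal c n q ((l : ℝ) / n)|
      ≤ 4 * ((n : ℝ) ^ lam * totalDev lam c g n / n) := by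
  have hn := h.pos
  have hl' := h.natCast_div_mem hl
  obtain ⟨i1, i2, i3⟩ := idx_spec h.c_ge h.two_le hl'
  obtain ⟨n1, n2⟩ := idx_near_of_mem_widePiece h.c_ge h.two_le hlj
  have h1 := h.abs_unbiasedEval_sub_le hj hjM i1 i2 n2 n1 hl hlj
    (mem_widePiece_idx h.c_ge h.two_le hl' (by omega) (by omega))
  have hD : ∀ i, 1 ≤ i → i ≤ numIntervals c n → dev lam c g n i ≤ totalDev lam c g n / n := by
    intro i hi hiM
    rw [le_div_iff₀ hn, mul_comm]
    have := h.dev_le_globalDev hi hiM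
    have := globalDeriv_nonneg c g n
    unfold totalDev
    linarith
  have h10 := ten_pow_deg_le h.two_le h.lam_pos h.lam_lt
  have hT : 0 ≤ totalDev lam c g n / n := div_nonneg (totalDev_nonneg _ _ _ _) hn.le
  refine h1.trans ?_
  calc _ ≤ (n : ℝ) ^ lam * (2 * (totalDev lam c g n / n) + 2 * (totalDev lam c g n / n)) := by
        have := hD j hj hjM
        have := hD _ i1 i2
        have := dev_nonneg lam c g n j
        have := dev_nonneg lam c g n (idx c n ((l : ℝ) / n))
        gcongr
    _ = _ := by ring

theorem abs_estimator_sub_diagonal_le (h : IsSetup c lam B n g q) {x : ℝ}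
    (hx : x ∈ Set.Icc (0 : ℝ) 1) {l : ℕ} (hl : l ≤ n) :
    |estimator c n q x ((l : ℝ) / n) - diagonal c n q ((l : ℝ) / n)|
      ≤ 4 * ((n : ℝ) ^ lam * totalDev lam c g n / n) := by
  obtain ⟨j, hj, hjM, hlj, e⟩ := h.exists_estimator_eq hx (h.natCast_div_mem hl)
  rw [e]
  exact h.abs_unbiasedEval_sub_diagonal_le hj hjM hl hlj

theorem unbiasedEval_C (n : ℕ) (a x : ℝ) : unbiasedEval n (C a) x = a := by
  simp [unbiasedEval]

theorem abs_unbiasedEval_succ_sub_le (h : IsSetup c lam B n g q) {j : ℕ} (hj : 1 ≤ j)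
    (hjM : j ≤ numIntervals c n) {k : ℕ} (hk : k + 1 ≤ n) (hkj : (k : ℝ) / n ∈ widePiece c n j)
    (hkj' : ((k + 1 : ℕ) : ℝ) / n ∈ widePiece c n j) :
    |unbiasedEval n (q j) (((k + 1 : ℕ) : ℝ) / n) - unbiasedEval n (q j) ((k : ℝ) / n)|
      ≤ 3 * ((n : ℝ) ^ lam * totalDev lam c g n / n) := by
  have hn := h.pos
  have hl := (h.long hj hjM).length_pos
  have h2 := h.two_le_mul_wideLength hj hjM
  have hd := h.deg_le_nat
  have hq := h.natDegree_le hj hjM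
  set a := (q j).eval (leftEnd c n j) with ha
  have hA : ∀ x ∈ Set.Icc (leftEnd c n j) (leftEnd c n j + wideLength c n j),
      |(q j - C a).eval x|
        ≤ 2 * dev lam c g n j + 3 * (slope c g n j * wideLength c n j) := by
    intro x hx
    rw [← widePiece_eq] at hx
    rw [eval_sub, eval_C, ha]
    have := h.osc_le hj hjM hx (h.left_mem hj hjM)
    exact (h.abs_eval_sub_eval_le hj hjM hx (h.left_mem hj hjM)).trans (by linarith)
  have hqa : (q j - C a).natDegree ≤ deg lam n := by rw [natDegree_sub_C]; exact hq
  rw [widePiece_eq] at hkj hkj'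
  have h1 := (h.long hj hjM).abs_unbiasedEval_sub_le hqa hA hk hkj hkj'
  rw [unbiasedEval_sub (hq.trans hd) (by simp) hk, unbiasedEval_sub (hq.trans hd) (by simp)
    (by omega), unbiasedEval_C, unbiasedEval_C, sub_sub_sub_cancel_right] at h1
  refine h1.trans ?_
  have hT : 2 * dev lam c g n j + 3 * (slope c g n j * wideLength c n j)
      ≤ 3 * (totalDev lam c g n * wideLength c n j) := by
    have e1 := h.dev_le_globalDev hj hjM
    have e2 := h.slope_le_globalDeriv hj hjM
    have e3 := dev_nonneg lam c g n j
    -- `n * wideLength c n j ≥ 2` turns the deviation, too, into a multiple of the length, which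
    -- then cancels against the length in the difference bound.
    have e4 : 2 * dev lam c g n j ≤ globalDev lam c g n * wideLength c n j := by
      nlinarith
    have e5 := mul_le_mul_of_nonneg_right e2 hl.le
    have e6 := mul_nonneg (globalDev_nonneg lam c g n) hl.le
    unfold totalDev
    nlinarith
  have hdl := deg_mul_ten_pow_le h.two_le h.lam_lt
  have hT0 := totalDev_nonneg lam c g n
  have hA0 := (abs_nonneg _).trans (hA _ hkj)
  calc _ ≤ (n : ℝ) ^ lam * (3 * (totalDev lam c g n * wideLength c n j))
        / (n * wideLength c n j) := by gcongr
    _ = _ := by field_simp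

/-- Since `1 / n ≤ c_n`, both frequencies lie in the extended interval of the first. One step with a
fixed polynomial costs 3, exchanging the polynomial costs 4. -/
theorem abs_diagonal_succ_sub_le (h : IsSetup c lam B n g q) {l : ℕ} (hl : l + 1 ≤ n) :
    |diagonal c n q (((l + 1 : ℕ) : ℝ) / n) - diagonal c n q ((l : ℝ) / n)|
      ≤ 7 * ((n : ℝ) ^ lam * totalDev lam c g n / n) := by
  have hn := h.pos
  have h0 := cn_pos h.c_ge h.two_le
  have h50 := fifty_le_natCast_mul_cn h.c_ge h.two_le
  have hl' := h.natCast_div_mem (by omega : l ≤ n)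
  obtain ⟨j1, j2, j3⟩ := idx_spec h.c_ge h.two_le hl'
  have hmem := mem_widePiece_idx h.c_ge h.two_le hl' (j := idx c n ((l : ℝ) / n)) (by omega)
    (by omega)
  set j := idx c n ((l : ℝ) / n) with hj
  have hstep : ((l + 1 : ℕ) : ℝ) / n = (l : ℝ) / n + 1 / n := by push_cast; ring
  have h1n : 1 / (n : ℝ) ≤ cn c n := by rw [div_le_iff₀ hn]; linarith
  have h1n0 : 0 ≤ 1 / (n : ℝ) := by positivity
  have hmem' : ((l + 1 : ℕ) : ℝ) / n ∈ widePiece c n j := by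
    refine ⟨?_, le_min (h.natCast_div_mem hl).2 ?_⟩
    · rw [hstep]; linarith [hmem.1]
    · rw [hstep]
      have := j3.2.trans (min_le_right _ _)
      have hj0 : (0 : ℝ) ≤ j := j.cast_nonneg
      nlinarith [mul_nonneg h0.le hj0]
  have e1 := h.abs_unbiasedEval_succ_sub_le j1 j2 hl hmem hmem'
  have e2 := h.abs_unbiasedEval_sub_diagonal_le j1 j2 hl hmem'
  have e3 : diagonal c n q ((l : ℝ) / n) = unbiasedEval n (q j) ((l : ℝ) / n) := rfl
  rw [e3]
  rw [abs_sub_comm] at e2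
  have := abs_sub_le (diagonal c n q (((l + 1 : ℕ) : ℝ) / n))
    (unbiasedEval n (q j) (((l + 1 : ℕ) : ℝ) / n)) (unbiasedEval n (q j) ((l : ℝ) / n))
  linarith

/-- The estimator has bounded differences in the first frequency. -/
theorem abs_estimator_sub_left_le (h : IsSetup c lam B n g q) {x x' : ℝ}
    (hx : x ∈ Set.Icc (0 : ℝ) 1) (hx' : x' ∈ Set.Icc (0 : ℝ) 1) {l : ℕ} (hl : l ≤ n) :
    |estimator c n q x ((l : ℝ) / n) - estimator c n q x' ((l : ℝ) / n)|
      ≤ 15 * ((n : ℝ) ^ lam * totalDev lam c g n / n) := by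
  have e1 := h.abs_estimator_sub_diagonal_le hx hl
  have e2 := h.abs_estimator_sub_diagonal_le hx' hl
  rw [abs_sub_comm] at e2
  have e3 := abs_sub_le (estimator c n q x ((l : ℝ) / n)) (diagonal c n q ((l : ℝ) / n))
    (estimator c n q x' ((l : ℝ) / n))
  have e4 : 0 ≤ (n : ℝ) ^ lam * totalDev lam c g n / n := by
    have := totalDev_nonneg lam c g n
    positivity
  linarith

/-- The estimator has bounded differences in the second frequency. -/
theorem abs_estimator_sub_right_le (h : IsSetup c lam B n g q) {x : ℝ}
    (hx : x ∈ Set.Icc (0 : ℝ) 1) {l : ℕ} (hl : l + 1 ≤ n) :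
    |estimator c n q x (((l + 1 : ℕ) : ℝ) / n) - estimator c n q x ((l : ℝ) / n)|
      ≤ 15 * ((n : ℝ) ^ lam * totalDev lam c g n / n) := by
  have e1 := abs_le.1 (h.abs_estimator_sub_diagonal_le hx hl)
  have e2 := abs_le.1 (h.abs_estimator_sub_diagonal_le hx (by omega : l ≤ n))
  have e3 := abs_le.1 (h.abs_diagonal_succ_sub_le hl)
  exact abs_le.2 ⟨by linarith [e1.1, e2.2, e3.1], by linarith [e1.2, e2.1, e3.2]⟩

end IsSetup

/-! ### The law of the sample -/

/-- The weight of a Bernoulli outcome. -/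
def bernoulliWeight (p : ℝ) (b : Bool) : ℝ := if b then p else 1 - p

/-- Number of ones in a sample. -/
def ones {m : ℕ} (X : Fin m → Bool) : ℕ := (Finset.univ.filter fun i => X i = true).card

instance (p : unitInterval) (m : ℕ) : IsProbabilityMeasure (sampleLaw p m) := by
  unfold sampleLaw; infer_instance

theorem integral_sampleLaw (p : unitInterval) (m : ℕ) (f : (Fin m → Bool) → ℝ) :
    ∫ X, f X ∂(sampleLaw p m) = ∑ X, (∏ i, bernoulliWeight p (X i)) * f X := by
  rw [integral_fintype .of_finite]
  refine Finset.sum_congr rfl fun X _ => ?_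
  rw [smul_eq_mul]
  congr 1
  rw [sampleLaw, measureReal_def, Measure.pi_singleton, ENNReal.toReal_prod]
  refine Finset.prod_congr rfl fun i _ => ?_
  rw [← measureReal_def, bernoulliMeasure_real_apply p (by measurability)]
  cases X i <;> simp [bernoulliWeight]

theorem sum_bernoulliWeight (p : ℝ) (m : ℕ) (f : ℕ → ℝ) :
    ∑ X : Fin m → Bool, (∏ i, bernoulliWeight p (X i)) * f (ones X) = binomExp p m f := by
  induction m generalizing f with
  | zero => simp [binomExp_zero, ones]
  | succ m ih =>
    rw [← (Fin.consEquiv fun _ => Bool).sum_comp, Fintype.sum_prod_type, binomExp_succ, ← ih f,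
      ← ih fun k => f (k + 1), Finset.mul_sum, Finset.mul_sum, Fintype.sum_bool]
    have hones : ∀ (b : Bool) (X : Fin m → Bool),
        ones (Fin.consEquiv (fun _ => Bool) (b, X)) = ones X + if b then 1 else 0 := by
      intro b X
      unfold ones
      rw [Finset.card_filter, Finset.card_filter, Fin.sum_univ_succ]
      simp [Fin.consEquiv, add_comm]
    congr 1 <;> refine Finset.sum_congr rfl fun X _ => ?_
    · rw [hones, Fin.prod_univ_succ]
      simp [Fin.consEquiv, bernoulliWeight, mul_assoc]
    · rw [hones, Fin.prod_univ_succ]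
      simp [Fin.consEquiv, bernoulliWeight, mul_assoc]

theorem integral_sampleLaw_frequencies (p : unitInterval) (n : ℕ) (F : ℝ → ℝ → ℝ) :
    ∫ X, F (freq₁ n X) (freq₂ n X) ∂(sampleLaw p (n + n))
      = binomExp p n fun k => binomExp p n fun l => F ((k : ℝ) / n) ((l : ℝ) / n) := by
  rw [integral_sampleLaw, ← (Fin.appendEquiv n n).sum_comp, Fintype.sum_prod_type,
    ← sum_bernoulliWeight]
  refine Finset.sum_congr rfl fun X _ => ?_
  rw [← sum_bernoulliWeight, Finset.mul_sum]
  refine Finset.sum_congr rfl fun Y _ => ?_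
  rw [Fin.prod_univ_add]
  simp [-Fin.natAdd_eq_addNat, Fin.appendEquiv, freq₁, freq₂, ones, mul_assoc]

/-- The expectation of a function of the two empirical frequencies. -/
def sampleExp (p : ℝ) (n : ℕ) (F : ℝ → ℝ → ℝ) : ℝ :=
  binomExp p n fun k => binomExp p n fun l => F ((k : ℝ) / n) ((l : ℝ) / n)

theorem integral_sampleEstimator (p : unitInterval) (c : ℝ) (n : ℕ) (q : ℕ → ℝ[X]) :
    ∫ X, sampleEstimator c n q X ∂(sampleLaw p (n + n)) = sampleExp p n (estimator c n q) :=
  integral_sampleLaw_frequencies p n (estimator c n q)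

/-- Any centre may replace the mean; `q_i(p)` with `i = idx c n p` will be used, so the bias does
not enter. -/
theorem variance_sampleEstimator_le (p : unitInterval) (c : ℝ) (n : ℕ) (q : ℕ → ℝ[X]) (a : ℝ) :
    Var[sampleEstimator c n q; sampleLaw p (n + n)]
      ≤ sampleExp p n fun x y => (estimator c n q x y - a) ^ 2 := by
  have hm : ∀ f : (Fin (n + n) → Bool) → ℝ, AEStronglyMeasurable f (sampleLaw p (n + n)) :=
    fun f => (measurable_of_finite f).aestronglyMeasurable
  rw [← variance_sub_const (hm _) a]
  refine (variance_le_expectation_sq (hm _)).trans_eq ?_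
  exact integral_sampleLaw_frequencies p n fun x y => (estimator c n q x y - a) ^ 2

open Classical in
theorem sampleLaw_real_deviation (p : unitInterval) (c : ℝ) (n : ℕ) (q : ℕ → ℝ[X]) (ε : ℝ) :
    (sampleLaw p (n + n)).real {X | ε < |sampleEstimator c n q X
        - ∫ Y, sampleEstimator c n q Y ∂(sampleLaw p (n + n))|}
      = sampleExp p n fun x y =>
        if ε < |estimator c n q x y - sampleExp p n (estimator c n q)| then 1 else 0 := by
  rw [integral_sampleEstimator, ← integral_indicator_one (Set.toFinite _).measurableSet]
  refine Eq.trans ?_ (integral_sampleLaw_frequencies p n fun x y =>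
    if ε < |estimator c n q x y - sampleExp p n (estimator c n q)| then 1 else 0)
  refine integral_congr_ae (Filter.Eventually.of_forall fun X => ?_)
  simp [Set.indicator_apply, sampleEstimator]

/-! ### Concentration -/

theorem le_two_mul_exp_of_forall {x v ε : ℝ} (hε : 0 < ε) (hv : 0 < v)
    (h : ∀ t : ℝ, 0 ≤ t → x ≤ 2 * Real.exp (v * t ^ 2 - t * ε)) :
    x ≤ 2 * Real.exp (-(ε ^ 2 / (4 * v))) := by
  refine (h (ε / (2 * v)) (by positivity)).trans_eq ?_
  congr 2
  field_simp
  ring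

theorem IsSetup.deviation_le {c lam B : ℝ} {n : ℕ} {g : ℝ → ℝ} {q : ℕ → ℝ[X]}
    (h : IsSetup c lam B n g q) (p : unitInterval) {ε : ℝ} (hε : 0 < ε) :
    (sampleLaw p (n + n)).real {X | ε < |sampleEstimator c n q X
        - ∫ Y, sampleEstimator c n q Y ∂(sampleLaw p (n + n))|}
      ≤ if totalDev lam c g n = 0 then 0 else
          2 * Real.exp (-(1 / 1800 * (ε ^ 2 * (2 * n : ℝ) ^ (1 - 2 * lam)
            / totalDev lam c g n ^ 2))) := by
  classical
  have hn := h.pos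
  set S := totalDev lam c g n with hS
  have hS0 : 0 ≤ S := totalDev_nonneg lam c g n
  set r := 15 * ((n : ℝ) ^ lam * S / n) with hr
  rw [sampleLaw_real_deviation]
  set x := sampleExp p n (fun x y =>
    if ε < |estimator c n q x y - sampleExp p n (estimator c n q)| then (1 : ℝ) else 0) with hx
  have hbd : ∀ t : ℝ, 0 ≤ t → x ≤ 2 * Real.exp (n * r ^ 2 * t ^ 2 - t * ε) := by
    intro t ht
    have := binomExp_binomExp_tail_le p.2.1 p.2.2 (n := n)
      (F := fun k l => estimator c n q ((k : ℝ) / n) ((l : ℝ) / n)) (r := r)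
      (fun k hk l hl => h.abs_estimator_sub_left_le (h.natCast_div_mem (by omega))
        (h.natCast_div_mem (by omega)) hl)
      (fun k hk l hl => h.abs_estimator_sub_right_le (h.natCast_div_mem hk) (by omega)) ε ht
    refine this.trans_eq ?_
    congr 2; ring
  split_ifs with h0
  · have hr0 : r = 0 := by rw [hr, h0]; simp
    refine le_of_forall_pos_le_add fun δ hδ => ?_
    -- When `S = 0` the differences vanish and the bound is `2 * exp (-t * ε)`; letting `t` grow
    -- shows that the probability is 0.
    have hb := hbd (2 / (δ * ε)) (by positivity)
    have e1 : n * r ^ 2 * (2 / (δ * ε)) ^ 2 - 2 / (δ * ε) * ε = -(2 / δ) := by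
      rw [hr0]; field_simp; ring
    rw [e1, Real.exp_neg] at hb
    have e2 : 2 / δ ≤ Real.exp (2 / δ) := by linarith [Real.add_one_le_exp (2 / δ)]
    have e3 : (Real.exp (2 / δ))⁻¹ ≤ (2 / δ)⁻¹ := inv_anti₀ (by positivity) e2
    rw [inv_div] at e3
    linarith
  · have hSpos : 0 < S := lt_of_le_of_ne hS0 (Ne.symm h0)
    have hrpos : 0 < r := by positivity
    refine (le_two_mul_exp_of_forall hε (by positivity : 0 < n * r ^ 2) hbd).trans ?_
    gcongr 2 * Real.exp (-?_)
    have e1 : (2 * n : ℝ) ^ (1 - 2 * lam) ≤ 2 * (n : ℝ) ^ (1 - 2 * lam) := by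
      rw [Real.mul_rpow (by norm_num) hn.le]
      gcongr
      calc (2 : ℝ) ^ (1 - 2 * lam) ≤ 2 ^ (1 : ℝ) :=
            Real.rpow_le_rpow_of_exponent_le (by norm_num) (by linarith [h.lam_pos])
        _ = 2 := Real.rpow_one _
    have e2 : (n : ℝ) ^ (1 - 2 * lam) * ((n : ℝ) ^ lam) ^ 2 = n := by
      rw [← Real.rpow_natCast ((n : ℝ) ^ lam), ← Real.rpow_mul hn.le, ← Real.rpow_add hn]
      have : 1 - 2 * lam + lam * ((2 : ℕ) : ℝ) = 1 := by push_cast; ring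
      rw [this, Real.rpow_one]
    -- `900 = 4 * 15 ^ 2`; passing from `n` to `2 * n` costs the last factor 2.
    have e3 : ε ^ 2 / (4 * (n * r ^ 2)) = 1 / 900 * (ε ^ 2 * (n : ℝ) ^ (1 - 2 * lam) / S ^ 2) := by
      rw [hr]
      have hN : 0 < (n : ℝ) ^ lam := by positivity
      have hN' : (n : ℝ) ^ (1 - 2 * lam) = n / ((n : ℝ) ^ lam) ^ 2 := by
        rw [eq_div_iff (by positivity), e2]
      rw [hN']
      field_simp
      norm_num
    rw [e3]
    calc _ ≤ 1 / 1800 * (ε ^ 2 * (2 * (n : ℝ) ^ (1 - 2 * lam)) / S ^ 2) := by gcongr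
      _ = _ := by ring

/-! ### Atypical frequencies -/

/-- The number `k` of ones among `n` samples is atypical for the parameter `p`. -/
def IsAtypical (c : ℝ) (n : ℕ) (p : ℝ) (k : ℕ) : Prop := √(cn c n) / 2 < |√((k : ℝ) / n) - √p|

theorem binomProb_isAtypical_le {c p : ℝ} {n : ℕ} (hc : 100 ≤ c) (hn : 2 ≤ n) (hp0 : 0 ≤ p)
    (hp1 : p ≤ 1) : binomProb p n (IsAtypical c n p) ≤ 100 * p ^ 2 / n ^ 20 := by
  have h0 := cn_pos hc hn
  have h50 := fifty_le_natCast_mul_cn hc hn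
  have hn1 : (1 : ℝ) ≤ n := by exact_mod_cast (by omega : 1 ≤ n)
  have hn0 : (0 : ℝ) < n := by linarith
  have hs : 0 < √(cn c n) := Real.sqrt_pos.2 h0
  have hss : √(cn c n) ^ 2 = cn c n := Real.sq_sqrt h0.le
  -- The left side is `n ^ (-c / 4)`, which accounts for the threshold 100 on `c`.
  have hexp : Real.exp (-(n * cn c n / 4)) ≤ 1 / n ^ 25 := by
    rw [natCast_mul_cn hn, one_div, ← Real.exp_log (inv_pos.2 (pow_pos hn0 25)), Real.log_inv,
      Real.log_pow]
    refine Real.exp_le_exp.2 ?_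
    have := half_le_log hn
    push_cast
    nlinarith
  have hpow : 1 / (n : ℝ) ^ 25 ≤ 1 / n ^ 22 := by
    gcongr
    norm_num
  -- The factor `p ^ 2`, not only `p`, is needed because Cauchy–Schwarz later takes a square root.
  -- It comes from the size-bias bound if `n p ≤ 1`; otherwise `(n p) ^ 2 ≥ 1` is inserted for free.
  rcases le_or_gt (n * p) 1 with hnp | hnp
  · have hKbad : ∀ k ≤ n, IsAtypical c n p k → n * cn c n / 4 ≤ k := by
      intro k _ hk
      have hsp : √p ≤ √(cn c n) / 2 := by
        refine Real.sqrt_le_iff.2 ⟨by positivity, ?_⟩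
        rw [div_pow, hss]
        have : n * p ≤ n * (cn c n / 2 ^ 2) := by linarith
        exact le_of_mul_le_mul_left this hn0
      have hk' : √(cn c n) / 2 < √((k : ℝ) / n) := by
        have hp := Real.sqrt_nonneg p
        have hkn := Real.sqrt_nonneg ((k : ℝ) / n)
        rcases lt_abs.1 hk with h | h <;> linarith
      have h1 : (√(cn c n) / 2) ^ 2 ≤ (k : ℝ) / n := by
        rw [← Real.sq_sqrt (by positivity : 0 ≤ (k : ℝ) / n)]
        gcongr
      rw [div_pow, hss, le_div_iff₀ hn0] at h1
      linarith
    refine (binomProb_mono hp0 hp1 hKbad).trans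
      ((binomProb_ge_le hp0 hp1 hnp (by linarith)).trans ?_)
    have e4 : Real.exp 4 ≤ 100 := by
      have h := Real.exp_one_lt_d9
      have : Real.exp 4 = Real.exp 1 ^ 4 := by rw [← Real.exp_nat_mul]; norm_num
      rw [this]
      calc Real.exp 1 ^ 4 ≤ 2.72 ^ 4 := by
            gcongr; linarith
        _ ≤ 100 := by norm_num
    rw [sub_eq_add_neg, Real.exp_add]
    calc _ ≤ (n * p) ^ 2 * (100 * (1 / n ^ 22)) := by
          gcongr; exact hexp.trans hpow
      _ = _ := by field_simp
  · have hp : 0 < p := by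
      by_contra hneg
      have : p = 0 := le_antisymm (not_lt.1 hneg) hp0
      rw [this] at hnp; simp at hnp; linarith
    refine (binomProb_sqrt_sub_sqrt_le hp hp1 (by omega) (by positivity)).trans ?_
    have e : (n : ℝ) * (√(cn c n) / 2) ^ 2 = n * cn c n / 4 := by rw [div_pow, hss]; ring
    rw [e]
    have h1 : 1 ≤ (n * p) ^ 2 := one_le_pow₀ hnp.le
    calc _ ≤ 2 * (1 / (n : ℝ) ^ 22) := by linarith [hexp.trans hpow]
      _ ≤ 100 * (n * p) ^ 2 * (1 / (n : ℝ) ^ 22) := by gcongr; linarith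
      _ = _ := by field_simp

/-! ### Typical frequencies and the bias. -/

namespace IsSetup

variable {c lam B : ℝ} {n : ℕ} {g : ℝ → ℝ} {q : ℕ → ℝ[X]} {p : ℝ}

theorem idx_near_of_typical (h : IsSetup c lam B n g q) (hp : p ∈ Set.Icc (0 : ℝ) 1) {k : ℕ}
    (hk : k ≤ n) (hkp : ¬ IsAtypical c n p k) :
    idx c n ((k : ℝ) / n) ≤ idx c n p + 1 ∧ idx c n p ≤ idx c n ((k : ℝ) / n) + 1 := by
  have hkp := abs_le.1 (not_lt.1 hkp)
  exact ⟨idx_le_idx_add_one h.c_ge h.two_le (h.natCast_div_mem hk) hp hkp.2,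
    idx_le_idx_add_one h.c_ge h.two_le hp (h.natCast_div_mem hk) (by linarith [hkp.1])⟩

theorem idx_mem_nearby (h : IsSetup c lam B n g q) (hp : p ∈ Set.Icc (0 : ℝ) 1) {k : ℕ}
    (hk : k ≤ n) (hkp : ¬ IsAtypical c n p k) : idx c n ((k : ℝ) / n) ∈ nearby c n p := by
  have h1 := idx_spec h.c_ge h.two_le (h.natCast_div_mem hk)
  have h2 := h.idx_near_of_typical hp hk hkp
  exact ⟨h1.1, h1.2.1, h2.2, h2.1⟩

theorem self_mem_nearby (h : IsSetup c lam B n g q) (hp : p ∈ Set.Icc (0 : ℝ) 1) :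
    idx c n p ∈ nearby c n p := by
  have h1 := idx_spec h.c_ge h.two_le hp
  exact ⟨h1.1, h1.2.1, by omega, by omega⟩

theorem estimator_eq_of_typical (h : IsSetup c lam B n g q) (hp : p ∈ Set.Icc (0 : ℝ) 1) {k l : ℕ}
    (hk : k ≤ n) (hl : l ≤ n) (hkp : ¬ IsAtypical c n p k) (hlp : ¬ IsAtypical c n p l) :
    estimator c n q ((k : ℝ) / n) ((l : ℝ) / n)
      = unbiasedEval n (q (idx c n ((k : ℝ) / n))) ((l : ℝ) / n) := by
  have h1 := h.idx_near_of_typical hp hk hkp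
  have h2 := h.idx_near_of_typical hp hl hlp
  exact if_pos (mem_widePiece_idx h.c_ge h.two_le (h.natCast_div_mem hl) (by omega) (by omega))

theorem one_le_cast (h : IsSetup c lam B n g q) : (1 : ℝ) ≤ n := by
  have := h.two_le
  exact_mod_cast (by omega : 1 ≤ n)

theorem rpow_lam_le (h : IsSetup c lam B n g q) : (n : ℝ) ^ lam ≤ n := by
  calc (n : ℝ) ^ lam ≤ (n : ℝ) ^ (1 : ℝ) :=
        Real.rpow_le_rpow_of_exponent_le h.one_le_cast (by linarith [h.lam_lt])
    _ = n := Real.rpow_one _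

/-- The pointwise bound fails for frequencies outside `I**_j`; this second moment controls the
unbiased estimator there through Cauchy–Schwarz. -/
theorem binomExp_unbiasedEval_sq_le (h : IsSetup c lam B n g q) (hp : p ∈ Set.Icc (0 : ℝ) 1)
    {j : ℕ} (hj : 1 ≤ j) (hjM : j ≤ numIntervals c n) (hpj : p ∈ widePiece c n j) :
    binomExp p n (fun l => unbiasedEval n (q j) ((l : ℝ) / n) ^ 2) ≤ 36 * B ^ 2 * n ^ 2 := by
  have hn := h.pos
  have hn1 := h.one_le_cast
  have hB := h.B_pos
  have hl := (h.long hj hjM).length_pos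
  have hdp := (widePiece_props h.c_ge h.lam_lt h.two_le hj hjM).2.2 p hpj
  have h20 := twenty_mul_deg_le h.two_le h.lam_lt
  have h10 := (ten_pow_deg_le h.two_le h.lam_pos h.lam_lt).trans h.rpow_lam_le
  have hq1 := h.abs_eval_le hj hjM hpj
  have hpj' := hpj
  rw [widePiece_eq] at hpj'
  have hV := binomExp_unbiasedEval_sub_sq_le hp.1 hp.2 hl hpj' (by omega) hdp
    (h.natDegree_le hj hjM) (A := 3 * B) (by exact_mod_cast hn)
    fun x hx => h.abs_eval_le hj hjM (by rwa [widePiece_eq])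
  have hV' : binomExp p n (fun k => (unbiasedEval n (q j) ((k : ℝ) / n) - (q j).eval p) ^ 2)
      ≤ 9 * B ^ 2 * n ^ 2 := by
    refine hV.trans ?_
    calc _ ≤ (n * (3 * B)) ^ 2 * 1 := by
          have hρ : 2 * deg lam n * p / (n * wideLength c n j ^ 2) ≤ 1 :=
            (div_le_one (by positivity)).2 hdp
          have := hp.1
          gcongr
      _ = _ := by ring
  have hsq : (q j).eval p ^ 2 ≤ 9 * B ^ 2 * n ^ 2 := by
    calc _ = |(q j).eval p| ^ 2 := (sq_abs _).symm
      _ ≤ (3 * B) ^ 2 := by gcongr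
      _ = 9 * B ^ 2 * 1 ^ 2 := by ring
      _ ≤ _ := by gcongr
  have hpt : ∀ k ≤ n, unbiasedEval n (q j) ((k : ℝ) / n) ^ 2
      ≤ 2 * (unbiasedEval n (q j) ((k : ℝ) / n) - (q j).eval p) ^ 2 + 2 * (q j).eval p ^ 2 := by
    intro k _
    nlinarith [sq_nonneg (unbiasedEval n (q j) ((k : ℝ) / n) - (q j).eval p - (q j).eval p)]
  refine (binomExp_mono hp.1 hp.2 hpt).trans ?_
  rw [binomExp_add, binomExp_const_mul, binomExp_const]
  linarith

open Classical in
/-- Conditional bias, given a typical first frequency. -/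
theorem abs_binomExp_estimator_sub_le (h : IsSetup c lam B n g q) (hp : p ∈ Set.Icc (0 : ℝ) 1)
    {k : ℕ} (hk : k ≤ n) (hkp : ¬ IsAtypical c n p k) :
    |binomExp p n (fun l => estimator c n q ((k : ℝ) / n) ((l : ℝ) / n)) - g p|
      ≤ 360 * B * (p / n ^ 3) + 2 * (localDev lam c g n p / n) := by
  have hn := h.pos
  have hn1 := h.one_le_cast
  have hB := h.B_pos
  have hp0 := hp.1
  have hp1 := hp.2
  set j := idx c n ((k : ℝ) / n) with hj
  obtain ⟨hj1, hjM, hj3, hj4⟩ := h.idx_mem_nearby hp hk hkp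
  have hpj : p ∈ widePiece c n j := mem_widePiece_idx h.c_ge h.two_le hp (by omega) (by omega)
  set u : ℕ → ℝ := fun l => unbiasedEval n (q j) ((l : ℝ) / n) with hu
  set bad : ℕ → ℝ := fun l => if IsAtypical c n p l then 1 else 0 with hbad
  have hP : binomExp p n bad ≤ 100 * p ^ 2 / n ^ 20 :=
    binomProb_isAtypical_le h.c_ge h.two_le hp0 hp1
  have hmean : binomExp p n u = (q j).eval p :=
    binomExp_unbiasedEval p ((h.natDegree_le hj1 hjM).trans h.deg_le_nat)
  -- `k` being fixed, `u` has mean exactly `(q j).eval p` and differs from the estimator only at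
  -- atypical `l`.
  have hpt : ∀ l ≤ n, |estimator c n q ((k : ℝ) / n) ((l : ℝ) / n) - u l|
      ≤ 3 * B * n * bad l + bad l * |u l| := by
    intro l hl
    by_cases hlp : IsAtypical c n p l
    · simp only [hbad, if_pos hlp, mul_one, one_mul]
      exact (abs_sub _ _).trans (add_le_add (h.abs_estimator_le hk hl) le_rfl)
    · rw [h.estimator_eq_of_typical hp hk hl hkp hlp]
      simp only [hbad, if_neg hlp]
      simp [hu, hj]
  have hdiff := abs_binomExp_le hp0 hp1 hpt
  rw [binomExp_sub, hmean, binomExp_add, binomExp_const_mul] at hdiff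
  have hcs : binomExp p n (fun l => bad l * |u l|) ≤ 60 * B * (p / n ^ 3) := by
    have h1 := binomExp_mul_sq_le hp0 hp1 n bad (fun l => |u l|)
    have e1 : (fun l => bad l ^ 2) = bad := by
      funext l; simp only [hbad]; split_ifs <;> norm_num
    have e2 : (fun l => |u l| ^ 2) = fun l => u l ^ 2 := by funext l; exact sq_abs _
    rw [e1, e2] at h1
    have h2 := h.binomExp_unbiasedEval_sq_le hp hj1 hjM hpj
    have h3 : binomExp p n bad * binomExp p n (fun l => u l ^ 2)
        ≤ 100 * p ^ 2 / n ^ 20 * (36 * B ^ 2 * n ^ 2) :=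
      mul_le_mul hP h2 (binomExp_nonneg hp0 hp1 fun _ _ => sq_nonneg _) (by positivity)
    have h4 : 100 * p ^ 2 / (n : ℝ) ^ 20 * (36 * B ^ 2 * n ^ 2) ≤ (60 * B * (p / n ^ 3)) ^ 2 := by
      have h5 : (n : ℝ) ^ 2 / n ^ 20 ≤ 1 / n ^ 6 := by
        rw [div_le_div_iff₀ (by positivity) (by positivity), one_mul, ← pow_add]
        exact pow_le_pow_right₀ hn1 (by norm_num)
      calc _ = 3600 * (B ^ 2 * p ^ 2) * ((n : ℝ) ^ 2 / n ^ 20) := by ring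
        _ ≤ 3600 * (B ^ 2 * p ^ 2) * (1 / n ^ 6) := by gcongr
        _ = _ := by field_simp; ring
    exact le_of_sq_le_sq (h1.trans (h3.trans h4)) (by positivity)
  have hb1 : 3 * B * n * binomExp p n bad ≤ 300 * B * (p / n ^ 3) := by
    have h5 : (n : ℝ) / n ^ 20 ≤ 1 / n ^ 3 := by
      rw [div_le_div_iff₀ (by positivity) (by positivity), one_mul, ← pow_succ']
      exact pow_le_pow_right₀ hn1 (by norm_num)
    have h6 : p ^ 2 ≤ p := by nlinarith
    calc _ ≤ 3 * B * n * (100 * p ^ 2 / n ^ 20) := by gcongr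
      _ = 300 * (B * p ^ 2) * ((n : ℝ) / n ^ 20) := by ring
      _ ≤ 300 * (B * p) * (1 / n ^ 3) := by gcongr
      _ = _ := by ring
  have hdev : 2 * dev lam c g n j ≤ 2 * (localDev lam c g n p / n) := by
    have := h.dev_le_localDev (x := p) (j := j) ⟨hj1, hjM, hj3, hj4⟩
    have : dev lam c g n j ≤ localDev lam c g n p / n := by
      rw [le_div_iff₀ hn]; linarith
    linarith
  have hg := h.abs_sub_eval_le hj1 hjM hpj
  rw [abs_sub_comm] at hg
  have := abs_sub_le (binomExp p n fun l => estimator c n q ((k : ℝ) / n) ((l : ℝ) / n))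
    ((q j).eval p) (g p)
  linarith

open Classical in
theorem bias_le (h : IsSetup c lam B n g q) (hp : p ∈ Set.Icc (0 : ℝ) 1) :
    |sampleExp p n (estimator c n q) - g p|
      ≤ 760 * B * (p / n ^ 3) + 2 * (localDev lam c g n p / n) := by
  have hn := h.pos
  have hn1 := h.one_le_cast
  have hB := h.B_pos
  have hp0 := hp.1
  have hp1 := hp.2
  set bad : ℕ → ℝ := fun l => if IsAtypical c n p l then 1 else 0 with hbad
  have hP : binomExp p n bad ≤ 100 * p ^ 2 / n ^ 20 :=
    binomProb_isAtypical_le h.c_ge h.two_le hp0 hp1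
  set K := 360 * B * (p / n ^ 3) + 2 * (localDev lam c g n p / n) with hK
  have hK0 : 0 ≤ K := by
    have := localDev_nonneg lam c g n p
    positivity
  have hpt : ∀ k ≤ n,
      |binomExp p n (fun l => estimator c n q ((k : ℝ) / n) ((l : ℝ) / n)) - g p|
        ≤ K + 4 * B * n * bad k := by
    intro k hk
    by_cases hkp : IsAtypical c n p k
    · simp only [hbad, if_pos hkp, mul_one]
      have h1 := abs_binomExp_le hp0 hp1 (n := n)
        (f := fun l => estimator c n q ((k : ℝ) / n) ((l : ℝ) / n)) (g := fun _ => 3 * B * n)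
        fun l hl => h.abs_estimator_le hk hl
      rw [binomExp_const] at h1
      refine (abs_sub _ _).trans ?_
      have := h.bound p hp
      nlinarith
    · simp only [hbad, if_neg hkp, mul_zero, add_zero]
      exact h.abs_binomExp_estimator_sub_le hp hk hkp
  have hmain := abs_binomExp_le hp0 hp1 hpt
  rw [binomExp_sub, binomExp_const, binomExp_add, binomExp_const, binomExp_const_mul] at hmain
  have hb1 : 4 * B * n * binomExp p n bad ≤ 400 * B * (p / n ^ 3) := by
    have h5 : (n : ℝ) / n ^ 20 ≤ 1 / n ^ 3 := by
      rw [div_le_div_iff₀ (by positivity) (by positivity), one_mul, ← pow_succ']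
      exact pow_le_pow_right₀ hn1 (by norm_num)
    have h6 : p ^ 2 ≤ p := by nlinarith
    calc _ ≤ 4 * B * n * (100 * p ^ 2 / n ^ 20) := by gcongr
      _ = 400 * (B * p ^ 2) * ((n : ℝ) / n ^ 20) := by ring
      _ ≤ 400 * (B * p) * (1 / n ^ 3) := by gcongr
      _ = _ := by ring
  refine hmain.trans ?_
  linarith

/-! ### Variance -/

/-- `(j + 2)² - (j - 3)² = 10 j - 5` for `j ≥ 3`, while truncation leaves at most 16 for `j ≤ 2`. -/
theorem wideLength_le (h : IsSetup c lam B n g q) {i j : ℕ} (hi : 1 ≤ i) (hji : j ≤ i + 1) :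
    wideLength c n j ≤ 16 * (cn c n * i) := by
  have h0 := cn_pos h.c_ge h.two_le
  have hi' : (1 : ℝ) ≤ i := by exact_mod_cast hi
  have hji' : (j : ℝ) ≤ i + 1 := by exact_mod_cast hji
  have hj0 : (0 : ℝ) ≤ j := j.cast_nonneg
  unfold wideLength leftEnd
  have h1 := min_le_right 1 (cn c n * ((j : ℝ) + 2) ^ 2)
  suffices ((j : ℝ) + 2) ^ 2 - ((j - 3 : ℕ) : ℝ) ^ 2 ≤ 16 * i by
    have := mul_le_mul_of_nonneg_left this h0.le
    linarith
  rcases Nat.lt_or_ge j 3 with hj | hj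
  · have : (j : ℝ) ≤ 2 := by exact_mod_cast (by omega : j ≤ 2)
    have := sq_nonneg ((j - 3 : ℕ) : ℝ)
    nlinarith
  · rw [Nat.cast_sub hj]
    push_cast
    nlinarith

/-- Subtracting the constant `q(p)` makes the polynomial of size at most `9 L l` on `I**_j`, so `l ^
2` cancels in the variance bound; `162 = 2 * 9 ^ 2`. -/
theorem binomExp_unbiasedEval_sub_eval_sq_le (h : IsSetup c lam B n g q)
    (hp : p ∈ Set.Icc (0 : ℝ) 1) :
    binomExp p n (fun l => (unbiasedEval n (q (idx c n p)) ((l : ℝ) / n)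
        - (q (idx c n p)).eval p) ^ 2)
      ≤ 162 * (((n : ℝ) ^ lam) ^ 2 * (localDeriv c g n p ^ 2 * p / n)) := by
  have hn := h.pos
  have hp0 := hp.1
  obtain ⟨hj, hjM, -⟩ := idx_spec h.c_ge h.two_le hp
  have hpj := mem_widePiece_idx h.c_ge h.two_le hp (j := idx c n p) (by omega) (by omega)
  have hL := slope_le_localDeriv (g := g) (h.self_mem_nearby hp)
  set j := idx c n p with hjdef
  set L := localDeriv c g n p
  have hl := (h.long hj hjM).length_pos
  have hdp := (widePiece_props h.c_ge h.lam_lt h.two_le hj hjM).2.2 p hpj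
  have h20 := twenty_mul_deg_le h.two_le h.lam_lt
  have hd := h.deg_le_nat
  have hq := h.natDegree_le hj hjM
  have hD := h.dev_le_slope hj hjM
  have hpj' := hpj
  rw [widePiece_eq] at hpj'
  set a := (q j).eval p with ha
  set l := wideLength c n j with hldef
  have hLl : slope c g n j * l ≤ L * l := mul_le_mul_of_nonneg_right hL hl.le
  have hA : ∀ x ∈ Set.Icc (leftEnd c n j) (leftEnd c n j + l),
      |(q j - C a).eval x| ≤ 9 * (L * l) := by
    intro x hx
    rw [hldef, ← widePiece_eq] at hx
    rw [eval_sub, eval_C, ha]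
    have h1 := h.osc_le hj hjM hx hpj
    have h2 := h.abs_eval_sub_eval_le hj hjM hx hpj
    linarith
  have hV := binomExp_unbiasedEval_sub_sq_le hp0 hp.2 hl hpj' (by omega) hdp
    (q := q j - C a) (by rw [natDegree_sub_C]; exact hq) (by exact_mod_cast hn) hA
  have e : binomExp p n (fun k => (unbiasedEval n (q j - C a) ((k : ℝ) / n)
      - (q j - C a).eval p) ^ 2)
      = binomExp p n (fun k => (unbiasedEval n (q j) ((k : ℝ) / n) - a) ^ 2) := by
    refine binomExp_congr fun k hk => ?_
    rw [unbiasedEval_sub (hq.trans hd) (by simp) hk, unbiasedEval_C, eval_sub, eval_C, ← ha,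
      sub_self, sub_zero]
  rw [e] at hV
  refine hV.trans ?_
  have h1 := deg_mul_ten_pow_le h.two_le h.lam_lt
  have h2 := ten_pow_deg_le h.two_le h.lam_pos h.lam_lt
  have h3 : (deg lam n : ℝ) * 10 ^ deg lam n * 10 ^ deg lam n ≤ ((n : ℝ) ^ lam) ^ 2 := by
    rw [pow_two]; gcongr
  calc _ = 162 * ((deg lam n : ℝ) * 10 ^ deg lam n * 10 ^ deg lam n * (L ^ 2 * p / n)) := by
        field_simp; ring
    _ ≤ _ := by gcongr

/-- The effect of the first frequency, if both frequencies are typical. -/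
theorem sq_estimator_sub_le (h : IsSetup c lam B n g q) (hp : p ∈ Set.Icc (0 : ℝ) 1) {k l : ℕ}
    (hk : k ≤ n) (hl : l ≤ n) (hkp : ¬ IsAtypical c n p k) (hlp : ¬ IsAtypical c n p l) :
    (estimator c n q ((k : ℝ) / n) ((l : ℝ) / n)
        - unbiasedEval n (q (idx c n p)) ((l : ℝ) / n)) ^ 2
      ≤ 147456 * (((n : ℝ) ^ lam) ^ 2 * (localDeriv c g n p ^ 2 * (cn c n * p))) := by
  have hn := h.pos
  have hp0 := hp.1
  have h0 := cn_pos h.c_ge h.two_le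
  rw [h.estimator_eq_of_typical hp hk hl hkp hlp]
  have hL0 := localDeriv_nonneg c g n p
  -- Near 0 the comparison `c_n i² ≤ 4p` fails, but there both indices are 1 and the two estimators
  -- coincide.
  rcases lt_or_ge p (cn c n / 4) with hpc | hpc
  · have e1 : idx c n p = 1 := idx_eq_one h.c_ge h.two_le hp (by linarith)
    have e2 : idx c n ((k : ℝ) / n) = 1 := by
      refine idx_eq_one h.c_ge h.two_le (h.natCast_div_mem hk) ?_
      have h1 := (abs_le.1 (not_lt.1 hkp)).2
      have h2 : √p ≤ √(cn c n) / 2 := by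
        refine Real.sqrt_le_iff.2 ⟨by positivity, ?_⟩
        rw [div_pow, Real.sq_sqrt h0.le]
        linarith
      have h3 : √((k : ℝ) / n) ≤ √(cn c n) := by linarith
      exact (Real.sqrt_le_sqrt_iff h0.le).1 h3
    rw [e1, e2, sub_self]
    norm_num
    positivity
  · obtain ⟨i1, iM, i3⟩ := idx_spec h.c_ge h.two_le hp
    have hself := h.self_mem_nearby hp
    have hjn := h.idx_mem_nearby hp hk hkp
    have hk2 := h.idx_near_of_typical hp hk hkp
    have hl2 := h.idx_near_of_typical hp hl hlp
    have hLj := slope_le_localDeriv (g := g) hjn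
    have hLi := slope_le_localDeriv (g := g) hself
    have hl' := h.natCast_div_mem hl
    have hd := h.abs_unbiasedEval_sub_le hjn.1 hjn.2.1 i1 iM (by omega) (by omega) hl
      (mem_widePiece_idx h.c_ge h.two_le hl' (by omega) (by omega))
      (mem_widePiece_idx h.c_ge h.two_le hl' (by omega) (by omega))
    have hDj := h.dev_le_slope hjn.1 hjn.2.1
    have hDi := h.dev_le_slope i1 iM
    have hwj := h.wideLength_le i1 hk2.1
    have hwi := h.wideLength_le (j := idx c n p) i1 (by omega)
    have hwj0 := (h.long hjn.1 hjn.2.1).length_pos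
    have hwi0 := (h.long i1 iM).length_pos
    set j := idx c n ((k : ℝ) / n)
    set i := idx c n p with hi
    set L := localDeriv c g n p
    have hDj' : dev lam c g n j ≤ 3 * (L * (16 * (cn c n * i))) := by
      refine hDj.trans ?_
      gcongr
    have hDi' : dev lam c g n i ≤ 3 * (L * (16 * (cn c n * i))) := by
      refine hDi.trans ?_
      gcongr
    have h10 := ten_pow_deg_le h.two_le h.lam_pos h.lam_lt
    have hDj0 := dev_nonneg lam c g n j
    have hDi0 := dev_nonneg lam c g n i
    have hT : |unbiasedEval n (q j) ((l : ℝ) / n) - unbiasedEval n (q i) ((l : ℝ) / n)|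
        ≤ (n : ℝ) ^ lam * (192 * (L * (cn c n * i))) := by
      refine hd.trans ?_
      have : 2 * dev lam c g n j + 2 * dev lam c g n i ≤ 192 * (L * (cn c n * i)) := by linarith
      gcongr
    have hpi : cn c n * (i : ℝ) ^ 2 ≤ 4 * p := by
      rcases Nat.lt_or_ge i 2 with hi2 | hi2
      · have : i = 1 := by omega
        rw [this]; push_cast; linarith
      · have h1 := i3.1
        have h2 : ((i - 1 : ℕ) : ℝ) = i - 1 := by rw [Nat.cast_sub i1]; norm_num
        rw [h2] at h1
        have h3 : (2 : ℝ) ≤ i := by exact_mod_cast hi2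
        have h4 : (i : ℝ) ^ 2 ≤ 4 * ((i : ℝ) - 1) ^ 2 := by nlinarith
        nlinarith [mul_le_mul_of_nonneg_left h4 h0.le]
    rw [← sq_abs]
    calc _ ≤ ((n : ℝ) ^ lam * (192 * (L * (cn c n * i)))) ^ 2 := by gcongr
      _ = 36864 * (((n : ℝ) ^ lam) ^ 2 * (L ^ 2 * (cn c n * (cn c n * (i : ℝ) ^ 2)))) := by ring
      _ ≤ 36864 * (((n : ℝ) ^ lam) ^ 2 * (L ^ 2 * (cn c n * (4 * p)))) := by gcongr
      _ = _ := by ring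

open Classical in
theorem sampleExp_sq_le (h : IsSetup c lam B n g q) (hp : p ∈ Set.Icc (0 : ℝ) 1) :
    sampleExp p n (fun x y => (estimator c n q x y - (q (idx c n p)).eval p) ^ 2)
      ≤ 324 * (((n : ℝ) ^ lam) ^ 2 * (localDeriv c g n p ^ 2 * p / n))
        + 294912 * (((n : ℝ) ^ lam) ^ 2 * (localDeriv c g n p ^ 2 * (cn c n * p)))
        + 7200 * B ^ 2 * (p / n ^ 5) := by
  have hn := h.pos
  have hn1 := h.one_le_cast
  have hB := h.B_pos
  have hp0 := hp.1
  have hp1 := hp.2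
  obtain ⟨i1, iM, i3⟩ := idx_spec h.c_ge h.two_le hp
  have hpi := mem_widePiece_idx h.c_ge h.two_le hp (j := idx c n p) (by omega) (by omega)
  have ha := h.abs_eval_le i1 iM hpi
  have h0 := cn_pos h.c_ge h.two_le
  set i := idx c n p
  set a := (q i).eval p
  set bad : ℕ → ℝ := fun l => if IsAtypical c n p l then 1 else 0 with hbad
  have hP : binomExp p n bad ≤ 100 * p ^ 2 / n ^ 20 :=
    binomProb_isAtypical_le h.c_ge h.two_le hp0 hp1
  have hbad0 : ∀ l, 0 ≤ bad l := fun l => by simp only [hbad]; split_ifs <;> norm_num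
  set u : ℕ → ℝ := fun l => unbiasedEval n (q i) ((l : ℝ) / n) with hu
  set T := 147456 * (((n : ℝ) ^ lam) ^ 2 * (localDeriv c g n p ^ 2 * (cn c n * p))) with hT
  have hT0 : 0 ≤ T := by positivity
  -- Atypical counts pay the crude bound `(6Bn)²`; otherwise the deviation splits into the effect of
  -- exchanging the polynomial and the fluctuation of the unbiased estimator of `q_i(p)`.
  have hpt : ∀ k ≤ n, ∀ l ≤ n, (estimator c n q ((k : ℝ) / n) ((l : ℝ) / n) - a) ^ 2
      ≤ 36 * B ^ 2 * n ^ 2 * bad k + (2 * T + 36 * B ^ 2 * n ^ 2 * bad l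
        + 2 * (u l - a) ^ 2) := by
    intro k hk l hl
    have hcrude : (estimator c n q ((k : ℝ) / n) ((l : ℝ) / n) - a) ^ 2
        ≤ 36 * B ^ 2 * n ^ 2 := by
      rw [← sq_abs]
      have h1 := (abs_sub (estimator c n q ((k : ℝ) / n) ((l : ℝ) / n)) a).trans
        (add_le_add (h.abs_estimator_le hk hl) ha)
      calc _ ≤ (6 * B * n) ^ 2 := by
            gcongr
            refine h1.trans ?_
            nlinarith
        _ = _ := by ring
    have hsq := sq_nonneg (u l - a)
    by_cases hkp : IsAtypical c n p k
    · have e : bad k = 1 := if_pos hkp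
      have : 0 ≤ 36 * B ^ 2 * n ^ 2 * bad l := mul_nonneg (by positivity) (hbad0 l)
      rw [e]; linarith
    by_cases hlp : IsAtypical c n p l
    · have e : bad l = 1 := if_pos hlp
      have : 0 ≤ 36 * B ^ 2 * n ^ 2 * bad k := mul_nonneg (by positivity) (hbad0 k)
      rw [e]; linarith
    have ek : bad k = 0 := if_neg hkp
    have el : bad l = 0 := if_neg hlp
    have hd := h.sq_estimator_sub_le hp hk hl hkp hlp
    rw [ek, el]
    change (estimator c n q ((k : ℝ) / n) ((l : ℝ) / n) - u l) ^ 2 ≤ T at hd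
    nlinarith [sq_nonneg (estimator c n q ((k : ℝ) / n) ((l : ℝ) / n) - u l - (u l - a))]
  have hstep : sampleExp p n (fun x y => (estimator c n q x y - a) ^ 2)
      ≤ binomExp p n fun k => binomExp p n fun l =>
        36 * B ^ 2 * n ^ 2 * bad k + (2 * T + 36 * B ^ 2 * n ^ 2 * bad l + 2 * (u l - a) ^ 2) :=
    binomExp_mono hp0 hp1 fun k hk => binomExp_mono hp0 hp1 fun l hl => hpt k hk l hl
  simp only [binomExp_add, binomExp_const, binomExp_const_mul] at hstep
  have hV := h.binomExp_unbiasedEval_sub_eval_sq_le hp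
  change binomExp p n (fun l => (u l - a) ^ 2) ≤ _ at hV
  have hb1 : 36 * B ^ 2 * n ^ 2 * binomExp p n bad ≤ 3600 * B ^ 2 * (p / n ^ 5) := by
    have h5 : (n : ℝ) ^ 2 / n ^ 20 ≤ 1 / n ^ 5 := by
      rw [div_le_div_iff₀ (by positivity) (by positivity), one_mul, ← pow_add]
      exact pow_le_pow_right₀ hn1 (by norm_num)
    have h6 : p ^ 2 ≤ p := by nlinarith
    calc _ ≤ 36 * B ^ 2 * n ^ 2 * (100 * p ^ 2 / n ^ 20) := by gcongr
      _ = 3600 * (B ^ 2 * p ^ 2) * ((n : ℝ) ^ 2 / n ^ 20) := by ring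
      _ ≤ 3600 * (B ^ 2 * p) * (1 / n ^ 5) := by gcongr
      _ = _ := by ring
  linarith

theorem variance_le (h : IsSetup c lam B n g q) (p : unitInterval) :
    Var[sampleEstimator c n q; sampleLaw p (n + n)]
      ≤ (648 + 294912 * (c / lam)) * (localDeriv c g n p ^ 2 * p / (2 * n : ℝ) ^ (1 - 4 * lam))
        + 230400 * B ^ 2 * ((p : ℝ) / (2 * n : ℝ) ^ 5) := by
  have hn := h.pos
  have hn1 := h.one_le_cast
  have hlam := h.lam_pos
  have hc : 0 < c := by linarith [h.c_ge]
  have hp0 : 0 ≤ (p : ℝ) := p.2.1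
  refine (variance_sampleEstimator_le p c n q _).trans ((h.sampleExp_sq_le p.2).trans ?_)
  set L := localDeriv c g n p
  set N := (n : ℝ) ^ lam with hN
  have hN1 : 1 ≤ N := Real.one_le_rpow hn1 hlam.le
  -- The logarithm in `c_n` is absorbed into another `n ^ (2 * lam)`: hence the exponent `1 - 4 *
  -- lam` and the dependence of the constant on `lam`.
  have hlog : Real.log n ≤ N ^ 2 / (2 * lam) := by
    have := Real.log_le_rpow_div hn.le (by positivity : 0 < 2 * lam)
    rwa [mul_comm 2 lam, Real.rpow_mul hn.le, Real.rpow_ofNat, mul_comm lam 2] at this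
  have hcn : cn c n ≤ c * (N ^ 2 / (2 * lam)) / n := by
    unfold cn; gcongr
  have hNN : N ^ 4 / n ≤ 2 / (2 * n : ℝ) ^ (1 - 4 * lam) := by
    have e1 : (2 * n : ℝ) ^ (1 - 4 * lam) ≤ 2 * (n : ℝ) ^ (1 - 4 * lam) := by
      rw [Real.mul_rpow (by norm_num) hn.le]
      gcongr
      calc (2 : ℝ) ^ (1 - 4 * lam) ≤ 2 ^ (1 : ℝ) :=
            Real.rpow_le_rpow_of_exponent_le (by norm_num) (by linarith)
        _ = 2 := Real.rpow_one _
    have e2 : (n : ℝ) ^ (1 - 4 * lam) * N ^ 4 = n := by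
      rw [hN, ← Real.rpow_natCast ((n : ℝ) ^ lam), ← Real.rpow_mul hn.le, ← Real.rpow_add hn]
      have : 1 - 4 * lam + lam * ((4 : ℕ) : ℝ) = 1 := by push_cast; ring
      rw [this, Real.rpow_one]
    rw [div_le_div_iff₀ hn (by positivity)]
    calc N ^ 4 * (2 * n : ℝ) ^ (1 - 4 * lam) ≤ N ^ 4 * (2 * (n : ℝ) ^ (1 - 4 * lam)) := by gcongr
      _ = 2 * (n : ℝ) := by linear_combination 2 * e2
  have hLp : 0 ≤ L ^ 2 * (p : ℝ) := by positivity
  have t1 : 324 * (N ^ 2 * (L ^ 2 * p / n))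
      ≤ 648 * (L ^ 2 * p / (2 * n : ℝ) ^ (1 - 4 * lam)) := by
    calc _ ≤ 324 * (N ^ 4 * (L ^ 2 * p / n)) := by
          gcongr
          norm_num
      _ = 324 * (L ^ 2 * p) * (N ^ 4 / n) := by ring
      _ ≤ 324 * (L ^ 2 * p) * (2 / (2 * n : ℝ) ^ (1 - 4 * lam)) := by gcongr
      _ = _ := by ring
  have t2 : 294912 * (N ^ 2 * (L ^ 2 * (cn c n * p)))
      ≤ 294912 * (c / lam) * (L ^ 2 * p / (2 * n : ℝ) ^ (1 - 4 * lam)) := by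
    calc _ ≤ 294912 * (N ^ 2 * (L ^ 2 * (c * (N ^ 2 / (2 * lam)) / n * p))) := by gcongr
      _ = 147456 * (c / lam) * (L ^ 2 * p) * (N ^ 4 / n) := by field_simp; ring
      _ ≤ 147456 * (c / lam) * (L ^ 2 * p) * (2 / (2 * n : ℝ) ^ (1 - 4 * lam)) := by gcongr
      _ = _ := by ring
  have t3 : 7200 * B ^ 2 * ((p : ℝ) / n ^ 5) = 230400 * B ^ 2 * ((p : ℝ) / (2 * n : ℝ) ^ 5) := by
    field_simp; ring
  rw [t3]
  linarith

end IsSetup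

end

end PiecewiseMinMax

theorem theorem4 :
    ∃ c₀ : ℝ, 0 < c₀ ∧ ∀ c : ℝ, c₀ ≤ c → ∀ lam : ℝ, 0 < lam → lam < 1 / 4 → ∀ B : ℝ, 0 < B →
    ∃ C κ : ℝ, 0 < C ∧ 0 < κ ∧
      ∀ n : ℕ, 2 ≤ n → ∀ g : ℝ → ℝ, (∀ x ∈ Set.Icc (0 : ℝ) 1, |g x| ≤ B) →
      ∀ q : ℕ → ℝ[X], IsLocalApprox lam c g n q →
      ∀ p : unitInterval,
        |(∫ X, sampleEstimator c n q X ∂(sampleLaw p (n + n))) - g p|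
            ≤ C * ((p : ℝ) / (2 * n : ℝ) ^ 3 + localDev lam c g n p / (2 * n)) ∧
        Var[sampleEstimator c n q; sampleLaw p (n + n)]
            ≤ C * ((p : ℝ) / (2 * n : ℝ) ^ 5
                + localDeriv c g n p ^ 2 * p / (2 * n : ℝ) ^ (1 - 4 * lam)) ∧
        ∀ ε : ℝ, 0 < ε →
          (sampleLaw p (n + n)).real
              {X | ε < |sampleEstimator c n q X
                    - ∫ Y, sampleEstimator c n q Y ∂(sampleLaw p (n + n))|}
            ≤ if totalDev lam c g n = 0 then 0 else
                C * Real.exp (-(κ * (ε ^ 2 * (2 * n : ℝ) ^ (1 - 2 * lam)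
                  / totalDev lam c g n ^ 2))) := by
  refine ⟨100, by norm_num, fun c hc lam hlam0 hlam1 B hB => ?_⟩
  have hcl : 0 < c / lam := by positivity
  -- The sum dominates all constants required by the three bounds; `6080 = 760 * 2 ^ 3` comes from
  -- passing from `n` to `2 * n`.
  refine ⟨6080 * B + 6 + (648 + 294912 * (c / lam)) + 230400 * B ^ 2, 1 / 1800, by positivity,
    by norm_num, fun n hn g hg q hq p => ?_⟩
  have h : IsSetup c lam B n g q := ⟨hc, hlam0, hlam1, hB, hn, hg, hq⟩
  have hn0 := h.pos
  have hp0 : 0 ≤ (p : ℝ) := p.2.1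
  have hB2 : 0 ≤ B ^ 2 := sq_nonneg B
  set K := 6080 * B + 6 + (648 + 294912 * (c / lam)) + 230400 * B ^ 2 with hK
  refine ⟨?_, ?_, fun ε hε => ?_⟩
  · rw [integral_sampleEstimator]
    refine (h.bias_le p.2).trans ?_
    have e1 : 760 * B * ((p : ℝ) / n ^ 3) = 6080 * B * ((p : ℝ) / (2 * n : ℝ) ^ 3) := by
      field_simp; ring
    have e2 : 2 * (localDev lam c g n p / n) = 4 * (localDev lam c g n p / (2 * n)) := by
      field_simp; ring
    have h1 : 0 ≤ (p : ℝ) / (2 * n : ℝ) ^ 3 := by positivity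
    have h2 : 0 ≤ localDev lam c g n p / (2 * n) :=
      div_nonneg (IsSetup.localDev_nonneg lam c g n p) (by positivity)
    rw [e1, e2, mul_add]
    refine add_le_add (mul_le_mul_of_nonneg_right ?_ h1) (mul_le_mul_of_nonneg_right ?_ h2) <;>
      linarith
  · refine (h.variance_le p).trans ?_
    have h1 : 0 ≤ (p : ℝ) / (2 * n : ℝ) ^ 5 := by positivity
    have h2 : 0 ≤ localDeriv c g n p ^ 2 * p / (2 * n : ℝ) ^ (1 - 4 * lam) := by positivity
    rw [mul_add, add_comm]
    refine add_le_add (mul_le_mul_of_nonneg_right ?_ h1) (mul_le_mul_of_nonneg_right ?_ h2) <;>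
      linarith
  · refine (h.deviation_le p hε).trans ?_
    split_ifs with h0
    · exact le_rfl
    · refine mul_le_mul_of_nonneg_right ?_ (Real.exp_pos _).le
      linarith
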